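/- Let $S$ be a one-dimensional complex manifold (Hausdorff and second countable). Let $\mathscr L_c(S)=\Omega^{0,*}_c(S,T_S)$ be the dg Lie algebra of compactly supported smooth Dolbeault forms with values in the holomorphic tangent bundle, with differential $\bar\partial$ and the bracket extending that of vector fields. In a holomorphic coordinate $z:U_z\to\mathbf C$ write $X=(\alpha_0+\alpha_1\,d\bar z)\partial_z$ and $Y=(\beta_0+\beta_1\,d\bar z)\partial_z$. A projective connection $\nabla$ on $S$ is a family of holomorphic functions $\rho_z$, one for each coordinate, such that $\rho_w=(\rho_z\circ f)\,(f')^2+S(f)$ for every holomorphic change of coordinate $z=f(w)$, where $S(f)=(f''/f')'-\frac12(f''/f')^2$ is the Schwarzian. For $X,Y\in\mathscr L_c(U_z)$ put $$\omega_{\nabla,z}(X,Y)=\omega_z(X,Y)+\nabla_z\cdot[X,Y],$$ $$\omega_z(X,Y)=\frac1{2\pi}\frac1{12}\int\left(\partial_z^3\alpha_0\,\beta_1+\partial_z^3\alpha_1\,\beta_0\right)d^2z,\qquad \nabla_z\cdot V=-\frac1{2\pi}\frac1{12}\int\rho_z\,V_1\,d^2z,$$ where $V_1\,d\bar z\,\partial_z$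 is the component of $V$ of form degree $1$ and $d^2z=dx\,dy$. Then the following hold. 1. For every coordinate $z$, $\omega_{\nabla,z}$ is a cocycle on $\mathscr L_c(U_z)$ (defining a $(-1)$-shifted central extension). 2. $\omega_{\nabla,z}$ is invariant under holomorphic changes of coordinate: $\omega_{\nabla,z}(X,Y)=\omega_{\nabla,w}(X,Y)$ whenever $X,Y$ are compactly supported where both $z$ and $w$ are defined. More precisely, the expressions $$\frac1{24\pi}\Big(\tfrac12\big(\partial_z^3\alpha_0\,\beta_1-\alpha_0\,\partial_z^3\beta_1+\partial_z^3\alpha_1\,\beta_0-\alpha_1\,\partial_z^3\beta_0\big)-\rho_z\,[X,Y]_1\Big)\,d^2z$$ define a global compactly supported $(1,1)$-form on $S$ for all $X,Y\in\mathscr L_c(S)$; its integral $\omega_\nabla(X,Y)$ is a cocycle on $\mathscr L_c(S)$ which agrees with $\omega_{\nabla,z}$ on each $\mathscr L_c(U_z)$. For every holomorphic embedding $f:S\to T$ and projective connection $\nabla$ on $T$, $\omega_{f^*\nabla}(X,Y)=\omega_\nabla(f_*X,f_*Y)$, where $f_*$ is extension by zero. 3. If $\nabla'$ is another projective connection on $S$,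 then $\omega_\nabla-\omega_{\nabla'}$ is the coboundary of the functional $\Phi_{\nabla,\nabla'}(X)=(\nabla-\nabla')\cdot X=-\frac1{24\pi}\int_S(\rho-\rho')X_1$; that is, $\Phi_{\nabla,\nabla'}\circ\bar\partial=0$ and $\omega_\nabla(X,Y)-\omega_{\nabla'}(X,Y)=\Phi_{\nabla,\nabla'}([X,Y])$. The corresponding statement holds for $\omega_{\nabla,z}-\omega_{\nabla',z}$ on each $\mathscr L_c(U_z)$. 4. Consequently the Virasoro central extension is universal. For each pair $(S,\nabla)$, $\hat{\mathscr L}_c(S,\nabla)=\mathscr L_c(S)\oplus\mathbf C c$, with $c$ in degree $1$ and bracket $[X,Y]+\omega_\nabla(X,Y)\,c$, is a dg Lie algebra. For all $(S,\nabla)$, $(T,\nabla')$ and every holomorphic embedding $f:S\to T$ (with no compatibility between $\nabla$ and $f^*\nabla'$ assumed), the map $(X,t)\mapsto(f_*X,\;t+\Phi_{f^*\nabla',\nabla}(X))$ is a homomorphism of dg Lie algebras $\hat{\mathscr L}_c(S,\nabla)\to\hat{\mathscr L}_c(T,\nabla')$, and these maps respect identities and composition. In particular the extensions belonging to different projective connections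 on one surface are canonically isomorphic, compatibly with all holomorphic embeddings. Surfaces embedded in a third one with disjoint images give commuting subalgebras, and if the images also cover, then $\mathscr L_c$ of the third surface is the direct sum of the two $\mathscr L_c$'s. -/

import Mathlib

open scoped Manifold ContDiff Topology

universe u

noncomputable section

/-! ## One-dimensional complex manifolds and holomorphic coordinates -/

/-- A one-dimensional complex manifold (not necessarily connected or compact). -/
structure RiemannSurface where
  carrier : Type u
  [top : TopologicalSpace carrier]
  [t2 : T2Space carrier]
  [secondCountable : SecondCountableTopology carrier]
  [charted : ChartedSpace ℂ carrier]
  [manifold : IsManifold 𝓘(ℂ) ω carrier]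

namespace RiemannSurface

instance : CoeSort RiemannSurface.{u} (Type u) := ⟨carrier⟩

attribute [instance] top t2 secondCountable charted manifold

/-- A holomorphic coordinate `z : U → ℂ` on an open subset `U = source`: a homeomorphism onto an
open subset of `ℂ`, holomorphic together with its inverse. -/
structure Coord (S : RiemannSurface.{u}) extends OpenPartialHomeomorph S ℂ where
  holo : ContMDiffOn 𝓘(ℂ) 𝓘(ℂ) ω toOpenPartialHomeomorph source
  holo_symm : ContMDiffOn 𝓘(ℂ) 𝓘(ℂ) ω toOpenPartialHomeomorph.symm target

/-- The preferred coordinate at a point. -/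
def coordAt (S : RiemannSurface.{u}) (x : S) : S.Coord where
  toOpenPartialHomeomorph := chartAt ℂ x
  holo := contMDiffOn_chart
  holo_symm := contMDiffOn_chart_symm

variable {S T : RiemannSurface.{u}}

/-- The inverse of a coordinate. -/
abbrev Coord.inv (φ : S.Coord) : ℂ → S := φ.toOpenPartialHomeomorph.symm

/-- The change of coordinate `w = ψ ∘ φ⁻¹`. -/
def trans (φ ψ : S.Coord) : ℂ → ℂ := fun z => ψ.toOpenPartialHomeomorph (φ.inv z)

/-- The open set of `φ`-coordinates of the points at which `ψ` is also defined. -/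
def overlap (φ ψ : S.Coord) : Set ℂ := φ.target ∩ φ.inv ⁻¹' ψ.source

/-- Holomorphic embeddings, i.e. biholomorphisms onto open subsets. -/
structure IsHolEmbedding (f : S → T) : Prop where
  isOpenEmbedding : Topology.IsOpenEmbedding f
  isLocalBihol : IsLocalDiffeomorph 𝓘(ℂ) 𝓘(ℂ) ω f

/-! ## Calculus in a coordinate -/

/-- `∂/∂z = (∂/∂x - i ∂/∂y) / 2`. -/
def dz (f : ℂ → ℂ) (z : ℂ) : ℂ := (fderiv ℝ f z 1 - Complex.I * fderiv ℝ f z Complex.I) / 2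

/-- `∂/∂z̄ = (∂/∂x + i ∂/∂y) / 2`. -/
def dzbar (f : ℂ → ℂ) (z : ℂ) : ℂ := (fderiv ℝ f z 1 + Complex.I * fderiv ℝ f z Complex.I) / 2

/-- The Schwarzian derivative `(f''/f')' - (1/2) (f''/f')²`. -/
def schwarzian (f : ℂ → ℂ) (z : ℂ) : ℂ :=
  deriv (fun w => deriv (deriv f) w / deriv f w) z - (1 / 2) * (deriv (deriv f) z / deriv f z) ^ 2

/-! ## Tensor fields -/

/-- A smooth section of `K^p ⊗ K̄^q` (`K` the holomorphic cotangent bundle), given by its coefficient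
function `c φ` with respect to `(dz)^p (dz̄)^q` in each holomorphic coordinate `z = φ`. A coefficient
is defined on `φ.target`; outside it is given the value `0`. -/
structure IsTensor (S : RiemannSurface.{u}) (p q : ℤ) (c : S.Coord → ℂ → ℂ) : Prop where
  smooth : ∀ φ, ContDiffOn ℝ ∞ (c φ) φ.target
  zero : ∀ φ, ∀ z ∉ φ.target, c φ z = 0
  law : ∀ φ ψ, ∀ z ∈ overlap φ ψ,
    c φ z = c ψ (trans φ ψ z) * deriv (trans φ ψ) z ^ p
      * (starRingEnd ℂ) (deriv (trans φ ψ) z) ^ q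

/-- The tensor field with coefficients `c` vanishes outside the set `K`. -/
def VanishesOff (K : Set S) (c : S.Coord → ℂ → ℂ) : Prop :=
  ∀ φ, ∀ z ∈ φ.target, φ.inv z ∉ K → c φ z = 0

/-- The tensor field with coefficients `c` has compact support contained in `U`. -/
def SupportedIn (U : Set S) (c : S.Coord → ℂ → ℂ) : Prop :=
  ∃ K ⊆ U, IsCompact K ∧ VanishesOff K c

theorem isTensor_zero (p q : ℤ) : IsTensor S p q 0 where
  smooth _ := contDiffOn_const
  zero _ _ _ := rfl
  law _ _ _ _ := by simp

theorem IsTensor.add {p q : ℤ} {c d : S.Coord → ℂ → ℂ} (hc : IsTensor S p q c)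
    (hd : IsTensor S p q d) : IsTensor S p q (c + d) where
  smooth φ := (hc.smooth φ).add (hd.smooth φ)
  zero φ z hz := by simp [hc.zero φ z hz, hd.zero φ z hz]
  law φ ψ z hz := by
    simp only [Pi.add_apply]
    rw [hc.law φ ψ z hz, hd.law φ ψ z hz]; ring

theorem IsTensor.smul {p q : ℤ} {c : S.Coord → ℂ → ℂ} (a : ℂ) (hc : IsTensor S p q c) :
    IsTensor S p q (a • c) where
  smooth φ := (hc.smooth φ).const_smul a
  zero φ z hz := by simp [hc.zero φ z hz]
  law φ ψ z hz := by
    simp only [Pi.smul_apply, smul_eq_mul]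
    rw [hc.law φ ψ z hz]; ring

theorem SupportedIn.zero (U : Set S) : SupportedIn U (0 : S.Coord → ℂ → ℂ) :=
  ⟨∅, Set.empty_subset _, isCompact_empty, fun _ _ _ _ => rfl⟩

theorem SupportedIn.add {U : Set S} {c d : S.Coord → ℂ → ℂ} (hc : SupportedIn U c)
    (hd : SupportedIn U d) : SupportedIn U (c + d) := by
  obtain ⟨K, hKU, hK, h⟩ := hc
  obtain ⟨L, hLU, hL, h'⟩ := hd
  refine ⟨K ∪ L, Set.union_subset hKU hLU, hK.union hL, fun φ z hz hn => ?_⟩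
  simp only [Set.mem_union, not_or] at hn
  simp [h φ z hz hn.1, h' φ z hz hn.2]

theorem SupportedIn.smul {U : Set S} {c : S.Coord → ℂ → ℂ} (a : ℂ) (hc : SupportedIn U c) :
    SupportedIn U (a • c) := by
  obtain ⟨K, hKU, hK, h⟩ := hc
  exact ⟨K, hKU, hK, fun φ z hz hn => by simp [h φ z hz hn]⟩

/-- Compactly supported smooth sections of `K^p ⊗ K̄^q`. -/
def Sections (S : RiemannSurface.{u}) (p q : ℤ) : Submodule ℂ (S.Coord → ℂ → ℂ) where
  carrier := {c | IsTensor S p q c ∧ SupportedIn Set.univ c}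
  zero_mem' := ⟨isTensor_zero p q, SupportedIn.zero _⟩
  add_mem' hc hd := ⟨hc.1.add hd.1, hc.2.add hd.2⟩
  smul_mem' a _ hc := ⟨hc.1.smul a, hc.2.smul a⟩

/-! ## Changes of coordinate -/

theorem isOpen_overlap (φ ψ : S.Coord) : IsOpen (overlap φ ψ) :=
  φ.toOpenPartialHomeomorph.isOpen_inter_preimage_symm ψ.open_source

theorem contDiffOn_trans (φ ψ : S.Coord) : ContDiffOn ℂ ω (trans φ ψ) (overlap φ ψ) := by
  rw [← contMDiffOn_iff_contDiffOn]
  exact ψ.holo.comp (φ.holo_symm.mono Set.inter_subset_left) (fun z hz => hz.2)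

theorem analyticAt_trans (φ ψ : S.Coord) {z : ℂ} (hz : z ∈ overlap φ ψ) :
    AnalyticAt ℂ (trans φ ψ) z :=
  ((contDiffOn_trans φ ψ).contDiffAt ((isOpen_overlap φ ψ).mem_nhds hz)).analyticAt

theorem trans_mem (φ ψ : S.Coord) {z : ℂ} (hz : z ∈ overlap φ ψ) :
    trans φ ψ z ∈ overlap ψ φ :=
  ⟨ψ.map_source hz.2, by
    simp only [trans, Coord.inv, Set.mem_preimage]
    rw [ψ.left_inv hz.2]
    exact φ.map_target hz.1⟩

theorem trans_trans_self (φ ψ : S.Coord) {z : ℂ} (hz : z ∈ overlap φ ψ) :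
    trans ψ φ (trans φ ψ z) = z := by
  simp only [trans, Coord.inv]
  rw [ψ.left_inv hz.2]
  exact φ.right_inv hz.1

theorem deriv_trans_ne_zero (φ ψ : S.Coord) {z : ℂ} (hz : z ∈ overlap φ ψ) :
    deriv (trans φ ψ) z ≠ 0 := by
  intro h0
  have h1 := (analyticAt_trans φ ψ hz).differentiableAt.hasDerivAt
  have h2 := (analyticAt_trans ψ φ (trans_mem φ ψ hz)).differentiableAt.hasDerivAt
  have h3 := h2.comp z h1
  have h4 : HasDerivAt (trans ψ φ ∘ trans φ ψ) 1 z :=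
    (hasDerivAt_id z).congr_of_eventuallyEq <| by
      filter_upwards [(isOpen_overlap φ ψ).mem_nhds hz] with w hw
      exact trans_trans_self φ ψ hw
  simpa [h0] using h3.unique h4

theorem eventuallyEq_of_vanishesOff {K : Set S} (hK : IsCompact K) {c : S.Coord → ℂ → ℂ}
    (h : VanishesOff K c) (φ : S.Coord) {z : ℂ} (hz : z ∈ φ.target) (hn : φ.inv z ∉ K) :
    c φ =ᶠ[𝓝 z] 0 := by
  have ho : IsOpen (φ.target ∩ φ.inv ⁻¹' Kᶜ) :=
    φ.toOpenPartialHomeomorph.isOpen_inter_preimage_symm hK.isClosed.isOpen_compl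
  filter_upwards [ho.mem_nhds ⟨hz, hn⟩] with w hw
  exact h φ w hw.1 hw.2

/-! ## Rules for `∂/∂z` and `∂/∂z̄` -/

theorem dz_congr {f g : ℂ → ℂ} {z : ℂ} (h : f =ᶠ[𝓝 z] g) : dz f z = dz g z := by
  simp only [dz, h.fderiv_eq]

theorem dzbar_congr {f g : ℂ → ℂ} {z : ℂ} (h : f =ᶠ[𝓝 z] g) : dzbar f z = dzbar g z := by
  simp only [dzbar, h.fderiv_eq]

theorem dz_zero (z : ℂ) : dz 0 z = 0 := by
  simp [dz]

theorem dzbar_zero (z : ℂ) : dzbar 0 z = 0 := by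
  simp [dzbar]

theorem dz_mul {f g : ℂ → ℂ} {z : ℂ} (hf : DifferentiableAt ℝ f z) (hg : DifferentiableAt ℝ g z) :
    dz (f * g) z = f z * dz g z + dz f z * g z := by
  simp only [dz, fderiv_mul hf hg, add_apply, smul_apply, smul_eq_mul]
  ring

theorem dzbar_mul {f g : ℂ → ℂ} {z : ℂ} (hf : DifferentiableAt ℝ f z)
    (hg : DifferentiableAt ℝ g z) :
    dzbar (f * g) z = f z * dzbar g z + dzbar f z * g z := by
  simp only [dzbar, fderiv_mul hf hg, add_apply, smul_apply, smul_eq_mul]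
  ring

theorem fderiv_real_apply {f : ℂ → ℂ} {z : ℂ} (hf : DifferentiableAt ℂ f z) (v : ℂ) :
    fderiv ℝ f z v = deriv f z * v := by
  rw [(hf.hasFDerivAt.restrictScalars ℝ).fderiv]
  simp [mul_comm]

theorem dzbar_holo {f : ℂ → ℂ} {z : ℂ} (hf : DifferentiableAt ℂ f z) : dzbar f z = 0 := by
  simp only [dzbar, fderiv_real_apply hf]
  linear_combination (deriv f z / 2) * Complex.I_sq

theorem dz_conj_holo {f : ℂ → ℂ} {z : ℂ} (hf : DifferentiableAt ℂ f z) :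
    dz (fun w => (starRingEnd ℂ) (f w)) z = 0 := by
  have h : HasFDerivAt (fun w => (starRingEnd ℂ) (f w))
      ((Complex.conjCLE : ℂ →L[ℝ] ℂ).comp (fderiv ℝ f z)) z :=
    (Complex.conjCLE : ℂ →L[ℝ] ℂ).hasFDerivAt.comp z (hf.restrictScalars ℝ).hasFDerivAt
  simp only [dz, h.fderiv, ContinuousLinearMap.comp_apply, fderiv_real_apply hf]
  simp only [ContinuousLinearEquiv.coe_coe, Complex.conjCLE_apply, map_mul, Complex.conj_I, map_one]
  linear_combination ((starRingEnd ℂ) (deriv f z) / 2) * Complex.I_sq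

theorem fderiv_comp_holo {f τ : ℂ → ℂ} {z : ℂ} (hf : DifferentiableAt ℝ f (τ z))
    (hτ : DifferentiableAt ℂ τ z) (v : ℂ) :
    fderiv ℝ (f ∘ τ) z v = fderiv ℝ f (τ z) (deriv τ z * v) := by
  rw [fderiv_comp z hf (hτ.restrictScalars ℝ), ContinuousLinearMap.comp_apply,
    fderiv_real_apply hτ]

theorem real_linear_apply (L : ℂ →L[ℝ] ℂ) (v : ℂ) : L v = v.re * L 1 + v.im * L Complex.I := by
  conv_lhs => rw [← Complex.re_add_im v]
  have h1 : ((v.re : ℂ)) = v.re • (1 : ℂ) := by simp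
  have h2 : ((v.im : ℂ)) * Complex.I = v.im • Complex.I := by simp
  rw [map_add, h1, h2, map_smul, map_smul]
  simp

theorem dz_comp_holo {f τ : ℂ → ℂ} {z : ℂ} (hf : DifferentiableAt ℝ f (τ z))
    (hτ : DifferentiableAt ℂ τ z) : dz (f ∘ τ) z = dz f (τ z) * deriv τ z := by
  simp only [dz, fderiv_comp_holo hf hτ]
  rw [real_linear_apply _ (deriv τ z * 1), real_linear_apply _ (deriv τ z * Complex.I)]
  conv_rhs => rw [← Complex.re_add_im (deriv τ z)]
  simp only [mul_one, Complex.mul_re, Complex.mul_im, Complex.I_re, Complex.I_im]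
  push_cast
  linear_combination (deriv τ z).im * (fderiv ℝ f (τ z) Complex.I) / 2 * Complex.I_sq

theorem dzbar_comp_holo {f τ : ℂ → ℂ} {z : ℂ} (hf : DifferentiableAt ℝ f (τ z))
    (hτ : DifferentiableAt ℂ τ z) :
    dzbar (f ∘ τ) z = dzbar f (τ z) * (starRingEnd ℂ) (deriv τ z) := by
  simp only [dzbar, fderiv_comp_holo hf hτ]
  rw [real_linear_apply _ (deriv τ z * 1), real_linear_apply _ (deriv τ z * Complex.I)]
  conv_rhs => rw [← Complex.re_add_im (deriv τ z)]
  simp only [mul_one, Complex.mul_re, Complex.mul_im, Complex.I_re, Complex.I_im, map_add, map_mul,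
    Complex.conj_ofReal, Complex.conj_I]
  push_cast
  linear_combination (deriv τ z).im * (fderiv ℝ f (τ z) Complex.I) / 2 * Complex.I_sq

theorem contDiffOn_dz {f : ℂ → ℂ} {s : Set ℂ} (hs : IsOpen s) (hf : ContDiffOn ℝ ∞ f s) :
    ContDiffOn ℝ ∞ (dz f) s := by
  have h : ContDiffOn ℝ ∞ (fderiv ℝ f) s := hf.fderiv_of_isOpen hs (by simp)
  exact ((h.clm_apply contDiffOn_const).sub
    (contDiffOn_const.mul (h.clm_apply contDiffOn_const))).div_const 2

theorem contDiffOn_dzbar {f : ℂ → ℂ} {s : Set ℂ} (hs : IsOpen s) (hf : ContDiffOn ℝ ∞ f s) :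
    ContDiffOn ℝ ∞ (dzbar f) s := by
  have h : ContDiffOn ℝ ∞ (fderiv ℝ f) s := hf.fderiv_of_isOpen hs (by simp)
  exact ((h.clm_apply contDiffOn_const).add
    (contDiffOn_const.mul (h.clm_apply contDiffOn_const))).div_const 2

theorem IsTensor.differentiableAt {p q : ℤ} {c : S.Coord → ℂ → ℂ} (hc : IsTensor S p q c)
    (φ : S.Coord) {z : ℂ} (hz : z ∈ φ.target) : DifferentiableAt ℝ (c φ) z :=
  ((hc.smooth φ).differentiableOn (by simp)).differentiableAt (φ.open_target.mem_nhds hz)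

/-! ## The Dolbeault operator and the Lie bracket -/

/-- The coefficients of `∂̄ c`. -/
def dbarCoeff (c : S.Coord → ℂ → ℂ) : S.Coord → ℂ → ℂ := fun φ => φ.target.indicator (dzbar (c φ))

/-- The coefficients `a ∂b - b ∂a` of a bracket. -/
def bracketCoeff (a b : S.Coord → ℂ → ℂ) : S.Coord → ℂ → ℂ :=
  fun φ z => a φ z * dz (b φ) z - b φ z * dz (a φ) z

theorem IsTensor.dbar {p : ℤ} {c : S.Coord → ℂ → ℂ} (hc : IsTensor S p 0 c) :
    IsTensor S p 1 (dbarCoeff c) where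
  smooth φ := (contDiffOn_dzbar φ.open_target (hc.smooth φ)).congr
    (fun z hz => Set.indicator_of_mem hz _)
  zero φ z hz := Set.indicator_of_notMem hz _
  law φ ψ z hz := by
    have hτ := (analyticAt_trans φ ψ hz)
    have hτ' := hτ.differentiableAt
    have hd0 := deriv_trans_ne_zero φ ψ hz
    have hm := trans_mem φ ψ hz
    have hG : DifferentiableAt ℂ (fun w => deriv (trans φ ψ) w ^ p) z :=
      hτ.deriv.differentiableAt.zpow (Or.inl hd0)
    have hcψ := hc.differentiableAt ψ hm.1
    have hev : c φ =ᶠ[𝓝 z] (c ψ ∘ trans φ ψ) * (fun w => deriv (trans φ ψ) w ^ p) := by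
      filter_upwards [(isOpen_overlap φ ψ).mem_nhds hz] with w hw
      simp [hc.law φ ψ w hw]
    simp only [dbarCoeff]
    rw [Set.indicator_of_mem hz.1, Set.indicator_of_mem hm.1, dzbar_congr hev,
      dzbar_mul (hcψ.comp z (hτ'.restrictScalars ℝ)) (hG.restrictScalars ℝ), dzbar_holo hG,
      dzbar_comp_holo hcψ hτ']
    simp only [zpow_one]
    ring

theorem SupportedIn.dbar {U : Set S} {c : S.Coord → ℂ → ℂ} (hc : SupportedIn U c) :
    SupportedIn U (dbarCoeff c) := by
  obtain ⟨K, hKU, hK, h⟩ := hc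
  refine ⟨K, hKU, hK, fun φ z hz hn => ?_⟩
  simp only [dbarCoeff]
  rw [Set.indicator_of_mem hz, dzbar_congr (eventuallyEq_of_vanishesOff hK h φ hz hn), dzbar_zero]

theorem IsTensor.dz_eq {q : ℤ} {c : S.Coord → ℂ → ℂ} (hc : IsTensor S (-1) q c) (φ ψ : S.Coord)
    {z : ℂ} (hz : z ∈ overlap φ ψ) :
    dz (c φ) z = (dz (c ψ) (trans φ ψ z)
        + c ψ (trans φ ψ z) * dz (fun w => deriv (trans φ ψ) w ^ (-1 : ℤ)) z)
      * (starRingEnd ℂ) (deriv (trans φ ψ) z) ^ q := by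
  have hτ := (analyticAt_trans φ ψ hz)
  have hτ' := hτ.differentiableAt
  have hd0 := deriv_trans_ne_zero φ ψ hz
  have hm := trans_mem φ ψ hz
  have hG : DifferentiableAt ℂ (fun w => deriv (trans φ ψ) w ^ (-1 : ℤ)) z :=
    hτ.deriv.differentiableAt.zpow (Or.inl hd0)
  have hE : DifferentiableAt ℂ (fun w => deriv (trans φ ψ) w ^ q) z :=
    hτ.deriv.differentiableAt.zpow (Or.inl hd0)
  have hE' : DifferentiableAt ℝ (fun w => (starRingEnd ℂ) (deriv (trans φ ψ) w ^ q)) z :=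
    (Complex.conjCLE : ℂ →L[ℝ] ℂ).differentiableAt.comp z (hE.restrictScalars ℝ)
  have hcψ := hc.differentiableAt ψ hm.1
  have hcomp := hcψ.comp z (hτ'.restrictScalars ℝ)
  have hev : c φ =ᶠ[𝓝 z] ((c ψ ∘ trans φ ψ) * (fun w => deriv (trans φ ψ) w ^ (-1 : ℤ)))
      * (fun w => (starRingEnd ℂ) (deriv (trans φ ψ) w ^ q)) := by
    filter_upwards [(isOpen_overlap φ ψ).mem_nhds hz] with w hw
    simp [hc.law φ ψ w hw]
  rw [dz_congr hev, dz_mul (hcomp.mul (hG.restrictScalars ℝ)) hE',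
    dz_mul hcomp (hG.restrictScalars ℝ), dz_conj_holo hE, dz_comp_holo hcψ hτ']
  simp only [map_zpow₀, zpow_neg_one, Function.comp_apply]
  field_simp
  ring

theorem IsTensor.bracket {q r : ℤ} {a b : S.Coord → ℂ → ℂ} (ha : IsTensor S (-1) q a)
    (hb : IsTensor S (-1) r b) : IsTensor S (-1) (q + r) (bracketCoeff a b) where
  smooth φ := ((ha.smooth φ).mul (contDiffOn_dz φ.open_target (hb.smooth φ))).sub
    ((hb.smooth φ).mul (contDiffOn_dz φ.open_target (ha.smooth φ)))
  zero φ z hz := by simp [bracketCoeff, ha.zero φ z hz, hb.zero φ z hz]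
  law φ ψ z hz := by
    have hd0 := deriv_trans_ne_zero φ ψ hz
    have hd1 : (starRingEnd ℂ) (deriv (trans φ ψ) z) ≠ 0 := by simpa using hd0
    simp only [bracketCoeff]
    rw [ha.dz_eq φ ψ hz, hb.dz_eq φ ψ hz, ha.law φ ψ z hz, hb.law φ ψ z hz, zpow_add₀ hd1]
    ring

theorem SupportedIn.bracket {U : Set S} {a b : S.Coord → ℂ → ℂ} (ha : SupportedIn U a) :
    SupportedIn U (bracketCoeff a b) := by
  obtain ⟨K, hKU, hK, h⟩ := ha
  refine ⟨K, hKU, hK, fun φ z hz hn => ?_⟩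
  have h1 := eventuallyEq_of_vanishesOff hK h φ hz hn
  simp only [bracketCoeff, dz_congr h1, dz_zero, h φ z hz hn]
  ring

/-! ## Compactly supported Dolbeault vector fields -/

/-- Compactly supported elements `α = (α₀ + α₁ dz̄) ∂/∂z` of the Dolbeault complex `Ω^{0,*}(S, T_S)`:
the pair of `α₀ ∂/∂z` (a smooth section of `T = K⁻¹`) and `α₁ dz̄ ⊗ ∂/∂z` (a smooth section of
`K⁻¹ ⊗ K̄`). -/
abbrev Lc (S : RiemannSurface.{u}) : Type u := S.Sections (-1) 0 × S.Sections (-1) 1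

namespace Lc

/-- The coefficient `α₀` in each coordinate. -/
def coeff₀ (X : Lc S) : S.Coord → ℂ → ℂ := X.1

/-- The coefficient `α₁` in each coordinate. -/
def coeff₁ (X : Lc S) : S.Coord → ℂ → ℂ := X.2

/-- The grading by form degree. -/
def deg (S : RiemannSurface.{u}) (i : ℤ) : Submodule ℂ (Lc S) :=
  if i = 0 then Submodule.prod ⊤ ⊥ else if i = 1 then Submodule.prod ⊥ ⊤ else ⊥

/-- The differential `∂̄`. -/
def dbar (X : Lc S) : Lc S :=
  (0, ⟨dbarCoeff X.coeff₀, X.1.2.1.dbar, X.1.2.2.dbar⟩)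

/-- The bracket extending the bracket of vector fields to Dolbeault forms. -/
def bracket (X Y : Lc S) : Lc S :=
  (⟨bracketCoeff X.coeff₀ Y.coeff₀, X.1.2.1.bracket Y.1.2.1, X.1.2.2.bracket⟩,
    ⟨bracketCoeff X.coeff₀ Y.coeff₁ + bracketCoeff X.coeff₁ Y.coeff₀,
      (X.1.2.1.bracket Y.2.2.1).add (X.2.2.1.bracket Y.1.2.1),
      SupportedIn.add X.1.2.2.bracket X.2.2.2.bracket⟩)

/-- The elements supported in `U`; for `U` open this is `Ω_c^{0,*}(U, T_U)`. -/
def on (U : Set S) : Submodule ℂ (Lc S) where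
  carrier := {X | SupportedIn U X.coeff₀ ∧ SupportedIn U X.coeff₁}
  zero_mem' := ⟨SupportedIn.zero U, SupportedIn.zero U⟩
  add_mem' hX hY := ⟨SupportedIn.add hX.1 hY.1, SupportedIn.add hX.2 hY.2⟩
  smul_mem' a _ hX := ⟨SupportedIn.smul a hX.1, SupportedIn.smul a hX.2⟩

end Lc

/-! ## Integration of `(1,1)`-forms -/

theorem exists_partition (S : RiemannSurface.{u}) :
    ∃ f : PartitionOfUnity S S, f.IsSubordinate (fun x => (S.coordAt x).source) := by
  have : LocallyCompactSpace S := ChartedSpace.locallyCompactSpace ℂ S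
  exact PartitionOfUnity.exists_isSubordinate isClosed_univ _
    (fun x => (S.coordAt x).open_source)
    (fun x _ => Set.mem_iUnion.2 ⟨x, mem_chart_source ℂ x⟩)

/-- A partition of unity subordinate to the preferred coordinates. -/
def partition (S : RiemannSurface.{u}) : PartitionOfUnity S S := (exists_partition S).choose

/-- The integral over `S` of a compactly supported `(1,1)`-form `η`, written `η = c φ · dx ∧ dy` in
each coordinate `φ = x + i y` (so `c` transforms by `|dw/dz|²`). -/
def integral (c : S.Coord → ℂ → ℂ) : ℂ :=
  ∑ᶠ x : S, ∫ z in (S.coordAt x).target,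
    ((S.partition x ((S.coordAt x).inv z) : ℝ) : ℂ) * c (S.coordAt x) z

/-! ## Projective connections -/

/-- A projective connection: a holomorphic function `ρ φ` in each coordinate `φ` such that
`ρ_z = (ρ_w ∘ w) (dw/dz)² + S(w)` under a change of coordinate `w(z)`, `S` the Schwarzian. -/
@[ext] structure ProjConn (S : RiemannSurface.{u}) where
  ρ : S.Coord → ℂ → ℂ
  holo : ∀ φ, DifferentiableOn ℂ (ρ φ) φ.target
  zero : ∀ φ, ∀ z ∉ φ.target, ρ φ z = 0
  law : ∀ φ ψ, ∀ z ∈ overlap φ ψ,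
    ρ φ z = ρ ψ (trans φ ψ z) * deriv (trans φ ψ) z ^ 2 + schwarzian (trans φ ψ) z

/-! ## The bilinear forms -/

/-- The form `ω` in the coordinate `φ`:
`(1/2π) (1/12) ∫ (∂³α₀ · β₁ + ∂³α₁ · β₀) d²z`. -/
def omegaLocal (φ : S.Coord) (X Y : Lc S) : ℂ :=
  1 / (2 * Real.pi) * (1 / 12) * ∫ z in φ.target,
    (dz^[3] (X.coeff₀ φ) z * Y.coeff₁ φ z + dz^[3] (X.coeff₁ φ) z * Y.coeff₀ φ z)

/-- The pairing `∇_z · V = - (1/2π) (1/12) ∫ ρ_z V₁ d²z` with a Dolbeault vector field, in the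
coordinate `φ`. -/
def ProjConn.pairLocal (D : ProjConn S) (φ : S.Coord) (V : Lc S) : ℂ :=
  -(1 / (2 * Real.pi) * (1 / 12)) * ∫ z in φ.target, D.ρ φ z * V.coeff₁ φ z

/-- `ω_{∇,z}(X, Y) = ω_z(X, Y) + ∇_z · [X, Y]`, in the coordinate `φ`. -/
def ProjConn.omegaLocal (D : ProjConn S) (φ : S.Coord) (X Y : Lc S) : ℂ :=
  RiemannSurface.omegaLocal φ X Y + D.pairLocal φ (X.bracket Y)

/-- The density, with respect to `d²z`, of `ω_∇(X, Y)` in each coordinate, with the third derivatives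
distributed evenly over the two arguments (an integration by parts away from the integrand of
`ProjConn.omegaLocal`). -/
def ProjConn.density (D : ProjConn S) (X Y : Lc S) : S.Coord → ℂ → ℂ := fun φ z =>
  1 / (2 * Real.pi) * (1 / 12) *
    ((1 / 2) * ((dz^[3] (X.coeff₀ φ) z * Y.coeff₁ φ z - X.coeff₀ φ z * dz^[3] (Y.coeff₁ φ) z)
        + (dz^[3] (X.coeff₁ φ) z * Y.coeff₀ φ z - X.coeff₁ φ z * dz^[3] (Y.coeff₀ φ) z))
      - D.ρ φ z * (X.bracket Y).coeff₁ φ z)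

/-- The form `ω_∇` on all compactly supported Dolbeault vector fields on `S`. -/
def ProjConn.omega (D : ProjConn S) (X Y : Lc S) : ℂ := integral (D.density X Y)

/-- The functional `X ↦ (∇ - ∇') · X = - (1/2π) (1/12) ∫_S (ρ - ρ') X₁`. -/
def ProjConn.diff (D D' : ProjConn S) (X : Lc S) : ℂ :=
  -(1 / (2 * Real.pi) * (1 / 12)) * integral (fun φ z => (D.ρ φ z - D'.ρ φ z) * X.coeff₁ φ z)

/-! ## Holomorphic embeddings -/

namespace IsHolEmbedding

variable {R : RiemannSurface.{u}} {f : S → T} {g : T → R}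

theorem id (S : RiemannSurface.{u}) : IsHolEmbedding (_root_.id : S → S) :=
  ⟨Topology.IsOpenEmbedding.id, fun x =>
    (Diffeomorph.refl 𝓘(ℂ) S ω).toPartialDiffeomorph.isLocalDiffeomorphAt _ _ _ (Set.mem_univ x)⟩

theorem comp (hg : IsHolEmbedding g) (hf : IsHolEmbedding f) : IsHolEmbedding (g ∘ f) :=
  ⟨hg.isOpenEmbedding.comp hf.isOpenEmbedding,
    fun x => 
      IsLocalDiffeomorphAt.comp (K := 𝓘(ℂ)) (P := R) (hf := hf.isLocalBihol x)
        (hg := hg.isLocalBihol (f x))⟩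

/-- The inverse of `f`, defined on the range of `f`, is holomorphic. -/
theorem holo_symm [Nonempty S] (hf : IsHolEmbedding f) :
    ContMDiffOn 𝓘(ℂ) 𝓘(ℂ) ω (hf.isOpenEmbedding.toOpenPartialHomeomorph f).symm (Set.range f) := by
  rintro _ ⟨x, rfl⟩
  apply ContMDiffAt.contMDiffWithinAt
  refine (hf.isLocalBihol x).localInverse_contMDiffAt.congr_of_eventuallyEq ?_
  filter_upwards [(hf.isLocalBihol x).localInverse_eventuallyEq_right] with y hy
  have hy' : f ((hf.isLocalBihol x).localInverse y) = y := hy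
  conv_lhs => rw [← hy']
  exact hf.isOpenEmbedding.toOpenPartialHomeomorph_left_inv f

/-- The coordinate `ψ ∘ f` on `S` obtained from a coordinate `ψ` on `T`. -/
def pullCoord [Nonempty S] (hf : IsHolEmbedding f) (ψ : T.Coord) : S.Coord where
  toOpenPartialHomeomorph :=
    (hf.isOpenEmbedding.toOpenPartialHomeomorph f).trans ψ.toOpenPartialHomeomorph
  holo := ψ.holo.comp hf.isLocalBihol.contMDiff.contMDiffOn (fun _ hx => hx.2)
  holo_symm := hf.holo_symm.comp (ψ.holo_symm.mono Set.inter_subset_left)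
    (fun z hz => by simpa using hz.2)

/-- The coordinate `φ ∘ f⁻¹` on `T` obtained from a coordinate `φ` on `S`. -/
def pushCoord (hf : IsHolEmbedding f) (φ : S.Coord) : T.Coord :=
  haveI : Nonempty S := ⟨φ.inv 0⟩
  { toOpenPartialHomeomorph :=
      (hf.isOpenEmbedding.toOpenPartialHomeomorph f).symm.trans φ.toOpenPartialHomeomorph
    holo := φ.holo.comp (hf.holo_symm.mono (fun y hy => by simpa using hy.1)) (fun _ hy => hy.2)
    holo_symm := hf.isLocalBihol.contMDiff.comp_contMDiffOn
      (φ.holo_symm.mono Set.inter_subset_left) }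

theorem pushCoord_overlap (hf : IsHolEmbedding f) {φ ψ : S.Coord} {z : ℂ} (hz : z ∈ overlap φ ψ) :
    z ∈ overlap (hf.pushCoord φ) (hf.pushCoord ψ) := by
  have : Nonempty S := ⟨φ.inv 0⟩
  have h : (hf.isOpenEmbedding.toOpenPartialHomeomorph f).symm (f (φ.inv z)) = φ.inv z :=
    hf.isOpenEmbedding.toOpenPartialHomeomorph_left_inv f
  have hr : f (φ.inv z) ∈ (hf.isOpenEmbedding.toOpenPartialHomeomorph f).target := by simp
  have hs : (hf.isOpenEmbedding.toOpenPartialHomeomorph f).symm (f (φ.inv z)) ∈ ψ.source :=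
    h.symm ▸ hz.2
  exact ⟨⟨hz.1, Set.mem_univ _⟩, hr, hs⟩

theorem trans_pushCoord (hf : IsHolEmbedding f) (φ ψ : S.Coord) :
    trans (hf.pushCoord φ) (hf.pushCoord ψ) = trans φ ψ := by
  have : Nonempty S := ⟨φ.inv 0⟩
  funext z
  have h : (hf.isOpenEmbedding.toOpenPartialHomeomorph f).symm (f (φ.inv z)) = φ.inv z :=
    hf.isOpenEmbedding.toOpenPartialHomeomorph_left_inv f
  exact congrArg ψ.toOpenPartialHomeomorph h

theorem pushCoord_target (hf : IsHolEmbedding f) (φ : S.Coord) :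
    (hf.pushCoord φ).target = φ.target := by
  simp [pushCoord]

theorem mem_pullCoord_target [Nonempty S] (hf : IsHolEmbedding f) (ψ : T.Coord) (z : ℂ) :
    z ∈ (hf.pullCoord ψ).target ↔ z ∈ ψ.target ∧ ψ.inv z ∈ Set.range f := by
  simp [pullCoord]

theorem apply_pullCoord_inv [Nonempty S] (hf : IsHolEmbedding f) (ψ : T.Coord) {z : ℂ}
    (hz : ψ.inv z ∈ Set.range f) : f ((hf.pullCoord ψ).inv z) = ψ.inv z :=
  hf.isOpenEmbedding.toOpenPartialHomeomorph_right_inv f hz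

theorem isTensor_push [Nonempty S] (hf : IsHolEmbedding f) {p q : ℤ} {c : S.Coord → ℂ → ℂ}
    (hc : IsTensor S p q c) (hs : SupportedIn Set.univ c) :
    IsTensor T p q (fun ψ => c (hf.pullCoord ψ)) where
  smooth ψ z hz := by
    apply ContDiffAt.contDiffWithinAt
    by_cases h : ψ.inv z ∈ Set.range f
    · exact (hc.smooth (hf.pullCoord ψ)).contDiffAt
        ((hf.pullCoord ψ).open_target.mem_nhds ((hf.mem_pullCoord_target ψ z).2 ⟨hz, h⟩))
    · obtain ⟨K, -, hK, hv⟩ := hs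
      have ho : IsOpen (ψ.target ∩ ψ.inv ⁻¹' (f '' K)ᶜ) :=
        ψ.toOpenPartialHomeomorph.isOpen_inter_preimage_symm
          (hK.image hf.isOpenEmbedding.continuous).isClosed.isOpen_compl
      have hm : z ∈ ψ.target ∩ ψ.inv ⁻¹' (f '' K)ᶜ :=
        ⟨hz, fun ⟨x, _, hx⟩ => h ⟨x, hx⟩⟩
      refine (contDiffAt_const (c := (0 : ℂ))).congr_of_eventuallyEq ?_
      filter_upwards [ho.mem_nhds hm] with w hw
      by_cases hw' : w ∈ (hf.pullCoord ψ).target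
      · refine hv _ w hw' (fun hK' => hw.2 ⟨_, hK', ?_⟩)
        exact hf.apply_pullCoord_inv ψ ((hf.mem_pullCoord_target ψ w).1 hw').2
      · exact hc.zero _ w hw'
  zero ψ z hz := hc.zero _ z (fun h => hz ((hf.mem_pullCoord_target ψ z).1 h).1)
  law ψ χ z hz := by
    by_cases h : ψ.inv z ∈ Set.range f
    · have hz' : z ∈ overlap (hf.pullCoord ψ) (hf.pullCoord χ) := by
        refine ⟨(hf.mem_pullCoord_target ψ z).2 ⟨hz.1, h⟩, Set.mem_univ _, ?_⟩
        have h1 : f ((hf.pullCoord ψ).inv z) ∈ χ.source := by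
          rw [hf.apply_pullCoord_inv ψ h]; exact hz.2
        exact h1
      have hev : trans (hf.pullCoord ψ) (hf.pullCoord χ) =ᶠ[𝓝 z] trans ψ χ := by
        filter_upwards [(isOpen_overlap (hf.pullCoord ψ) (hf.pullCoord χ)).mem_nhds hz'] with w hw
        have := hf.apply_pullCoord_inv ψ ((hf.mem_pullCoord_target ψ w).1 hw.1).2
        exact congrArg χ.toOpenPartialHomeomorph this
      rw [hc.law _ _ z hz', hev.eq_of_nhds, hev.deriv_eq]
    · have h1 : c (hf.pullCoord ψ) z = 0 :=
        hc.zero _ z (fun h' => h ((hf.mem_pullCoord_target ψ z).1 h').2)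
      have h2 : c (hf.pullCoord χ) (trans ψ χ z) = 0 := by
        refine hc.zero _ _ (fun h' => h ?_)
        have h3 := ((hf.mem_pullCoord_target χ _).1 h').2
        have h4 : χ.inv (trans ψ χ z) = ψ.inv z := χ.left_inv hz.2
        rwa [h4] at h3
      simp [h1, h2]

theorem supportedIn_push [Nonempty S] (hf : IsHolEmbedding f) {p q : ℤ} {c : S.Coord → ℂ → ℂ}
    (hc : IsTensor S p q c) (hs : SupportedIn Set.univ c) :
    SupportedIn Set.univ (fun ψ : T.Coord => c (hf.pullCoord ψ)) := by
  obtain ⟨K, -, hK, hv⟩ := hs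
  refine ⟨f '' K, Set.subset_univ _, hK.image hf.isOpenEmbedding.continuous, fun ψ z hz hn => ?_⟩
  by_cases h : z ∈ (hf.pullCoord ψ).target
  · refine hv _ z h (fun hK' => hn ⟨_, hK', ?_⟩)
    exact hf.apply_pullCoord_inv ψ ((hf.mem_pullCoord_target ψ z).1 h).2
  · exact hc.zero _ z h

open Classical in
/-- Extension by zero `f_*` of compactly supported sections: the coefficient of `f_* c` in a coordinate
`ψ` is the coefficient of `c` in the coordinate `ψ ∘ f` (and `0` off the range of `f`). -/
def pushSection (hf : IsHolEmbedding f) {p q : ℤ} (c : S.Sections p q) : T.Sections p q :=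
  if _h : Nonempty S then
    ⟨fun ψ => c.1 (hf.pullCoord ψ), hf.isTensor_push c.2.1 c.2.2, hf.supportedIn_push c.2.1 c.2.2⟩
  else 0

/-- Extension by zero `f_* : L_c(S) → L_c(T)`. -/
def push (hf : IsHolEmbedding f) (X : Lc S) : Lc T := (hf.pushSection X.1, hf.pushSection X.2)

end IsHolEmbedding

/-- The pull-back `f^*∇`: its function in a coordinate `φ` is that of `∇` in the coordinate
`φ ∘ f⁻¹`. -/
def ProjConn.pull {f : S → T} (D : ProjConn T) (hf : IsHolEmbedding f) : ProjConn S where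
  ρ φ := D.ρ (hf.pushCoord φ)
  holo φ := hf.pushCoord_target φ ▸ D.holo (hf.pushCoord φ)
  zero φ z hz := D.zero _ z (by rwa [hf.pushCoord_target φ])
  law φ ψ z hz := by
    have h := D.law _ _ z (hf.pushCoord_overlap hz)
    rwa [hf.trans_pushCoord] at h

end RiemannSurface

/-! ## Differential graded Lie algebras, cocycles, central extensions -/

section DGLie

variable {V W : Type*} [AddCommGroup V] [Module ℂ V] [AddCommGroup W] [Module ℂ W]

/-- `V = ⨁ deg i`, with the differential `d` and the bracket `br`, is a dg Lie algebra
(cohomologically graded). -/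
structure IsDGLie (deg : ℤ → Submodule ℂ V) (d : V → V) (br : V → V → V) : Prop where
  internal : DirectSum.IsInternal deg
  d_linear : IsLinearMap ℂ d
  br_left : ∀ y, IsLinearMap ℂ (fun x => br x y)
  br_right : ∀ x, IsLinearMap ℂ (br x)
  d_deg : ∀ i, ∀ x ∈ deg i, d x ∈ deg (i + 1)
  br_deg : ∀ i j, ∀ x ∈ deg i, ∀ y ∈ deg j, br x y ∈ deg (i + j)
  d_d : ∀ x, d (d x) = 0
  skew : ∀ i j, ∀ x ∈ deg i, ∀ y ∈ deg j, br x y = -(-1 : ℂ) ^ (i * j) • br y x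
  leibniz : ∀ i, ∀ x ∈ deg i, ∀ y, d (br x y) = br (d x) y + (-1 : ℂ) ^ i • br x (d y)
  jacobi : ∀ i j k, ∀ x ∈ deg i, ∀ y ∈ deg j, ∀ z ∈ deg k,
    (-1 : ℂ) ^ (i * k) • br (br x y) z + (-1 : ℂ) ^ (j * i) • br (br y z) x
      + (-1 : ℂ) ^ (k * j) • br (br z x) y = 0

/-- `F` is a homomorphism of dg Lie algebras. -/
structure IsDGLieHom (deg : ℤ → Submodule ℂ V) (d : V → V) (br : V → V → V)
    (deg' : ℤ → Submodule ℂ W) (d' : W → W) (br' : W → W → W) (F : V → W) : Prop where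
  linear : IsLinearMap ℂ F
  map_deg : ∀ i, ∀ x ∈ deg i, F x ∈ deg' i
  map_d : ∀ x, F (d x) = d' (F x)
  map_br : ∀ x y, F (br x y) = br' (F x) (F y)

/-- On the sub dg Lie algebra `A`, the bilinear form `c` is a cocycle of degree `-1`: the bracket
`[x, y] + c(x, y)` defines a `(-1)`-shifted central extension of `A`, by `ℂ` in degree `1`. -/
structure IsCocycle (deg : ℤ → Submodule ℂ V) (d : V → V) (br : V → V → V) (A : Submodule ℂ V)
    (c : V → V → ℂ) : Prop where
  left : ∀ y ∈ A, IsLinearMap ℂ (fun x : A => c x y)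
  right : ∀ x ∈ A, IsLinearMap ℂ (fun y : A => c x y)
  degree : ∀ i j, ∀ x ∈ deg i ⊓ A, ∀ y ∈ deg j ⊓ A, i + j ≠ 1 → c x y = 0
  skew : ∀ i j, ∀ x ∈ deg i ⊓ A, ∀ y ∈ deg j ⊓ A, c x y = -(-1 : ℂ) ^ (i * j) * c y x
  closed : ∀ i, ∀ x ∈ deg i ⊓ A, ∀ y ∈ A, c (d x) y + (-1 : ℂ) ^ i * c x (d y) = 0
  jacobi : ∀ i j k, ∀ x ∈ deg i ⊓ A, ∀ y ∈ deg j ⊓ A, ∀ z ∈ deg k ⊓ A,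
    (-1 : ℂ) ^ (i * k) * c (br x y) z + (-1 : ℂ) ^ (j * i) * c (br y z) x
      + (-1 : ℂ) ^ (k * j) * c (br z x) y = 0

/-- On the sub dg Lie algebra `A`, the form `c` is the Chevalley-Eilenberg coboundary of the linear
functional `Φ` (concentrated on degree `1`). -/
structure IsCoboundaryOf (deg : ℤ → Submodule ℂ V) (d : V → V) (br : V → V → V)
    (A : Submodule ℂ V) (Φ : V → ℂ) (c : V → V → ℂ) : Prop where
  linear : IsLinearMap ℂ (fun x : A => Φ x)
  degree : ∀ i, i ≠ 1 → ∀ x ∈ deg i ⊓ A, Φ x = 0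
  closed : ∀ x ∈ A, Φ (d x) = 0
  eq : ∀ x ∈ A, ∀ y ∈ A, c x y = Φ (br x y)

end DGLie

namespace RiemannSurface

variable {S T : RiemannSurface.{u}}

/-- The vector space underlying the `(-1)`-shifted central extension `L_c(S) ⊕ ℂ·c`. -/
abbrev Ext (S : RiemannSurface.{u}) : Type u := Lc S × ℂ

namespace Ext

/-- The grading, with `c` in degree `1`. -/
def deg (S : RiemannSurface.{u}) (i : ℤ) : Submodule ℂ (Ext S) :=
  (Lc.deg S i).prod (if i = 1 then ⊤ else ⊥)

/-- The differential `∂̄`, with `∂̄ c = 0`. -/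
def d (x : Ext S) : Ext S := (x.1.dbar, 0)

/-- The bracket `[X, Y] + ω_∇(X, Y) c`, with `c` central. -/
def bracket (D : ProjConn S) (x y : Ext S) : Ext S := (x.1.bracket y.1, D.omega x.1 y.1)

/-- The map of extensions `(X, t) ↦ (f_* X, t + (f^*∇' - ∇) · X)` over `f_*`, from the extension of
`L_c(S)` determined by `∇` to the extension of `L_c(T)` determined by `∇'`. -/
def map {f : S → T} (hf : IsHolEmbedding f) (D : ProjConn S) (D' : ProjConn T) (x : Ext S) : Ext T :=
  (hf.push x.1, x.2 + (D'.pull hf).diff D x.1)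

end Ext

end RiemannSurface

end

open RiemannSurface

noncomputable section

namespace RiemannSurface

variable {S T : RiemannSurface.{u}}

open MeasureTheory

/-! ## Calculus of smooth functions on the complex plane -/

/-! In one coordinate, elements supported in the coordinate domain have coefficients that are test
functions on the plane, and the third-derivative part of `ω_∇` is built from the form `∫ a''' b`.
This form is antisymmetric by integration by parts (`gelfandFuks_swap`), compatible with `∂̄`
because `∂` and `∂̄` commute (`gelfandFuks_dzbar`), and a cocycle because the cyclic sum is `∂` of
twice the Wronskian determinant of the three functions (`gelfandFuks_jacobi`). The term with `ρ` is
a linear functional of `[X, Y]`: its Jacobi identity is that of the bracket, and it is compatible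
with `∂̄` by Stokes, `ρ` being holomorphic.

Globally, `∂³` on vector fields is not a tensor operation. Under a change of coordinate `τ` it
acquires a first-order term `-2 S(τ) ∂` and a term of order zero (`dz_three_eq`). Antisymmetrizing
the integrand kills the latter and turns the former into `S(τ) [X, Y]₁`, which is what the affine
law of `ρ` removes. So the density is a genuine `(1,1)`-form (`ProjConn.isTensor_density`), and
integrating it by parts in one coordinate gives back the local form
(`ProjConn.omega_eq_omegaLocal`).

The cocycle identities on `S` follow from those in a coordinate: by linearity and a smooth partition
of unity `X` may be supported in one coordinate domain (`Lc.induction`), and by locality of the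
density the other arguments may be cut off to the same domain (`Lc.exists_agreeNear`).

For two connections the third derivatives cancel in `ω_∇ - ω_∇'`, leaving the pairing of `[X, Y]`
with `ρ - ρ'`, a holomorphic quadratic differential since the Schwarzians cancel. The functionals
`Φ` are additive in the pair of connections and natural for embeddings, which makes the maps of
extensions homomorphisms that compose. Koszul signs play no role: they differ from `1` only when two
arguments have degree `1`, and then every term vanishes. -/

theorem contDiff_dz {f : ℂ → ℂ} (hf : ContDiff ℝ ∞ f) : ContDiff ℝ ∞ (dz f) :=
  contDiffOn_univ.1 (contDiffOn_dz isOpen_univ hf.contDiffOn)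

theorem contDiff_dzbar {f : ℂ → ℂ} (hf : ContDiff ℝ ∞ f) : ContDiff ℝ ∞ (dzbar f) :=
  contDiffOn_univ.1 (contDiffOn_dzbar isOpen_univ hf.contDiffOn)

theorem contDiff_mul {f g : ℂ → ℂ} (hf : ContDiff ℝ ∞ f) (hg : ContDiff ℝ ∞ g) :
    ContDiff ℝ ∞ (f * g) := hf.mul hg

theorem contDiff_add {f g : ℂ → ℂ} (hf : ContDiff ℝ ∞ f) (hg : ContDiff ℝ ∞ g) :
    ContDiff ℝ ∞ (f + g) := hf.add hg

theorem contDiff_sub {f g : ℂ → ℂ} (hf : ContDiff ℝ ∞ f) (hg : ContDiff ℝ ∞ g) :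
    ContDiff ℝ ∞ (f - g) := hf.sub hg

theorem differentiableAt_of_smooth {f : ℂ → ℂ} (hf : ContDiff ℝ ∞ f) (z : ℂ) :
    DifferentiableAt ℝ f z := (hf.differentiable (by simp)).differentiableAt

theorem dz_add {f g : ℂ → ℂ} {z : ℂ} (hf : DifferentiableAt ℝ f z) (hg : DifferentiableAt ℝ g z) :
    dz (f + g) z = dz f z + dz g z := by
  simp only [dz, fderiv_add hf hg, add_apply]; ring

theorem dz_sub {f g : ℂ → ℂ} {z : ℂ} (hf : DifferentiableAt ℝ f z) (hg : DifferentiableAt ℝ g z) :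
    dz (f - g) z = dz f z - dz g z := by
  simp only [dz, fderiv_sub hf hg, sub_apply]; ring

theorem dzbar_add {f g : ℂ → ℂ} {z : ℂ} (hf : DifferentiableAt ℝ f z)
    (hg : DifferentiableAt ℝ g z) : dzbar (f + g) z = dzbar f z + dzbar g z := by
  simp only [dzbar, fderiv_add hf hg, add_apply]; ring

theorem dzbar_sub {f g : ℂ → ℂ} {z : ℂ} (hf : DifferentiableAt ℝ f z)
    (hg : DifferentiableAt ℝ g z) : dzbar (f - g) z = dzbar f z - dzbar g z := by
  simp only [dzbar, fderiv_sub hf hg, sub_apply]; ring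

theorem dz_const_smul {f : ℂ → ℂ} {z : ℂ} (a : ℂ) (hf : DifferentiableAt ℝ f z) :
    dz (a • f) z = a * dz f z := by
  simp only [dz, fderiv_const_smul hf, smul_apply, smul_eq_mul]; ring

theorem dzbar_const_smul {f : ℂ → ℂ} {z : ℂ} (a : ℂ) (hf : DifferentiableAt ℝ f z) :
    dzbar (a • f) z = a * dzbar f z := by
  simp only [dzbar, fderiv_const_smul hf, smul_apply, smul_eq_mul]; ring

theorem dz_mul_smooth {f g : ℂ → ℂ} (hf : ContDiff ℝ ∞ f) (hg : ContDiff ℝ ∞ g) :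
    dz (f * g) = f * dz g + dz f * g :=
  funext fun z => dz_mul (differentiableAt_of_smooth hf z) (differentiableAt_of_smooth hg z)

theorem dzbar_mul_smooth {f g : ℂ → ℂ} (hf : ContDiff ℝ ∞ f) (hg : ContDiff ℝ ∞ g) :
    dzbar (f * g) = f * dzbar g + dzbar f * g :=
  funext fun z => dzbar_mul (differentiableAt_of_smooth hf z) (differentiableAt_of_smooth hg z)

theorem dz_add_smooth {f g : ℂ → ℂ} (hf : ContDiff ℝ ∞ f) (hg : ContDiff ℝ ∞ g) :
    dz (f + g) = dz f + dz g :=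
  funext fun z => dz_add (differentiableAt_of_smooth hf z) (differentiableAt_of_smooth hg z)

theorem dz_sub_smooth {f g : ℂ → ℂ} (hf : ContDiff ℝ ∞ f) (hg : ContDiff ℝ ∞ g) :
    dz (f - g) = dz f - dz g :=
  funext fun z => dz_sub (differentiableAt_of_smooth hf z) (differentiableAt_of_smooth hg z)

/-- `∂/∂z` and `∂/∂z̄` commute. -/
theorem dzbar_dz {f : ℂ → ℂ} {z : ℂ} (hf : ContDiffAt ℝ ∞ f z) :
    dzbar (dz f) z = dz (dzbar f) z := by
  have hs : IsSymmSndFDerivAt ℝ f z := hf.isSymmSndFDerivAt (by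
    simpa using WithTop.coe_le_coe.2 (OrderTop.le_top (2 : ℕ∞)))
  have hd : DifferentiableAt ℝ (fderiv ℝ f) z :=
    (hf.fderiv_right (m := ∞) (by simp)).differentiableAt (by simp)
  have h : ∀ v, HasFDerivAt (fun w => fderiv ℝ f w v)
      ((ContinuousLinearMap.apply ℝ ℂ v).comp (fderiv ℝ (fderiv ℝ f) z)) z := fun v =>
    (ContinuousLinearMap.apply ℝ ℂ v).hasFDerivAt.comp z hd.hasFDerivAt
  have h1 : HasFDerivAt (dz f) _ z :=
    ((h 1).sub ((h Complex.I).const_smul Complex.I)).const_smul (1 / 2 : ℂ) |>.congr_of_eventuallyEq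
      (.of_forall fun w => by simp [dz]; ring)
  have h2 : HasFDerivAt (dzbar f) _ z :=
    ((h 1).add ((h Complex.I).const_smul Complex.I)).const_smul (1 / 2 : ℂ) |>.congr_of_eventuallyEq
      (.of_forall fun w => by simp [dzbar]; ring)
  rw [dzbar, dz, h1.fderiv, h2.fderiv]
  have := hs.eq 1 Complex.I
  simp [this]
  ring

/-! ## Test functions -/

/-- Smooth functions on the plane with compact support. -/
def IsTest (f : ℂ → ℂ) : Prop := ContDiff ℝ ∞ f ∧ HasCompactSupport f

namespace IsTest

variable {f g : ℂ → ℂ}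

theorem mul_right (hf : IsTest f) (hg : ContDiff ℝ ∞ g) : IsTest (f * g) :=
  ⟨hf.1.mul hg, hf.2.mul_right⟩

theorem add (hf : IsTest f) (hg : IsTest g) : IsTest (f + g) :=
  ⟨hf.1.add hg.1, hf.2.add hg.2⟩

theorem neg (hf : IsTest f) : IsTest (-f) := ⟨hf.1.neg, hf.2.neg⟩

theorem sub (hf : IsTest f) (hg : IsTest g) : IsTest (f - g) := by
  rw [sub_eq_add_neg]; exact hf.add hg.neg

theorem dz (hf : IsTest f) : IsTest (dz f) :=
  ⟨contDiff_dz hf.1, hf.2.fderiv (𝕜 := ℝ) |>.mono' (by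
    intro z hz
    refine subset_tsupport _ ?_
    simp only [Function.mem_support, RiemannSurface.dz] at hz ⊢
    rintro h
    simp [h] at hz)⟩

theorem dzbar (hf : IsTest f) : IsTest (dzbar f) :=
  ⟨contDiff_dzbar hf.1, hf.2.fderiv (𝕜 := ℝ) |>.mono' (by
    intro z hz
    refine subset_tsupport _ ?_
    simp only [Function.mem_support, RiemannSurface.dzbar] at hz ⊢
    rintro h
    simp [h] at hz)⟩

theorem dz_iterate (hf : IsTest f) (n : ℕ) : IsTest (RiemannSurface.dz^[n] f) := by
  induction n with
  | zero => exact hf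
  | succ n ih => rw [Function.iterate_succ_apply']; exact ih.dz

theorem integrable (hf : IsTest f) : MeasureTheory.Integrable f :=
  hf.1.continuous.integrable_of_hasCompactSupport hf.2

theorem integrable_fderiv (hf : IsTest f) (v : ℂ) :
    MeasureTheory.Integrable (fun z => fderiv ℝ f z v) :=
  ((hf.1.continuous_fderiv (by simp)).clm_apply continuous_const).integrable_of_hasCompactSupport
    (hf.2.fderiv_apply ℝ v)

theorem integral_fderiv (hf : IsTest f) (v : ℂ) : ∫ z, fderiv ℝ f z v = 0 := by
  -- Integration by parts against the constant `1`, which lacks compact support; only integrability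
  -- of the products is needed.
  have h := integral_smul_fderiv_eq_neg_fderiv_smul_of_integrable (𝕜 := ℝ)
    (μ := MeasureTheory.volume)
    (f := fun _ => (1 : ℝ)) (g := f) (v := v) (by simp) (by simpa using hf.integrable_fderiv v)
    (by simpa using hf.integrable) (by simp)
    (fun z _ => differentiableAt_of_smooth hf.1 z)
  simpa using h

theorem integral_dz (hf : IsTest f) : ∫ z, RiemannSurface.dz f z = 0 := by
  simp only [RiemannSurface.dz]
  rw [MeasureTheory.integral_div, MeasureTheory.integral_sub (hf.integrable_fderiv _)
    ((hf.integrable_fderiv _).const_mul _), MeasureTheory.integral_const_mul, hf.integral_fderiv,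
    hf.integral_fderiv]
  simp

theorem integral_dzbar (hf : IsTest f) : ∫ z, RiemannSurface.dzbar f z = 0 := by
  simp only [RiemannSurface.dzbar]
  rw [MeasureTheory.integral_div, MeasureTheory.integral_add (hf.integrable_fderiv _)
    ((hf.integrable_fderiv _).const_mul _), MeasureTheory.integral_const_mul, hf.integral_fderiv,
    hf.integral_fderiv]
  simp

end IsTest

/-! ## The Gelfand-Fuks form -/

/-- The Gelfand-Fuks form `∫ a''' b` of two functions on the plane. -/
def gelfandFuks (a b : ℂ → ℂ) : ℂ := ∫ z, dz^[3] a z * b z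

theorem dzbar_dz_iterate {f : ℂ → ℂ} (hf : ContDiff ℝ ∞ f) (n : ℕ) :
    dzbar (dz^[n] f) = dz^[n] (dzbar f) := by
  induction n generalizing f with
  | zero => rfl
  | succ n ih =>
    rw [Function.iterate_succ_apply, Function.iterate_succ_apply, ih (contDiff_dz hf),
      show dzbar (dz f) = dz (dzbar f) from funext fun z => dzbar_dz hf.contDiffAt]

/-- Stokes in the form used below: an integral identity is proved by exhibiting a primitive for `∂`
that is a test function. -/
theorem integral_eq_zero_of_eq_dz {f g : ℂ → ℂ} (hg : IsTest g) (h : f = dz g) :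
    ∫ z, f z = 0 := h ▸ hg.integral_dz

theorem gelfandFuks_swap {a b : ℂ → ℂ} (ha : IsTest a) (hb : IsTest b) :
    gelfandFuks b a = -gelfandFuks a b := by
  -- The primitive `a''b - a'b' + ab''` is determined by the proof that it is a test function.
  have h := integral_eq_zero_of_eq_dz (f := dz^[3] a * b + dz^[3] b * a)
    (((ha.dz.dz.mul_right hb.1).sub (ha.dz.mul_right hb.dz.1)).add (ha.mul_right hb.dz.dz.1)) ?_
  · rw [eq_neg_iff_add_eq_zero, add_comm, ← h]
    exact (MeasureTheory.integral_add ((ha.dz_iterate 3).mul_right hb.1).integrable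
      ((hb.dz_iterate 3).mul_right ha.1).integrable).symm
  · have h1 := ha.1
    have h2 := hb.1
    simp (disch := (repeat' first
      | assumption | apply contDiff_dz | apply contDiff_mul | apply contDiff_add | apply contDiff_sub)) only
      [Function.iterate_succ_apply, Function.iterate_zero, id,
      dz_mul_smooth, dz_add_smooth, dz_sub_smooth]
    ring

/-- Stokes for `∂̄(a''' b)`, once `∂̄` has been moved past `∂³`. -/
theorem gelfandFuks_dzbar {a b : ℂ → ℂ} (ha : IsTest a) (hb : IsTest b) :
    gelfandFuks (dzbar a) b + gelfandFuks a (dzbar b) = 0 := by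
  have h := ((ha.dz_iterate 3).mul_right hb.1).integral_dzbar
  rw [dzbar_mul_smooth (ha.dz_iterate 3).1 hb.1, dzbar_dz_iterate ha.1, add_comm] at h
  rw [← h]
  exact (MeasureTheory.integral_add ((ha.dzbar.dz_iterate 3).mul_right hb.1).integrable
      ((ha.dz_iterate 3).mul_right hb.dzbar.1).integrable).symm

/-- The bracket of two vector fields on the plane. -/
def planeBracket (a b : ℂ → ℂ) : ℂ → ℂ := a * dz b - b * dz a

theorem IsTest.planeBracket {a b : ℂ → ℂ} (ha : IsTest a) (hb : IsTest b) :
    IsTest (planeBracket a b) := (ha.mul_right hb.dz.1).sub (hb.mul_right ha.dz.1)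

theorem contDiffAt_dz {f : ℂ → ℂ} {z : ℂ} (hf : ContDiffAt ℝ ∞ f z) :
    ContDiffAt ℝ ∞ (dz f) z := by
  have h : ContDiffAt ℝ ∞ (fderiv ℝ f) z := hf.fderiv_right (by simp)
  exact ((h.clm_apply contDiffAt_const).sub
    (contDiffAt_const.mul (h.clm_apply contDiffAt_const))).div_const 2

theorem differentiableAt_dz {f : ℂ → ℂ} {z : ℂ} (hf : ContDiffAt ℝ ∞ f z) :
    DifferentiableAt ℝ (dz f) z := (contDiffAt_dz hf).differentiableAt (by simp)

theorem contDiffAt_planeBracket {a b : ℂ → ℂ} {z : ℂ} (ha : ContDiffAt ℝ ∞ a z)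
    (hb : ContDiffAt ℝ ∞ b z) : ContDiffAt ℝ ∞ (planeBracket a b) z :=
  (ha.mul (contDiffAt_dz hb)).sub (hb.mul (contDiffAt_dz ha))

/-- The products `a'b'` cancel, so that the Jacobi identity below needs no derivative beyond the
second. -/
theorem dz_planeBracket {a b : ℂ → ℂ} {z : ℂ} (ha : ContDiffAt ℝ ∞ a z) (hb : ContDiffAt ℝ ∞ b z) :
    dz (planeBracket a b) z = a z * dz (dz b) z - b z * dz (dz a) z := by
  have h1 := ha.differentiableAt (by simp)
  have h2 := hb.differentiableAt (by simp)
  have h3 := differentiableAt_dz ha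
  have h4 := differentiableAt_dz hb
  rw [planeBracket, dz_sub (h1.mul h4) (h2.mul h3), dz_mul h1 h4, dz_mul h2 h3]
  ring

theorem dzbar_planeBracket {a b : ℂ → ℂ} {z : ℂ} (ha : ContDiffAt ℝ ∞ a z)
    (hb : ContDiffAt ℝ ∞ b z) : dzbar (planeBracket a b) z
      = planeBracket (dzbar a) b z + planeBracket a (dzbar b) z := by
  have h1 := ha.differentiableAt (by simp)
  have h2 := hb.differentiableAt (by simp)
  have h3 := differentiableAt_dz ha
  have h4 := differentiableAt_dz hb
  rw [planeBracket, dzbar_sub (h1.mul h4) (h2.mul h3), dzbar_mul h1 h4, dzbar_mul h2 h3,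
    dzbar_dz ha, dzbar_dz hb]
  simp only [planeBracket, Pi.sub_apply, Pi.mul_apply]
  ring

theorem planeBracket_jacobi {a b c : ℂ → ℂ} {z : ℂ} (ha : ContDiffAt ℝ ∞ a z)
    (hb : ContDiffAt ℝ ∞ b z) (hc : ContDiffAt ℝ ∞ c z) :
    planeBracket (planeBracket a b) c z + planeBracket (planeBracket b c) a z
      + planeBracket (planeBracket c a) b z = 0 := by
  have h : ∀ f g : ℂ → ℂ, planeBracket f g z = f z * dz g z - g z * dz f z := fun _ _ => rfl
  rw [h (planeBracket a b), h (planeBracket b c), h (planeBracket c a), dz_planeBracket ha hb,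
    dz_planeBracket hb hc, dz_planeBracket hc ha, h, h, h]
  ring

/-- Since `[a,b]''' = 2(a'b''' - b'a''') + (ab'''' - ba'''')`, multiplying by `c` and summing
cyclically cancels the fourth derivatives, and what remains is `2 ∂W`, with `W` the determinant of
the rows `(a,b,c)`, `(a',b',c')`, `(a'',b'',c'')`. -/
theorem gelfandFuks_jacobi {a b c : ℂ → ℂ} (ha : IsTest a) (hb : IsTest b) (hc : IsTest c) :
    gelfandFuks (planeBracket a b) c + gelfandFuks (planeBracket b c) a
      + gelfandFuks (planeBracket c a) b = 0 := by
  have h1 := ha.1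
  have h2 := hb.1
  have h3 := hc.1
  -- The primitive is `2W`, written as `W + W` so that the closure rules for sums and products
  -- suffice.
  have t := integral_eq_zero_of_eq_dz (f := dz^[3] (planeBracket a b) * c
      + dz^[3] (planeBracket b c) * a + dz^[3] (planeBracket c a) * b)
    (g := a * (dz b * dz (dz c) - dz c * dz (dz b)) + b * (dz c * dz (dz a) - dz a * dz (dz c))
      + c * (dz a * dz (dz b) - dz b * dz (dz a))
      + (a * (dz b * dz (dz c) - dz c * dz (dz b)) + b * (dz c * dz (dz a) - dz a * dz (dz c))
      + c * (dz a * dz (dz b) - dz b * dz (dz a)))) ?_ ?_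
  · rw [← t]
    exact ((MeasureTheory.integral_add
      ((((ha.planeBracket hb).dz_iterate 3).mul_right h3).add
        (((hb.planeBracket hc).dz_iterate 3).mul_right h1)).integrable
      (((hc.planeBracket ha).dz_iterate 3).mul_right h2).integrable).trans
      (congrArg₂ _ (MeasureTheory.integral_add
        (((ha.planeBracket hb).dz_iterate 3).mul_right h3).integrable
        (((hb.planeBracket hc).dz_iterate 3).mul_right h1).integrable) rfl)).symm
  · have h := fun {f g k : ℂ → ℂ} (hf : IsTest f) (hg : IsTest g) (hk : IsTest k) =>
      hf.mul_right ((hg.dz.mul_right hk.dz.dz.1).sub (hk.dz.mul_right hg.dz.dz.1)).1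
    have := ((h ha hb hc).add (h hb hc ha)).add (h hc ha hb)
    exact this.add this
  · simp (disch := (repeat' first
      | assumption | apply contDiff_dz | apply contDiff_mul | apply contDiff_add | apply contDiff_sub)) only
      [Function.iterate_succ_apply, Function.iterate_zero, id,
      planeBracket, dz_mul_smooth, dz_add_smooth, dz_sub_smooth]
    ring

/-! ## Transformation of third derivatives -/

theorem dz_eventuallyEq {f g : ℂ → ℂ} {z : ℂ} (h : f =ᶠ[𝓝 z] g) : dz f =ᶠ[𝓝 z] dz g := by
  filter_upwards [h.eventually_nhds] with w hw using dz_congr hw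

theorem dz_iterate_eventuallyEq {f g : ℂ → ℂ} {z : ℂ} (h : f =ᶠ[𝓝 z] g) (n : ℕ) :
    dz^[n] f =ᶠ[𝓝 z] dz^[n] g := by
  induction n with
  | zero => exact h
  | succ n ih => simp only [Function.iterate_succ_apply']; exact dz_eventuallyEq ih

theorem contDiffOn_dz_iterate {f : ℂ → ℂ} {s : Set ℂ} (hs : IsOpen s) (hf : ContDiffOn ℝ ∞ f s)
    (n : ℕ) : ContDiffOn ℝ ∞ (dz^[n] f) s := by
  induction n with
  | zero => exact hf
  | succ n ih => rw [Function.iterate_succ_apply']; exact contDiffOn_dz hs ih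

theorem dz_holo {f : ℂ → ℂ} {z : ℂ} (hf : DifferentiableAt ℂ f z) : dz f z = deriv f z := by
  simp only [dz, fderiv_real_apply hf]
  linear_combination (-deriv f z / 2) * Complex.I_sq

theorem differentiableAt_conj_holo {E : ℂ → ℂ} {z : ℂ} (hE : DifferentiableAt ℂ E z) :
    DifferentiableAt ℝ (fun w => (starRingEnd ℂ) (E w)) z :=
  (Complex.conjCLE : ℂ →L[ℝ] ℂ).differentiableAt.comp z (hE.restrictScalars ℝ)

theorem differentiableAt_comp_mul_conj {F τ g E : ℂ → ℂ} {z : ℂ} (hF : DifferentiableAt ℝ F (τ z))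
    (hτ : DifferentiableAt ℂ τ z) (hg : DifferentiableAt ℂ g z) (hE : DifferentiableAt ℂ E z) :
    DifferentiableAt ℝ (fun w => F (τ w) * g w * (starRingEnd ℂ) (E w)) z :=
  ((hF.comp z (hτ.restrictScalars ℝ)).mul (hg.restrictScalars ℝ)).mul (differentiableAt_conj_holo hE)

theorem dz_comp_mul_conj {F τ g E : ℂ → ℂ} {z : ℂ} (hF : DifferentiableAt ℝ F (τ z))
    (hτ : DifferentiableAt ℂ τ z) (hg : DifferentiableAt ℂ g z) (hE : DifferentiableAt ℂ E z) :
    dz (fun w => F (τ w) * g w * (starRingEnd ℂ) (E w)) z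
      = (dz F (τ z) * (deriv τ z * g z) + F (τ z) * deriv g z) * (starRingEnd ℂ) (E z) := by
  have h1 := hF.comp z (hτ.restrictScalars ℝ)
  have h := dz_mul (h1.mul (hg.restrictScalars ℝ)) (differentiableAt_conj_holo hE)
  rw [dz_conj_holo hE, dz_mul h1 (hg.restrictScalars ℝ), dz_comp_holo hF hτ, dz_holo hg] at h
  refine Eq.trans h ?_
  simp only [Function.comp_apply]
  ring

/-- The third derivative intertwines vector fields and quadratic differentials up to a Schwarzian
term and a term of order zero. -/
theorem dz_three_eq {O : Set ℂ} (hO : IsOpen O) {V : Set ℂ} (hV : IsOpen V) {F τ E c : ℂ → ℂ}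
    (hF : ContDiffOn ℝ ∞ F V) (hτV : Set.MapsTo τ O V) (hτ : ∀ w ∈ O, AnalyticAt ℂ τ w)
    (hp : ∀ w ∈ O, deriv τ w ≠ 0) (hE : ∀ w ∈ O, DifferentiableAt ℂ E w)
    (hc : ∀ w ∈ O, c w = F (τ w) * (deriv τ w)⁻¹ * (starRingEnd ℂ) (E w)) {z : ℂ} (hz : z ∈ O) :
    dz^[3] c z = (deriv τ z ^ 2 * dz^[3] F (τ z) - 2 * schwarzian τ z * dz F (τ z)
      + deriv (deriv (deriv fun w => (deriv τ w)⁻¹)) z * F (τ z)) * (starRingEnd ℂ) (E z) := by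
  set p := deriv τ with hpdef
  set u : ℂ → ℂ := fun w => (p w)⁻¹ with hu
  -- With `n = p'/p` the Schwarzian is `n' - n²/2`, and `u = 1/p` satisfies `u' = -nu`, so every
  -- coefficient is expressible through `n`.
  set n : ℂ → ℂ := fun w => deriv p w / p w with hn
  have ap : ∀ w ∈ O, AnalyticAt ℂ p w := fun w hw => (hτ w hw).deriv
  have au : ∀ w ∈ O, AnalyticAt ℂ u w := fun w hw => (ap w hw).inv (hp w hw)
  have an : ∀ w ∈ O, AnalyticAt ℂ n w := fun w hw => (ap w hw).deriv.div (ap w hw) (hp w hw)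
  have du : ∀ w ∈ O, deriv u w = -(n w * u w) := fun w hw => by
    rw [((ap w hw).differentiableAt.hasDerivAt.fun_inv (hp w hw)).deriv]
    simp only [hn, hu]
    have := hp w hw
    field_simp
  have ddu : ∀ w ∈ O, deriv (deriv u) w = -(deriv n w * u w) + n w ^ 2 * u w := fun w hw => by
    have h : deriv u =ᶠ[𝓝 w] fun w => -(n w * u w) := by
      filter_upwards [hO.mem_nhds hw] with v hv using du v hv
    rw [h.deriv_eq, (((an w hw).differentiableAt.hasDerivAt.fun_mul
      (au w hw).differentiableAt.hasDerivAt).fun_neg).deriv, du w hw]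
    ring
  have dF : ∀ k, ∀ w ∈ O, DifferentiableAt ℝ (dz^[k] F) (τ w) := fun k w hw =>
    ((contDiffOn_dz_iterate hV hF k).contDiffAt (hV.mem_nhds (hτV hw))).differentiableAt (by simp)
  -- The antiholomorphic factor is a constant for `∂`, so `∂` maps a term `(∂ᵏF ∘ τ) g Ē` to two
  -- terms of the same shape.
  have step : ∀ k, ∀ g : ℂ → ℂ, ∀ w ∈ O, DifferentiableAt ℂ g w →
      dz (fun w => dz^[k] F (τ w) * g w * (starRingEnd ℂ) (E w)) w
        = (dz^[k + 1] F (τ w) * (p w * g w) + dz^[k] F (τ w) * deriv g w)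
          * (starRingEnd ℂ) (E w) := fun k g w hw hg => by
    rw [dz_comp_mul_conj (dF k w hw) (hτ w hw).differentiableAt hg (hE w hw),
      Function.iterate_succ_apply']
  have diff : ∀ k, ∀ g : ℂ → ℂ, ∀ w ∈ O, DifferentiableAt ℂ g w →
      DifferentiableAt ℝ (fun w => dz^[k] F (τ w) * g w * (starRingEnd ℂ) (E w)) w :=
    fun k g w hw hg =>
      differentiableAt_comp_mul_conj (dF k w hw) (hτ w hw).differentiableAt hg (hE w hw)
  have s1 : ∀ w ∈ O, dz c w = ((fun w => dz^[1] F (τ w) * 1 * (starRingEnd ℂ) (E w))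
      + fun w => dz^[0] F (τ w) * deriv u w * (starRingEnd ℂ) (E w)) w := fun w hw => by
    have h : c =ᶠ[𝓝 w] fun w => dz^[0] F (τ w) * u w * (starRingEnd ℂ) (E w) := by
      filter_upwards [hO.mem_nhds hw] with v hv using hc v hv
    rw [dz_congr h, step 0 u w hw (au w hw).differentiableAt, mul_inv_cancel₀ (hp w hw)]
    simp only [Pi.add_apply]
    ring
  have s2 : ∀ w ∈ O, dz (dz c) w = ((fun w => dz^[2] F (τ w) * p w * (starRingEnd ℂ) (E w))
      + (fun w => dz^[1] F (τ w) * (-n w) * (starRingEnd ℂ) (E w))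
      + fun w => dz^[0] F (τ w) * deriv (deriv u) w * (starRingEnd ℂ) (E w)) w := fun w hw => by
    have h := Filter.eventuallyEq_of_mem (hO.mem_nhds hw) s1
    have d1 : DifferentiableAt ℂ (fun _ : ℂ => (1 : ℂ)) w := differentiableAt_const _
    have d2 := (au w hw).deriv.differentiableAt
    rw [dz_congr h, dz_add (diff 1 _ w hw d1) (diff 0 _ w hw d2), step 1 _ w hw d1,
      step 0 _ w hw d2, du w hw, deriv_const]
    simp only [Pi.add_apply, hu]
    have := hp w hw
    field_simp
    ring
  have h := Filter.eventuallyEq_of_mem (hO.mem_nhds hz) s2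
  have d1 := (ap z hz).differentiableAt
  have d2 := (an z hz).differentiableAt.fun_neg
  have d3 := (au z hz).deriv.deriv.differentiableAt
  rw [Function.iterate_succ_apply', Function.iterate_succ_apply', Function.iterate_succ_apply',
    Function.iterate_zero, id, dz_congr h,
    dz_add ((diff 2 _ z hz d1).add (diff 1 _ z hz d2)) (diff 0 _ z hz d3),
    dz_add (diff 2 _ z hz d1) (diff 1 _ z hz d2), step 2 _ z hz d1, step 1 _ z hz d2,
    step 0 _ z hz d3, ddu z hz, deriv.fun_neg]
  -- The two `F''` terms cancel because `p' = np`; the coefficient of `F'` is `-n' + p u'' = -2n' +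
  -- n²`, which is `-2S(τ)`.
  have hs : schwarzian τ z = deriv n z - 1 / 2 * n z ^ 2 := rfl
  have hpn : deriv p z = n z * p z := by simp only [hn]; field_simp [hp z hz]
  have hpu : p z * u z = 1 := mul_inv_cancel₀ (hp z hz)
  rw [hs, hpn]
  simp only [Function.iterate_succ_apply', Function.iterate_zero, id]
  linear_combination (dz F (τ z) * (starRingEnd ℂ) (E z) * (n z ^ 2 - deriv n z)) * hpu

/-- The choice `E = (τ')^q` accounts for the factor `(dz̄)^q`, so both form degrees are treated at
once. -/
theorem IsTensor.dz_three_eq {q : ℤ} {c : S.Coord → ℂ → ℂ} (hc : IsTensor S (-1) q c)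
    (φ ψ : S.Coord) {z : ℂ} (hz : z ∈ overlap φ ψ) :
    dz^[3] (c φ) z = (deriv (trans φ ψ) z ^ 2 * dz^[3] (c ψ) (trans φ ψ z)
      - 2 * schwarzian (trans φ ψ) z * dz (c ψ) (trans φ ψ z)
      + deriv (deriv (deriv fun w => (deriv (trans φ ψ) w)⁻¹)) z * c ψ (trans φ ψ z))
        * (starRingEnd ℂ) (deriv (trans φ ψ) z) ^ q := by
  rw [← map_zpow₀]
  refine RiemannSurface.dz_three_eq (isOpen_overlap φ ψ) ψ.open_target (hc.smooth ψ)
    (fun w hw => (trans_mem φ ψ hw).1) (fun w hw => analyticAt_trans φ ψ hw)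
    (fun w hw => deriv_trans_ne_zero φ ψ hw)
    (E := fun w => deriv (trans φ ψ) w ^ q) (fun w hw =>
      (analyticAt_trans φ ψ hw).deriv.differentiableAt.zpow (Or.inl (deriv_trans_ne_zero φ ψ hw)))
    (fun w hw => ?_) hz
  rw [hc.law φ ψ w hw, zpow_neg_one, map_zpow₀]

/-! ## The density of the cocycle is a `(1,1)`-form -/

theorem Lc.isTensor₀ (X : Lc S) : IsTensor S (-1) 0 X.coeff₀ := X.1.2.1
theorem Lc.isTensor₁ (X : Lc S) : IsTensor S (-1) 1 X.coeff₁ := X.2.2.1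

theorem Lc.mem_on_univ (X : Lc S) : X ∈ Lc.on (Set.univ : Set S) := ⟨X.1.2.2, X.2.2.2⟩

theorem Lc.exists_compact {U : Set S} {X : Lc S} (hX : X ∈ Lc.on U) :
    ∃ K ⊆ U, IsCompact K ∧ VanishesOff K X.coeff₀ ∧ VanishesOff K X.coeff₁ := by
  obtain ⟨⟨K, hKU, hK, h⟩, L, hLU, hL, h'⟩ := hX
  exact ⟨K ∪ L, Set.union_subset hKU hLU, hK.union hL,
    fun φ z hz hn => h φ z hz fun hk => hn (Or.inl hk),
    fun φ z hz hn => h' φ z hz fun hk => hn (Or.inr hk)⟩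

theorem Lc.coeff₁_bracket (X Y : Lc S) (φ : S.Coord) (z : ℂ) :
    (X.bracket Y).coeff₁ φ z = X.coeff₀ φ z * dz (Y.coeff₁ φ) z - Y.coeff₁ φ z * dz (X.coeff₀ φ) z
      + (X.coeff₁ φ z * dz (Y.coeff₀ φ) z - Y.coeff₀ φ z * dz (X.coeff₁ φ) z) := rfl

theorem ProjConn.contDiffOn (D : ProjConn S) (φ : S.Coord) : ContDiffOn ℝ ∞ (D.ρ φ) φ.target :=
  ((D.holo φ).contDiffOn (n := ∞) φ.open_target).restrict_scalars ℝ

/-- Locality: the value at a point depends only on the germs of the coefficients. This is what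
permits cut-offs later. -/
theorem ProjConn.density_congr (D : ProjConn S) {X X' Y Y' : Lc S} {φ : S.Coord} {z : ℂ}
    (h₀ : X.coeff₀ φ =ᶠ[𝓝 z] X'.coeff₀ φ) (h₁ : X.coeff₁ φ =ᶠ[𝓝 z] X'.coeff₁ φ)
    (k₀ : Y.coeff₀ φ =ᶠ[𝓝 z] Y'.coeff₀ φ) (k₁ : Y.coeff₁ φ =ᶠ[𝓝 z] Y'.coeff₁ φ) :
    D.density X Y φ z = D.density X' Y' φ z := by
  simp only [density, Lc.coeff₁_bracket, h₀.eq_of_nhds, h₁.eq_of_nhds, k₀.eq_of_nhds,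
    k₁.eq_of_nhds, dz_congr h₀, dz_congr h₁, dz_congr k₀, dz_congr k₁,
    (dz_iterate_eventuallyEq h₀ 3).eq_of_nhds, (dz_iterate_eventuallyEq h₁ 3).eq_of_nhds,
    (dz_iterate_eventuallyEq k₀ 3).eq_of_nhds, (dz_iterate_eventuallyEq k₁ 3).eq_of_nhds]

theorem dz_iterate_zero (n : ℕ) : dz^[n] (0 : ℂ → ℂ) = 0 := by
  induction n with
  | zero => rfl
  | succ n ih => rw [Function.iterate_succ_apply', ih]; exact funext dz_zero

theorem ProjConn.density_of_left (D : ProjConn S) {X : Lc S} (Y : Lc S) {φ : S.Coord} {z : ℂ}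
    (h₀ : X.coeff₀ φ =ᶠ[𝓝 z] 0) (h₁ : X.coeff₁ φ =ᶠ[𝓝 z] 0) : D.density X Y φ z = 0 := by
  simp [density, Lc.coeff₁_bracket, h₀.eq_of_nhds, h₁.eq_of_nhds, dz_congr h₀, dz_congr h₁, dz_zero,
    (dz_iterate_eventuallyEq h₀ 3).eq_of_nhds, (dz_iterate_eventuallyEq h₁ 3).eq_of_nhds,
    dz_iterate_zero]

theorem ProjConn.density_of_right (D : ProjConn S) (X : Lc S) {Y : Lc S} {φ : S.Coord} {z : ℂ}
    (h₀ : Y.coeff₀ φ =ᶠ[𝓝 z] 0) (h₁ : Y.coeff₁ φ =ᶠ[𝓝 z] 0) : D.density X Y φ z = 0 := by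
  simp [density, Lc.coeff₁_bracket, h₀.eq_of_nhds, h₁.eq_of_nhds, dz_congr h₀, dz_congr h₁, dz_zero,
    (dz_iterate_eventuallyEq h₀ 3).eq_of_nhds, (dz_iterate_eventuallyEq h₁ 3).eq_of_nhds,
    dz_iterate_zero]

theorem ProjConn.density_supportedIn (D : ProjConn S) {U : Set S} {X : Lc S} (hX : X ∈ Lc.on U)
    (Y : Lc S) : SupportedIn U (D.density X Y) := by
  obtain ⟨K, hKU, hK, h₀, h₁⟩ := Lc.exists_compact hX
  exact ⟨K, hKU, hK, fun φ z hz hn => D.density_of_left Y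
    (eventuallyEq_of_vanishesOff hK h₀ φ hz hn) (eventuallyEq_of_vanishesOff hK h₁ φ hz hn)⟩

/-- In `½(∂³α β - α ∂³β)` the zero-order terms of the transformation law cancel and the first-order
ones add up to `S(τ)(α ∂β - β ∂α)`. The Schwarzian in the law of `ρ` cancels this contribution. -/
theorem ProjConn.isTensor_density (D : ProjConn S) (X Y : Lc S) :
    IsTensor S 1 1 (D.density X Y) where
  smooth φ := by
    have x0 := X.isTensor₀.smooth φ
    have x1 := X.isTensor₁.smooth φ
    have y0 := Y.isTensor₀.smooth φ
    have y1 := Y.isTensor₁.smooth φ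
    have hd := fun {f : ℂ → ℂ} (h : ContDiffOn ℝ ∞ f φ.target) =>
      contDiffOn_dz_iterate φ.open_target h 3
    exact contDiffOn_const.mul ((contDiffOn_const.mul ((((hd x0).mul y1).sub (x0.mul (hd y1))).add
      (((hd x1).mul y0).sub (x1.mul (hd y0))))).sub
        ((D.contDiffOn φ).mul ((X.bracket Y).isTensor₁.smooth φ)))
  zero φ z hz := by
    simp [density, D.zero φ z hz, X.isTensor₀.zero φ z hz, X.isTensor₁.zero φ z hz,
      Y.isTensor₀.zero φ z hz, Y.isTensor₁.zero φ z hz]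
  law φ ψ z hz := by
    have hp := deriv_trans_ne_zero φ ψ hz
    simp only [density]
    rw [X.isTensor₀.dz_three_eq φ ψ hz, X.isTensor₁.dz_three_eq φ ψ hz,
      Y.isTensor₀.dz_three_eq φ ψ hz, Y.isTensor₁.dz_three_eq φ ψ hz, D.law φ ψ z hz,
      (X.bracket Y).isTensor₁.law φ ψ z hz, X.isTensor₀.law φ ψ z hz, X.isTensor₁.law φ ψ z hz,
      Y.isTensor₀.law φ ψ z hz, Y.isTensor₁.law φ ψ z hz, Lc.coeff₁_bracket]
    simp only [zpow_zero, zpow_one, zpow_neg_one, mul_one]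
    field_simp
    ring

theorem ProjConn.density_mem (D : ProjConn S) (X Y : Lc S) : D.density X Y ∈ S.Sections 1 1 :=
  ⟨D.isTensor_density X Y, D.density_supportedIn X.mem_on_univ Y⟩

/-- The `(1,1)`-form `(ρ - ρ') X₁`. -/
theorem ProjConn.diff_mem (D D' : ProjConn S) (X : Lc S) :
    (fun φ z => (D.ρ φ z - D'.ρ φ z) * X.coeff₁ φ z) ∈ S.Sections 1 1 := by
  refine ⟨⟨fun φ => ((D.contDiffOn φ).sub (D'.contDiffOn φ)).mul (X.isTensor₁.smooth φ),
    fun φ z hz => by simp [X.isTensor₁.zero φ z hz], fun φ ψ z hz => ?_⟩, ?_⟩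
  · have hp := deriv_trans_ne_zero φ ψ hz
    -- The Schwarzians cancel in `ρ - ρ'`, which is therefore a section of `K²`; multiplied by a
    -- section of `K⁻¹ ⊗ K̄` it gives one of `K ⊗ K̄`.
    rw [D.law φ ψ z hz, D'.law φ ψ z hz, X.isTensor₁.law φ ψ z hz, zpow_neg_one, zpow_one]
    field_simp
    ring
  · obtain ⟨K, hKU, hK, h⟩ := X.2.2.2
    exact ⟨K, hKU, hK, fun φ z hz hn => by
      simp only [mul_eq_zero]; exact Or.inr (h φ z hz hn)⟩

/-! ## Integration of `(1,1)`-forms -/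

theorem Coord.isCompact_image (φ : S.Coord) {K : Set S} (hK : IsCompact K) (hKφ : K ⊆ φ.source) :
    IsCompact (φ.toOpenPartialHomeomorph '' K) :=
  hK.image_of_continuousOn (φ.continuousOn.mono hKφ)

theorem Coord.mem_image_iff (φ : S.Coord) {K : Set S} (hKφ : K ⊆ φ.source) {z : ℂ}
    (hz : z ∈ φ.target) : z ∈ φ.toOpenPartialHomeomorph '' K ↔ φ.inv z ∈ K := by
  constructor
  · rintro ⟨x, hx, rfl⟩
    have h : φ.inv (φ.toOpenPartialHomeomorph x) = x := φ.left_inv (hKφ hx)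
    rwa [h]
  · exact fun h => ⟨_, h, φ.right_inv hz⟩

theorem Coord.image_subset_target (φ : S.Coord) {K : Set S} (hKφ : K ⊆ φ.source) :
    φ.toOpenPartialHomeomorph '' K ⊆ φ.target := by
  rintro _ ⟨x, hx, rfl⟩
  exact φ.map_source (hKφ hx)

/-- Nothing is assumed about `h` near the boundary of the target: only the compact image of `K`
contributes. -/
theorem Coord.integrableOn (φ : S.Coord) {h : ℂ → ℂ} (hh : ContinuousOn h φ.target) {K : Set S}
    (hK : IsCompact K) (hKφ : K ⊆ φ.source) (h0 : ∀ z ∈ φ.target, φ.inv z ∉ K → h z = 0) :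
    IntegrableOn h φ.target := by
  have h1 : IntegrableOn h (φ.toOpenPartialHomeomorph '' K) :=
    (hh.mono (φ.image_subset_target hKφ)).integrableOn_compact (φ.isCompact_image hK hKφ)
  exact h1.of_forall_sdiff_eq_zero φ.open_target.measurableSet
    fun z hz => h0 z hz.1 fun hk => hz.2 ((φ.mem_image_iff hKφ hz.1).2 hk)

theorem image_trans_overlap (φ ψ : S.Coord) : trans φ ψ '' overlap φ ψ = overlap ψ φ := by
  ext w
  constructor
  · rintro ⟨z, hz, rfl⟩
    exact trans_mem φ ψ hz
  · exact fun hw => ⟨_, trans_mem ψ φ hw, trans_trans_self ψ φ hw⟩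

theorem injOn_trans (φ ψ : S.Coord) : Set.InjOn (trans φ ψ) (overlap φ ψ) := fun z hz w hw h => by
  rw [← trans_trans_self φ ψ hz, h, trans_trans_self φ ψ hw]

/-- The Jacobian determinant of multiplication by a complex number. -/
theorem det_real_mul (a : ℂ) :
    (((ContinuousLinearMap.toSpanSingleton ℂ a).restrictScalars ℝ : ℂ →L[ℝ] ℂ)).det
      = Complex.normSq a := by
  rw [ContinuousLinearMap.det, ← LinearMap.det_toMatrix Complex.basisOneI, Matrix.det_fin_two]
  simp [LinearMap.toMatrix_apply, Complex.normSq_apply]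

/-- The real Jacobian `|τ'|²` of the holomorphic transition map is exactly the factor `τ' · conj τ'`
in the law of a `(1,1)`-form. The weight `g` makes room for the functions of a partition of unity.
-/
theorem setIntegral_overlap {c : S.Coord → ℂ → ℂ} (hc : IsTensor S 1 1 c) (g : S → ℂ)
    (φ ψ : S.Coord) : ∫ w in overlap ψ φ, g (ψ.inv w) * c ψ w
      = ∫ z in overlap φ ψ, g (φ.inv z) * c φ z := by
  rw [← image_trans_overlap φ ψ, integral_image_eq_integral_abs_det_fderiv_smul volume
    (isOpen_overlap φ ψ).measurableSet
    (fun z hz => ((analyticAt_trans φ ψ hz).differentiableAt.hasDerivAt.hasFDerivAt.restrictScalars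
      ℝ).hasFDerivWithinAt) (injOn_trans φ ψ)]
  refine setIntegral_congr_fun (isOpen_overlap φ ψ).measurableSet fun z hz => ?_
  have h1 : ψ.inv (trans φ ψ z) = φ.inv z := ψ.left_inv hz.2
  simp only [h1]
  rw [det_real_mul, hc.law φ ψ z hz, zpow_one, zpow_one, abs_of_nonneg (Complex.normSq_nonneg _),
    mul_assoc (c ψ _), Complex.mul_conj, Complex.real_smul]
  ring

theorem setIntegral_target {c : S.Coord → ℂ → ℂ} (hc : IsTensor S 1 1 c) (g : S → ℂ)
    (φ ψ : S.Coord) (hφ : ∀ z ∈ φ.target, φ.inv z ∉ ψ.source → g (φ.inv z) * c φ z = 0)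
    (hψ : ∀ z ∈ ψ.target, ψ.inv z ∉ φ.source → g (ψ.inv z) * c ψ z = 0) :
    ∫ w in ψ.target, g (ψ.inv w) * c ψ w = ∫ z in φ.target, g (φ.inv z) * c φ z := by
  have h1 : ∫ w in ψ.target, g (ψ.inv w) * c ψ w = ∫ w in overlap ψ φ, g (ψ.inv w) * c ψ w :=
    setIntegral_eq_of_subset_of_forall_sdiff_eq_zero ψ.open_target.measurableSet
      Set.inter_subset_left fun z hz => hψ z hz.1 fun h => hz.2 ⟨hz.1, h⟩
  have h2 : ∫ z in φ.target, g (φ.inv z) * c φ z = ∫ z in overlap φ ψ, g (φ.inv z) * c φ z :=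
    setIntegral_eq_of_subset_of_forall_sdiff_eq_zero φ.open_target.measurableSet
      Set.inter_subset_left fun z hz => hφ z hz.1 fun h => hz.2 ⟨hz.1, h⟩
  rw [h1, h2, setIntegral_overlap hc g φ ψ]

theorem finite_partition_inter {K : Set S} (hK : IsCompact K) :
    {x | (Function.support (S.partition x) ∩ K).Nonempty}.Finite :=
  S.partition.locallyFinite.finite_nonempty_inter_compact hK

theorem tsupport_partition_subset (x : S) : tsupport (S.partition x) ⊆ (S.coordAt x).source :=
  (exists_partition S).choose_spec x

/-- Together with `finite_partition_inter` this makes the sum defining `integral` finite; a `finsum`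
with infinite support would have the default value `0` and not be additive. -/
theorem support_integral_subset {c : S.Coord → ℂ → ℂ} {K : Set S} (h : VanishesOff K c) :
    (Function.support fun x : S => ∫ z in (S.coordAt x).target,
      ((S.partition x ((S.coordAt x).inv z) : ℝ) : ℂ) * c (S.coordAt x) z)
      ⊆ {x | (Function.support (S.partition x) ∩ K).Nonempty} := by
  intro x hx
  by_contra hn
  refine hx (setIntegral_eq_zero_of_forall_eq_zero fun z hz => ?_)
  by_cases hk : (S.coordAt x).inv z ∈ K
  · have : S.partition x ((S.coordAt x).inv z) = 0 := by
      by_contra h0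
      exact hn ⟨_, h0, hk⟩
    simp [this]
  · simp [h _ z hz hk]

/-- The integral of a form supported in the domain of one coordinate. -/
theorem integral_eq_setIntegral {c : S.Coord → ℂ → ℂ} (hc : IsTensor S 1 1 c) {φ : S.Coord}
    (hs : SupportedIn φ.source c) : integral c = ∫ z in φ.target, c φ z := by
  obtain ⟨K, hKφ, hK, h⟩ := hs
  rw [integral, finsum_eq_sum_of_support_subset (s := (finite_partition_inter hK).toFinset) _
    (by simpa using support_integral_subset h)]
  -- Each summand is moved to the coordinate `φ`: outside the preferred coordinate domain the
  -- partition function vanishes, outside `φ.source` the form does.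
  have h1 : ∀ x : S, ∫ z in (S.coordAt x).target,
      ((S.partition x ((S.coordAt x).inv z) : ℝ) : ℂ) * c (S.coordAt x) z
      = ∫ z in φ.target, ((S.partition x (φ.inv z) : ℝ) : ℂ) * c φ z := fun x => by
    refine setIntegral_target hc (fun y => ((S.partition x y : ℝ) : ℂ)) φ (S.coordAt x)
      (fun z _ hn => ?_) (fun z hz hn => ?_)
    · have : S.partition x (φ.inv z) = 0 := by
        by_contra h0
        exact hn (tsupport_partition_subset x (subset_tsupport _ h0))
      simp [this]
    · simp [h _ z hz fun hk => hn (hKφ hk)]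
  rw [Finset.sum_congr rfl fun x _ => h1 x, ← integral_finsetSum]
  · refine setIntegral_congr_fun φ.open_target.measurableSet fun z hz => ?_
    rw [← Finset.sum_mul]
    -- Over `K` the finitely many functions retained sum to `1`; off `K` the form is zero.
    by_cases hk : φ.inv z ∈ K
    · have hsum : ∑ x ∈ (finite_partition_inter hK).toFinset, S.partition x (φ.inv z) = 1 := by
        rw [← S.partition.sum_eq_one (Set.mem_univ (φ.inv z))]
        refine (finsum_eq_sum_of_support_subset _ fun x hx => ?_).symm
        simpa using ⟨φ.inv z, hx, hk⟩
      rw [← Complex.ofReal_sum, hsum]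
      simp
    · simp [h _ z hz hk]
  · intro x _
    refine φ.integrableOn ?_ hK hKφ fun z hz hn => by simp [h _ z hz hn]
    exact (Complex.continuous_ofReal.comp_continuousOn
      ((S.partition x).continuous.comp_continuousOn φ.continuousOn_symm)).mul
      (hc.smooth φ).continuousOn

theorem integrableOn_partition_mul (c : S.Sections 1 1) (x : S) :
    IntegrableOn (fun z => ((S.partition x ((S.coordAt x).inv z) : ℝ) : ℂ) * c.1 (S.coordAt x) z)
      (S.coordAt x).target := by
  obtain ⟨hc, K, -, hK, h⟩ := c.2
  refine (S.coordAt x).integrableOn (K := K ∩ tsupport (S.partition x)) ?_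
    (hK.inter_right (isClosed_tsupport _))
    (fun y hy => tsupport_partition_subset x hy.2) fun z hz hn => ?_
  · exact (Complex.continuous_ofReal.comp_continuousOn
      ((S.partition x).continuous.comp_continuousOn (S.coordAt x).continuousOn_symm)).mul
      (hc.smooth _).continuousOn
  · by_cases hk : (S.coordAt x).inv z ∈ K
    · have : S.partition x ((S.coordAt x).inv z) = 0 := by
        by_contra h0
        exact hn ⟨hk, subset_tsupport _ h0⟩
      simp [this]
    · simp [h _ z hz hk]

/-- Integration as a linear functional on compactly supported `(1,1)`-forms. -/
def integralLinear (S : RiemannSurface.{u}) : S.Sections 1 1 →ₗ[ℂ] ℂ where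
  toFun c := integral c.1
  map_add' c d := by
    obtain ⟨-, K, -, hK, h⟩ := c.2
    obtain ⟨-, L, -, hL, h'⟩ := d.2
    simp only [integral]
    rw [← finsum_add_distrib ((finite_partition_inter hK).subset (support_integral_subset h))
      ((finite_partition_inter hL).subset (support_integral_subset h'))]
    refine finsum_congr fun x => ?_
    rw [← integral_add (integrableOn_partition_mul c x) (integrableOn_partition_mul d x)]
    simp [mul_add]
  map_smul' a c := by
    simp only [integral, RingHom.id_apply, smul_eq_mul]
    rw [← smul_eq_mul, smul_finsum]
    refine finsum_congr fun x => ?_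
    rw [smul_eq_mul, ← integral_const_mul]
    simp [mul_left_comm]

theorem integralLinear_apply (c : S.Sections 1 1) : integralLinear S c = integral c.1 := rfl

/-! ## Smooth functions and localization of sections -/

/-- A chart of the maximal atlas is a coordinate. -/
def coordOfMaximalAtlas (e : OpenPartialHomeomorph S ℂ)
    (he : e ∈ IsManifold.maximalAtlas 𝓘(ℂ) ω S) : S.Coord where
  toOpenPartialHomeomorph := e
  holo := contMDiffOn_of_mem_maximalAtlas he
  holo_symm := contMDiffOn_symm_of_mem_maximalAtlas he

theorem contDiffOn_real_trans (φ ψ : S.Coord) : ContDiffOn ℝ ∞ (trans φ ψ) (overlap φ ψ) :=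
  ((contDiffOn_trans φ ψ).restrict_scalars ℝ).of_le (by simp)

/-- Smooth bump functions and partitions of unity live on the underlying real manifold; the members
of `S.partition` are only continuous and cannot multiply smooth sections. -/
instance isManifold_real (S : RiemannSurface.{u}) : IsManifold 𝓘(ℝ, ℂ) ∞ S := by
  refine isManifold_of_contDiffOn _ _ _ fun e e' he he' => ?_
  have h := contDiffOn_real_trans
    (coordOfMaximalAtlas e (IsManifold.subset_maximalAtlas he))
    (coordOfMaximalAtlas e' (IsManifold.subset_maximalAtlas he'))
  refine h.mono fun z hz => ?_
  simpa [overlap, coordOfMaximalAtlas] using hz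

/-- A complex function on `S` which is smooth in all coordinates. -/
def IsSmooth (χ : S → ℂ) : Prop := ∀ φ : S.Coord, ContDiffOn ℝ ∞ (fun z => χ (φ.inv z)) φ.target

/-- Manifold smoothness is tested in the preferred charts. Any other coordinate differs from such a
chart by a holomorphic transition map, which is smooth over the reals. -/
theorem isSmooth_of_contMDiff {χ : S → ℝ} (h : ContMDiff 𝓘(ℝ, ℂ) 𝓘(ℝ, ℝ) ∞ χ) :
    IsSmooth fun x => (χ x : ℂ) := by
  have h1 : ∀ x : S, ContDiffOn ℝ ∞ (fun z => χ ((S.coordAt x).inv z)) (S.coordAt x).target :=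
    fun x => contMDiffOn_iff_contDiffOn.1
      (h.comp_contMDiffOn (contMDiffOn_chart_symm (I := 𝓘(ℝ, ℂ)) (n := ∞) (x := x)))
  intro φ z hz
  have hz' : z ∈ overlap φ (S.coordAt (φ.inv z)) := ⟨hz, mem_chart_source ℂ (φ.inv z)⟩
  have h2 := (h1 (φ.inv z)).comp (contDiffOn_real_trans φ (S.coordAt (φ.inv z)))
    fun w hw => (trans_mem φ _ hw).1
  have h3 := h2.contDiffAt ((isOpen_overlap _ _).mem_nhds hz')
  refine (Complex.ofRealCLM.contDiff.contDiffAt.comp z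
    (h3.congr_of_eventuallyEq ?_)).contDiffWithinAt
  filter_upwards [(isOpen_overlap _ _).mem_nhds hz'] with w hw
  have : (S.coordAt (φ.inv z)).inv (trans φ (S.coordAt (φ.inv z)) w) = φ.inv w :=
    (S.coordAt (φ.inv z)).left_inv hw.2
  simp only [Function.comp_apply, this]

/-- Multiplication of sections by a smooth function. -/
def mulSection {χ : S → ℂ} (hχ : IsSmooth χ) {p q : ℤ} (c : S.Sections p q) : S.Sections p q :=
  ⟨fun φ z => χ (φ.inv z) * c.1 φ z, ⟨fun φ => (hχ φ).mul (c.2.1.smooth φ),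
    fun φ z hz => by simp [c.2.1.zero φ z hz], fun φ ψ z hz => by
      have : ψ.inv (trans φ ψ z) = φ.inv z := ψ.left_inv hz.2
      rw [this, c.2.1.law φ ψ z hz]
      ring⟩, by
    obtain ⟨K, hKU, hK, h⟩ := c.2.2
    exact ⟨K, hKU, hK, fun φ z hz hn => by simp [h φ z hz hn]⟩⟩

theorem mulSection_apply {χ : S → ℂ} (hχ : IsSmooth χ) {p q : ℤ} (c : S.Sections p q)
    (φ : S.Coord) (z : ℂ) : (mulSection hχ c).1 φ z = χ (φ.inv z) * c.1 φ z := rfl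

theorem mulSection_supportedIn {χ : S → ℂ} (hχ : IsSmooth χ) {p q : ℤ} (c : S.Sections p q)
    {U : Set S} (hU : tsupport χ ⊆ U) : SupportedIn U (mulSection hχ c).1 := by
  obtain ⟨K, -, hK, h⟩ := c.2.2
  refine ⟨K ∩ tsupport χ, Set.inter_subset_right.trans hU, hK.inter_right (isClosed_tsupport _),
    fun φ z hz hn => ?_⟩
  rw [mulSection_apply]
  by_cases hk : φ.inv z ∈ K
  · have : χ (φ.inv z) = 0 := by
      by_contra h0
      exact hn ⟨hk, subset_tsupport _ h0⟩
    simp [this]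
  · simp [h _ z hz hk]

theorem tsupport_ofReal_subset {χ : S → ℝ} : tsupport (fun x => (χ x : ℂ)) ⊆ tsupport χ :=
  closure_mono fun x hx => by simpa using hx

/-- Every compactly supported section is a finite sum of sections supported in the domains of
coordinates. -/
theorem Sections.induction {p q : ℤ} {P : S.Sections p q → Prop} (h0 : P 0)
    (hadd : ∀ c d, P c → P d → P (c + d))
    (hloc : ∀ (φ : S.Coord) (c : S.Sections p q), SupportedIn φ.source c.1 → P c)
    (c : S.Sections p q) : P c := by
  have : LocallyCompactSpace S := ChartedSpace.locallyCompactSpace ℂ S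
  obtain ⟨f, hf⟩ := SmoothPartitionOfUnity.exists_isSubordinate_chartAt_source 𝓘(ℝ, ℂ) S
  obtain ⟨-, K, -, hK, h⟩ := c.2
  have hs := fun x => isSmooth_of_contMDiff (f x).contMDiff
  have hfin : {x | (Function.support (f x) ∩ K).Nonempty}.Finite :=
    f.locallyFinite.finite_nonempty_inter_compact hK
  -- Only the functions whose support meets `K` matter, and there are finitely many of them.
  have hc : c = ∑ x ∈ hfin.toFinset, mulSection (hs x) c := by
    apply Subtype.ext
    rw [AddSubmonoidClass.coe_finsetSum]
    funext φ z
    simp only [Finset.sum_apply, mulSection_apply]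
    rw [← Finset.sum_mul]
    by_cases hz : z ∈ φ.target
    · by_cases hk : φ.inv z ∈ K
      · have hsum : ∑ x ∈ hfin.toFinset, f x (φ.inv z) = 1 := by
          rw [← f.sum_eq_one (Set.mem_univ (φ.inv z))]
          refine (finsum_eq_sum_of_support_subset _ fun x hx => ?_).symm
          simpa using ⟨φ.inv z, hx, hk⟩
        rw [← Complex.ofReal_sum, hsum]
        simp
      · simp [h _ z hz hk]
    · simp [c.2.1.zero φ z hz]
  rw [hc]
  generalize hfin.toFinset = s
  classical
  induction s using Finset.induction_on with
  | empty => simpa using h0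
  | insert x s hx ih =>
    rw [Finset.sum_insert hx]
    exact hadd _ _ (hloc (S.coordAt x) _
      (mulSection_supportedIn (hs x) c (tsupport_ofReal_subset.trans (hf x)))) ih

theorem Lc.induction {P : Lc S → Prop} (h0 : P 0) (hadd : ∀ X Y, P X → P Y → P (X + Y))
    (hloc : ∀ (φ : S.Coord), ∀ X ∈ Lc.on φ.source, P X) (X : Lc S) : P X := by
  have h : X = (X.1, 0) + (0, X.2) := by simp
  rw [h]
  refine hadd _ _ ?_ ?_
  · refine Sections.induction (P := fun c => P (c, 0)) h0 (fun c d hc hd => ?_)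
      (fun φ c hc => hloc φ _ ⟨hc, SupportedIn.zero _⟩) X.1
    simpa using hadd _ _ hc hd
  · refine Sections.induction (P := fun c => P (0, c)) h0 (fun c d hc hd => ?_)
      (fun φ c hc => hloc φ _ ⟨SupportedIn.zero _, hc⟩) X.2
    simpa using hadd _ _ hc hd

/-! ### Locality and cut-offs near a compact set. -/

theorem planeBracket_congr {a a' b b' : ℂ → ℂ} {z : ℂ} (h : a =ᶠ[𝓝 z] a') (k : b =ᶠ[𝓝 z] b') :
    planeBracket a b z = planeBracket a' b' z := by
  simp only [planeBracket, Pi.sub_apply, Pi.mul_apply, dz_congr h, dz_congr k, h.eq_of_nhds,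
    k.eq_of_nhds]

theorem planeBracket_eventuallyEq {a a' b b' : ℂ → ℂ} {z : ℂ} (h : a =ᶠ[𝓝 z] a')
    (k : b =ᶠ[𝓝 z] b') : planeBracket a b =ᶠ[𝓝 z] planeBracket a' b' := by
  filter_upwards [h.eventually_nhds, k.eventually_nhds] with w hw kw
  exact planeBracket_congr hw kw

/-- The elements `X` and `Y` agree in a neighbourhood of `K`. -/
def Lc.AgreeNear (K : Set S) (X Y : Lc S) : Prop := ∀ φ : S.Coord, ∀ z ∈ φ.target, φ.inv z ∈ K →
  X.coeff₀ φ =ᶠ[𝓝 z] Y.coeff₀ φ ∧ X.coeff₁ φ =ᶠ[𝓝 z] Y.coeff₁ φ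

/-- Both components are multiplied by a smooth function equal to `1` near `K` and supported in `U`.
Agreement on a neighbourhood, not merely on `K`, is what survives differentiation. -/
theorem Lc.exists_agreeNear {K U : Set S} (hK : IsCompact K) (hU : IsOpen U) (hKU : K ⊆ U)
    (X : Lc S) : ∃ X' ∈ Lc.on U, Lc.AgreeNear K X X' := by
  have : LocallyCompactSpace S := ChartedSpace.locallyCompactSpace ℂ S
  obtain ⟨f, hf0, hf1, -⟩ := exists_contMDiffMap_zero_one_nhds_of_isClosed 𝓘(ℝ, ℂ) (n := ⊤)
    hU.isClosed_compl hK.isClosed (Set.disjoint_compl_left_iff_subset.2 hKU)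
  have hs := isSmooth_of_contMDiff f.contMDiff
  have ht : tsupport (fun x => (f x : ℂ)) ⊆ U := by
    -- The function vanishes on a neighbourhood of the complement of `U`, so its closed support,
    -- too, stays inside `U`.
    refine tsupport_ofReal_subset.trans fun x hx => ?_
    by_contra hxU
    exact (mem_closure_iff_frequently.1 hx) (by
      filter_upwards [(Filter.eventually_all.2 fun _ : Unit => eventually_nhdsSet_iff_forall.1 hf0 x hxU)]
        with y hy using by simpa using hy ())
  refine ⟨(mulSection hs X.1, mulSection hs X.2), ⟨mulSection_supportedIn hs _ ht,
    mulSection_supportedIn hs _ ht⟩, fun φ z hz hk => ?_⟩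
  have hev : ∀ᶠ w in 𝓝 z, f (φ.inv w) = 1 :=
    (φ.continuousOn_symm.continuousAt (φ.open_target.mem_nhds hz)).eventually
      (eventually_nhdsSet_iff_forall.1 hf1 _ hk)
  constructor <;> filter_upwards [hev] with w hw <;>
    simp [Lc.coeff₀, Lc.coeff₁, mulSection_apply, hw]

theorem Lc.AgreeNear.dbar {K : Set S} {X Y : Lc S} (h : Lc.AgreeNear K X Y) :
    Lc.AgreeNear K X.dbar Y.dbar := fun φ z hz hk => by
  refine ⟨Filter.EventuallyEq.rfl, ?_⟩
  filter_upwards [(h φ z hz hk).1.eventually_nhds] with w hw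
  simp only [Lc.coeff₁, Lc.dbar, dbarCoeff, Set.indicator, dzbar_congr hw]

theorem Lc.AgreeNear.bracket {K : Set S} {X X' Y Y' : Lc S} (h : Lc.AgreeNear K X X')
    (k : Lc.AgreeNear K Y Y') : Lc.AgreeNear K (X.bracket Y) (X'.bracket Y') := fun φ z hz hk => by
  have h' := h φ z hz hk
  have k' := k φ z hz hk
  exact ⟨planeBracket_eventuallyEq h'.1 k'.1,
    (planeBracket_eventuallyEq h'.1 k'.2).add (planeBracket_eventuallyEq h'.2 k'.1)⟩

theorem Lc.AgreeNear.refl (K : Set S) (X : Lc S) : Lc.AgreeNear K X X := fun _ _ _ _ =>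
  ⟨Filter.EventuallyEq.rfl, Filter.EventuallyEq.rfl⟩

theorem ProjConn.density_agreeNear (D : ProjConn S) {K : Set S} (hK : IsCompact K) {X Y Y' : Lc S}
    (h₀ : VanishesOff K X.coeff₀) (h₁ : VanishesOff K X.coeff₁) (h : Lc.AgreeNear K Y Y') :
    D.density X Y = D.density X Y' := by
  funext φ z
  by_cases hz : z ∈ φ.target
  · by_cases hk : φ.inv z ∈ K
    · exact D.density_congr .rfl .rfl (h φ z hz hk).1 (h φ z hz hk).2
    · have e₀ := eventuallyEq_of_vanishesOff hK h₀ φ hz hk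
      have e₁ := eventuallyEq_of_vanishesOff hK h₁ φ hz hk
      rw [D.density_of_left Y e₀ e₁, D.density_of_left Y' e₀ e₁]
  · rw [(D.isTensor_density X Y).zero φ z hz, (D.isTensor_density X Y').zero φ z hz]

/-! ## The dg Lie algebra of Dolbeault vector fields -/

theorem Lc.ext_coeff {X Y : Lc S} (h₀ : ∀ φ : S.Coord, ∀ z ∈ φ.target, X.coeff₀ φ z = Y.coeff₀ φ z)
    (h₁ : ∀ φ : S.Coord, ∀ z ∈ φ.target, X.coeff₁ φ z = Y.coeff₁ φ z) : X = Y := by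
  refine Prod.ext (Subtype.ext (funext fun φ => funext fun z => ?_))
    (Subtype.ext (funext fun φ => funext fun z => ?_))
  · by_cases hz : z ∈ φ.target
    · exact h₀ φ z hz
    · exact (X.isTensor₀.zero φ z hz).trans (Y.isTensor₀.zero φ z hz).symm
  · by_cases hz : z ∈ φ.target
    · exact h₁ φ z hz
    · exact (X.isTensor₁.zero φ z hz).trans (Y.isTensor₁.zero φ z hz).symm

theorem Lc.coeff₀_bracket (X Y : Lc S) (φ : S.Coord) :
    (X.bracket Y).coeff₀ φ = planeBracket (X.coeff₀ φ) (Y.coeff₀ φ) := rfl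

theorem Lc.coeff₁_bracket_eq (X Y : Lc S) (φ : S.Coord) :
    (X.bracket Y).coeff₁ φ = planeBracket (X.coeff₀ φ) (Y.coeff₁ φ)
      + planeBracket (X.coeff₁ φ) (Y.coeff₀ φ) := rfl

theorem Lc.coeff₀_dbar (X : Lc S) (φ : S.Coord) : X.dbar.coeff₀ φ = 0 := rfl

theorem Lc.coeff₁_dbar (X : Lc S) (φ : S.Coord) :
    X.dbar.coeff₁ φ = φ.target.indicator (dzbar (X.coeff₀ φ)) := rfl

theorem Lc.coeff₁_dbar_eventuallyEq (X : Lc S) (φ : S.Coord) {z : ℂ} (hz : z ∈ φ.target) :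
    X.dbar.coeff₁ φ =ᶠ[𝓝 z] dzbar (X.coeff₀ φ) := by
  filter_upwards [φ.open_target.mem_nhds hz] with w hw
  rw [Lc.coeff₁_dbar, Set.indicator_of_mem hw]

theorem Lc.coeff₀_add (X Y : Lc S) (φ : S.Coord) : (X + Y).coeff₀ φ = X.coeff₀ φ + Y.coeff₀ φ := rfl
theorem Lc.coeff₁_add (X Y : Lc S) (φ : S.Coord) : (X + Y).coeff₁ φ = X.coeff₁ φ + Y.coeff₁ φ := rfl
theorem Lc.coeff₀_smul (a : ℂ) (X : Lc S) (φ : S.Coord) : (a • X).coeff₀ φ = a • X.coeff₀ φ := rfl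
theorem Lc.coeff₁_smul (a : ℂ) (X : Lc S) (φ : S.Coord) : (a • X).coeff₁ φ = a • X.coeff₁ φ := rfl
theorem Lc.coeff₀_neg (X : Lc S) (φ : S.Coord) : (-X).coeff₀ φ = -X.coeff₀ φ := rfl
theorem Lc.coeff₁_neg (X : Lc S) (φ : S.Coord) : (-X).coeff₁ φ = -X.coeff₁ φ := rfl
theorem Lc.coeff₀_zero (φ : S.Coord) : (0 : Lc S).coeff₀ φ = 0 := rfl
theorem Lc.coeff₁_zero (φ : S.Coord) : (0 : Lc S).coeff₁ φ = 0 := rfl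

theorem Lc.contDiffAt₀ (X : Lc S) {φ : S.Coord} {z : ℂ} (hz : z ∈ φ.target) :
    ContDiffAt ℝ ∞ (X.coeff₀ φ) z := (X.isTensor₀.smooth φ).contDiffAt (φ.open_target.mem_nhds hz)

theorem Lc.contDiffAt₁ (X : Lc S) {φ : S.Coord} {z : ℂ} (hz : z ∈ φ.target) :
    ContDiffAt ℝ ∞ (X.coeff₁ φ) z := (X.isTensor₁.smooth φ).contDiffAt (φ.open_target.mem_nhds hz)

theorem planeBracket_add_left {a a' b : ℂ → ℂ} {z : ℂ} (h : ContDiffAt ℝ ∞ a z)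
    (h' : ContDiffAt ℝ ∞ a' z) :
    planeBracket (a + a') b z = planeBracket a b z + planeBracket a' b z := by
  simp only [planeBracket, Pi.sub_apply, Pi.mul_apply, Pi.add_apply,
    dz_add (h.differentiableAt (by simp)) (h'.differentiableAt (by simp))]
  ring

theorem planeBracket_smul_left {a b : ℂ → ℂ} {z : ℂ} (t : ℂ) (h : ContDiffAt ℝ ∞ a z) :
    planeBracket (t • a) b z = t * planeBracket a b z := by
  simp only [planeBracket, Pi.sub_apply, Pi.mul_apply, Pi.smul_apply, smul_eq_mul,
    dz_const_smul t (h.differentiableAt (by simp))]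
  ring

theorem planeBracket_swap (a b : ℂ → ℂ) : planeBracket a b = -planeBracket b a := by
  simp only [planeBracket]; ring

theorem planeBracket_zero_left (b : ℂ → ℂ) : planeBracket 0 b = 0 := by
  funext z
  simp [planeBracket, dz_zero]

theorem planeBracket_zero_right (b : ℂ → ℂ) : planeBracket b 0 = 0 := by
  rw [planeBracket_swap, planeBracket_zero_left, neg_zero]

/-- Here and in the Leibniz and Jacobi rules below no Koszul sign appears, even for inhomogeneous
elements. The signed versions are recovered at the end, because the bracket of two elements of
degree `1` is zero. -/
theorem Lc.bracket_swap (X Y : Lc S) : X.bracket Y = -Y.bracket X := by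
  refine Lc.ext_coeff (fun φ z _ => ?_) (fun φ z _ => ?_)
  · rw [Lc.coeff₀_neg, Lc.coeff₀_bracket, Lc.coeff₀_bracket, planeBracket_swap]
  · rw [Lc.coeff₁_neg, Lc.coeff₁_bracket_eq, Lc.coeff₁_bracket_eq, planeBracket_swap,
      planeBracket_swap (X.coeff₁ φ), neg_add_rev]

theorem Lc.bracket_add_left (X X' Y : Lc S) :
    (X + X').bracket Y = X.bracket Y + X'.bracket Y := by
  refine Lc.ext_coeff (fun φ z hz => ?_) (fun φ z hz => ?_)
  · simp only [Lc.coeff₀_add, Lc.coeff₀_bracket, Pi.add_apply,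
      planeBracket_add_left (X.contDiffAt₀ hz) (X'.contDiffAt₀ hz)]
  · simp only [Lc.coeff₁_add, Lc.coeff₀_add, Lc.coeff₁_bracket_eq, Pi.add_apply,
      planeBracket_add_left (X.contDiffAt₀ hz) (X'.contDiffAt₀ hz),
      planeBracket_add_left (X.contDiffAt₁ hz) (X'.contDiffAt₁ hz)]
    ring

theorem Lc.bracket_smul_left (a : ℂ) (X Y : Lc S) : (a • X).bracket Y = a • X.bracket Y := by
  refine Lc.ext_coeff (fun φ z hz => ?_) (fun φ z hz => ?_)
  · simp only [Lc.coeff₀_smul, Lc.coeff₀_bracket, Pi.smul_apply, smul_eq_mul,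
      planeBracket_smul_left a (X.contDiffAt₀ hz)]
  · simp only [Lc.coeff₁_smul, Lc.coeff₀_smul, Lc.coeff₁_bracket_eq, Pi.smul_apply, smul_eq_mul,
      Pi.add_apply, planeBracket_smul_left a (X.contDiffAt₀ hz),
      planeBracket_smul_left a (X.contDiffAt₁ hz)]
    ring

theorem Lc.isLinearMap_bracket_left (Y : Lc S) : IsLinearMap ℂ (fun X : Lc S => X.bracket Y) :=
  ⟨fun X X' => Lc.bracket_add_left X X' Y, fun a X => Lc.bracket_smul_left a X Y⟩

theorem Lc.isLinearMap_bracket_right (X : Lc S) : IsLinearMap ℂ (Lc.bracket X) := by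
  constructor
  · intro Y Y'
    rw [Lc.bracket_swap, Lc.bracket_add_left, Lc.bracket_swap X Y, Lc.bracket_swap X Y', neg_add]
  · intro a Y
    rw [Lc.bracket_swap, Lc.bracket_smul_left, Lc.bracket_swap X Y, smul_neg]

theorem Lc.isLinearMap_dbar : IsLinearMap ℂ (Lc.dbar : Lc S → Lc S) := by
  constructor
  · intro X Y
    refine Lc.ext_coeff (fun φ z hz => ?_) (fun φ z hz => ?_)
    · simp [Lc.coeff₀_add, Lc.coeff₀_dbar]
    · simp only [Lc.coeff₁_add, Lc.coeff₁_dbar, Lc.coeff₀_add, Pi.add_apply,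
        Set.indicator_of_mem hz, dzbar_add ((X.contDiffAt₀ hz).differentiableAt (by simp))
        ((Y.contDiffAt₀ hz).differentiableAt (by simp))]
  · intro a X
    refine Lc.ext_coeff (fun φ z hz => ?_) (fun φ z hz => ?_)
    · simp [Lc.coeff₀_smul, Lc.coeff₀_dbar]
    · simp only [Lc.coeff₁_smul, Lc.coeff₁_dbar, Lc.coeff₀_smul, Pi.smul_apply, smul_eq_mul,
        Set.indicator_of_mem hz, dzbar_const_smul a ((X.contDiffAt₀ hz).differentiableAt (by simp))]

theorem Lc.dbar_dbar (X : Lc S) : X.dbar.dbar = 0 := by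
  refine Lc.ext_coeff (fun φ z hz => rfl) (fun φ z hz => ?_)
  rw [Lc.coeff₁_dbar, Set.indicator_of_mem hz, Lc.coeff₀_dbar, dzbar_zero]
  rfl

theorem Lc.dbar_bracket (X Y : Lc S) :
    (X.bracket Y).dbar = X.dbar.bracket Y + X.bracket Y.dbar := by
  refine Lc.ext_coeff (fun φ z hz => ?_) (fun φ z hz => ?_)
  · simp [Lc.coeff₀_add, Lc.coeff₀_bracket, Lc.coeff₀_dbar, planeBracket_zero_left,
      planeBracket_zero_right]
  · simp only [Lc.coeff₁_add, Lc.coeff₁_bracket_eq, Lc.coeff₀_dbar, Lc.coeff₁_dbar (X.bracket Y),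
      Lc.coeff₀_bracket, Set.indicator_of_mem hz, planeBracket_zero_left, planeBracket_zero_right,
      Pi.add_apply, zero_add, add_zero,
      dzbar_planeBracket (X.contDiffAt₀ hz) (Y.contDiffAt₀ hz),
      planeBracket_congr (X.coeff₁_dbar_eventuallyEq φ hz) (.refl _ (Y.coeff₀ φ)),
      planeBracket_congr (.refl _ (X.coeff₀ φ)) (Y.coeff₁_dbar_eventuallyEq φ hz)]

theorem Lc.jacobi (X Y Z : Lc S) :
    (X.bracket Y).bracket Z + (Y.bracket Z).bracket X + (Z.bracket X).bracket Y = 0 := by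
  refine Lc.ext_coeff (fun φ z hz => ?_) (fun φ z hz => ?_)
  · exact planeBracket_jacobi (X.contDiffAt₀ hz) (Y.contDiffAt₀ hz) (Z.contDiffAt₀ hz)
  · have hb {a b : ℂ → ℂ} := contDiffAt_planeBracket (a := a) (b := b) (z := z)
    have x0 := X.contDiffAt₀ hz
    have x1 := X.contDiffAt₁ hz
    have y0 := Y.contDiffAt₀ hz
    have y1 := Y.contDiffAt₁ hz
    have z0 := Z.contDiffAt₀ hz
    have z1 := Z.contDiffAt₁ hz
    simp only [Lc.coeff₁_add, Lc.coeff₁_bracket_eq, Lc.coeff₀_bracket, Pi.add_apply,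
      planeBracket_add_left (hb x0 y1) (hb x1 y0), planeBracket_add_left (hb y0 z1) (hb y1 z0),
      planeBracket_add_left (hb z0 x1) (hb z1 x0), Lc.coeff₁_zero, Pi.zero_apply]
    -- The part of form degree `1` is a sum of three Jacobi identities on the plane, one for each
    -- argument that can contribute its `dz̄` coefficient.
    linear_combination planeBracket_jacobi x0 y0 z1 + planeBracket_jacobi x0 y1 z0
      + planeBracket_jacobi x1 y0 z0

/-! ## Functions supported in a coordinate domain -/

theorem Coord.eventuallyEq_zero (φ : S.Coord) {h : ℂ → ℂ} {K : Set S} (hK : IsCompact K)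
    (hKφ : K ⊆ φ.source) (h0 : ∀ z ∈ φ.target, φ.inv z ∉ K → h z = 0)
    (h1 : ∀ z ∉ φ.target, h z = 0) {z : ℂ} (hz : z ∉ φ.toOpenPartialHomeomorph '' K) :
    h =ᶠ[𝓝 z] 0 := by
  filter_upwards [(φ.isCompact_image hK hKφ).isClosed.isOpen_compl.mem_nhds hz] with w hw
  by_cases hwt : w ∈ φ.target
  · exact h0 w hwt fun hk => hw ((φ.mem_image_iff hKφ hwt).2 hk)
  · exact h1 w hwt

/-- Extension by zero is smooth across the boundary of the target because the image of `K` is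
compact, hence closed in `ℂ`. -/
theorem Coord.isTest (φ : S.Coord) {h : ℂ → ℂ} (hh : ContDiffOn ℝ ∞ h φ.target) {K : Set S}
    (hK : IsCompact K) (hKφ : K ⊆ φ.source) (h0 : ∀ z ∈ φ.target, φ.inv z ∉ K → h z = 0)
    (h1 : ∀ z ∉ φ.target, h z = 0) : IsTest h := by
  constructor
  · refine contDiff_iff_contDiffAt.2 fun z => ?_
    by_cases hz : z ∈ φ.target
    · exact hh.contDiffAt (φ.open_target.mem_nhds hz)
    · exact contDiffAt_const.congr_of_eventuallyEq
        (φ.eventuallyEq_zero hK hKφ h0 h1 fun hk => hz (φ.image_subset_target hKφ hk))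
  · refine HasCompactSupport.intro (φ.isCompact_image hK hKφ) fun z hz => ?_
    exact (φ.eventuallyEq_zero hK hKφ h0 h1 hz).eq_of_nhds

theorem IsTensor.isTest {p q : ℤ} {c : S.Coord → ℂ → ℂ} (hc : IsTensor S p q c) {φ : S.Coord}
    (hs : SupportedIn φ.source c) : IsTest (c φ) := by
  obtain ⟨K, hKφ, hK, h⟩ := hs
  exact φ.isTest (hc.smooth φ) hK hKφ (h φ) (hc.zero φ)

/-- A holomorphic function pairs to zero with `∂̄`-exact forms. -/
theorem setIntegral_holo_mul_dbar {p : ℤ} {c : S.Coord → ℂ → ℂ} (hc : IsTensor S p 0 c)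
    {φ : S.Coord} (hs : SupportedIn φ.source c) {r : ℂ → ℂ} (hr : DifferentiableOn ℂ r φ.target) :
    ∫ z in φ.target, r z * dbarCoeff c φ z = 0 := by
  obtain ⟨K, hKφ, hK, h⟩ := hs
  have h0 : ∀ z ∈ φ.target, φ.inv z ∉ K → (r * c φ) z = 0 := fun z hz hn => by
    simp [h φ z hz hn]
  have h1 : ∀ z ∉ φ.target, (r * c φ) z = 0 := fun z hz => by simp [hc.zero φ z hz]
  -- The product is a test function on the whole plane although `r` is holomorphic only on the
  -- target.
  have ht : IsTest (r * c φ) := φ.isTest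
    (((hr.contDiffOn (n := ∞) φ.open_target).restrict_scalars ℝ).mul (hc.smooth φ)) hK hKφ h0 h1
  have h2 : ∀ z ∉ φ.target, dzbar (r * c φ) z = 0 := fun z hz => by
    rw [dzbar_congr (φ.eventuallyEq_zero hK hKφ h0 h1 fun hk => hz (φ.image_subset_target hKφ hk)),
      dzbar_zero]
  rw [← ht.integral_dzbar, ← setIntegral_eq_integral_of_forall_compl_eq_zero h2]
  refine setIntegral_congr_fun φ.open_target.measurableSet fun z hz => ?_
  have hrz := hr.differentiableAt (φ.open_target.mem_nhds hz)
  rw [dzbar_mul (hrz.restrictScalars ℝ) (hc.differentiableAt φ hz), dzbar_holo hrz, dbarCoeff,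
    Set.indicator_of_mem hz]
  ring

theorem Lc.isTest₀ {φ : S.Coord} {X : Lc S} (hX : X ∈ Lc.on φ.source) : IsTest (X.coeff₀ φ) :=
  X.isTensor₀.isTest hX.1

theorem Lc.isTest₁ {φ : S.Coord} {X : Lc S} (hX : X ∈ Lc.on φ.source) : IsTest (X.coeff₁ φ) :=
  X.isTensor₁.isTest hX.2

theorem Lc.dbar_mem_on {U : Set S} {X : Lc S} (hX : X ∈ Lc.on U) : X.dbar ∈ Lc.on U :=
  ⟨SupportedIn.zero U, hX.1.dbar⟩

theorem Lc.bracket_mem_on {U : Set S} {X : Lc S} (hX : X ∈ Lc.on U) (Y : Lc S) :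
    X.bracket Y ∈ Lc.on U :=
  ⟨hX.1.bracket, SupportedIn.add hX.1.bracket hX.2.bracket⟩

theorem Lc.on_mono {U V : Set S} (h : U ⊆ V) : Lc.on U ≤ (Lc.on V : Submodule ℂ (Lc S)) := by
  rintro X ⟨⟨K, hK, h1⟩, L, hL, h2⟩
  exact ⟨⟨K, hK.trans h, h1⟩, L, hL.trans h, h2⟩

/-! ## Bilinearity and symmetry of the density -/

theorem dz_iterate_add {s : Set ℂ} (hs : IsOpen s) {f g : ℂ → ℂ} (hf : ContDiffOn ℝ ∞ f s)
    (hg : ContDiffOn ℝ ∞ g s) (n : ℕ) {z : ℂ} (hz : z ∈ s) :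
    dz^[n] (f + g) z = dz^[n] f z + dz^[n] g z := by
  induction n generalizing z with
  | zero => rfl
  | succ n ih =>
    have h : dz^[n] (f + g) =ᶠ[𝓝 z] dz^[n] f + dz^[n] g :=
      Filter.eventuallyEq_of_mem (hs.mem_nhds hz) fun w hw => ih hw
    have d := fun {k : ℂ → ℂ} (hk : ContDiffOn ℝ ∞ k s) =>
      ((contDiffOn_dz_iterate hs hk n).contDiffAt (hs.mem_nhds hz)).differentiableAt (by simp)
    simp only [Function.iterate_succ_apply']
    rw [dz_congr h, dz_add (d hf) (d hg)]

theorem dz_iterate_smul {s : Set ℂ} (hs : IsOpen s) {f : ℂ → ℂ} (a : ℂ) (hf : ContDiffOn ℝ ∞ f s)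
    (n : ℕ) {z : ℂ} (hz : z ∈ s) : dz^[n] (a • f) z = a * dz^[n] f z := by
  induction n generalizing z with
  | zero => rfl
  | succ n ih =>
    have h : dz^[n] (a • f) =ᶠ[𝓝 z] a • dz^[n] f :=
      Filter.eventuallyEq_of_mem (hs.mem_nhds hz) fun w hw => ih hw
    simp only [Function.iterate_succ_apply']
    rw [dz_congr h, dz_const_smul a
      (((contDiffOn_dz_iterate hs hf n).contDiffAt (hs.mem_nhds hz)).differentiableAt (by simp))]

theorem ProjConn.density_swap (D : ProjConn S) (X Y : Lc S) :
    D.density X Y = -D.density Y X := by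
  funext φ z
  simp only [density, Pi.neg_apply]
  rw [Lc.bracket_swap X Y, Lc.coeff₁_neg, Pi.neg_apply]
  ring

theorem ProjConn.density_add_left (D : ProjConn S) (X X' Y : Lc S) :
    D.density (X + X') Y = D.density X Y + D.density X' Y := by
  funext φ z
  by_cases hz : z ∈ φ.target
  · simp only [density, Pi.add_apply, Lc.bracket_add_left, Lc.coeff₀_add, Lc.coeff₁_add,
      dz_iterate_add φ.open_target (X.isTensor₀.smooth φ) (X'.isTensor₀.smooth φ) 3 hz,
      dz_iterate_add φ.open_target (X.isTensor₁.smooth φ) (X'.isTensor₁.smooth φ) 3 hz]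
    ring
  · simp [(D.isTensor_density _ Y).zero φ z hz]

theorem ProjConn.density_smul_left (D : ProjConn S) (a : ℂ) (X Y : Lc S) :
    D.density (a • X) Y = a • D.density X Y := by
  funext φ z
  by_cases hz : z ∈ φ.target
  · simp only [density, Pi.smul_apply, smul_eq_mul, Lc.bracket_smul_left, Lc.coeff₀_smul,
      Lc.coeff₁_smul, dz_iterate_smul φ.open_target a (X.isTensor₀.smooth φ) 3 hz,
      dz_iterate_smul φ.open_target a (X.isTensor₁.smooth φ) 3 hz]
    ring
  · simp [(D.isTensor_density _ Y).zero φ z hz]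

/-! ## The global form -/

theorem ProjConn.omega_eq (D : ProjConn S) (X Y : Lc S) :
    D.omega X Y = integralLinear S ⟨_, D.density_mem X Y⟩ := rfl

theorem ProjConn.isLinearMap_omega_left (D : ProjConn S) (Y : Lc S) :
    IsLinearMap ℂ (fun X => D.omega X Y) := by
  constructor
  · intro X X'
    simp only [omega_eq]
    rw [← map_add]
    exact congrArg _ (Subtype.ext (D.density_add_left X X' Y))
  · intro a X
    simp only [omega_eq]
    rw [← map_smul]
    exact congrArg _ (Subtype.ext (D.density_smul_left a X Y))

theorem ProjConn.omega_swap (D : ProjConn S) (X Y : Lc S) : D.omega X Y = -D.omega Y X := by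
  simp only [omega_eq]
  rw [← map_neg]
  exact congrArg _ (Subtype.ext (D.density_swap X Y))

theorem ProjConn.isLinearMap_omega_right (D : ProjConn S) (X : Lc S) :
    IsLinearMap ℂ (D.omega X) := by
  have h := D.isLinearMap_omega_left X
  constructor
  · intro Y Y'
    rw [D.omega_swap, h.map_add, D.omega_swap X Y, D.omega_swap X Y', neg_add]
  · intro a Y
    rw [D.omega_swap, h.map_smul, D.omega_swap X Y, smul_neg]

theorem Coord.setIntegral_target_eq (φ : S.Coord) {h : ℂ → ℂ} (h1 : ∀ z ∉ φ.target, h z = 0) :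
    ∫ z in φ.target, h z = ∫ z, h z :=
  setIntegral_eq_integral_of_forall_compl_eq_zero h1

theorem ProjConn.isTest_mul_coeff₁ (D : ProjConn S) {φ : S.Coord} {X : Lc S}
    (hX : X ∈ Lc.on φ.source) : IsTest (fun z => D.ρ φ z * X.coeff₁ φ z) := by
  obtain ⟨K, hKφ, hK, h⟩ := hX.2
  exact φ.isTest ((D.contDiffOn φ).mul (X.isTensor₁.smooth φ)) hK hKφ
    (fun z hz hn => by simp [h φ z hz hn]) (fun z hz => by simp [D.zero φ z hz])

/-- The integrands vanish off the target, so the local form becomes one over the whole plane, to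
which the integration by parts above applies. -/
theorem ProjConn.omegaLocal_eq (D : ProjConn S) {φ : S.Coord} {X Y : Lc S}
    (hX : X ∈ Lc.on φ.source) (hY : Y ∈ Lc.on φ.source) :
    D.omegaLocal φ X Y = 1 / (2 * Real.pi) * (1 / 12) *
      (gelfandFuks (X.coeff₀ φ) (Y.coeff₁ φ) + gelfandFuks (X.coeff₁ φ) (Y.coeff₀ φ)
        - ∫ z, D.ρ φ z * (X.bracket Y).coeff₁ φ z) := by
  have h := integral_add (((Lc.isTest₀ hX).dz_iterate 3).mul_right (Lc.isTest₁ hY).1).integrable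
    (((Lc.isTest₁ hX).dz_iterate 3).mul_right (Lc.isTest₀ hY).1).integrable
  simp only [Pi.mul_apply] at h
  rw [omegaLocal, RiemannSurface.omegaLocal, pairLocal, φ.setIntegral_target_eq
    (fun z hz => by rw [Y.isTensor₀.zero φ z hz, Y.isTensor₁.zero φ z hz, mul_zero, mul_zero,
      add_zero]), φ.setIntegral_target_eq (fun z hz => by rw [D.zero φ z hz, zero_mul]), h]
  simp only [gelfandFuks]
  ring

/-- The density has its third derivatives distributed evenly over both arguments. By
`gelfandFuks_swap` the two halves have equal integrals, so the integral is that of the one-sided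
expression. -/
theorem ProjConn.omega_eq_omegaLocal (D : ProjConn S) {φ : S.Coord} {X Y : Lc S}
    (hX : X ∈ Lc.on φ.source) (hY : Y ∈ Lc.on φ.source) :
    D.omega X Y = D.omegaLocal φ X Y := by
  have x0 := Lc.isTest₀ hX
  have x1 := Lc.isTest₁ hX
  have y0 := Lc.isTest₀ hY
  have y1 := Lc.isTest₁ hY
  have i1 := ((x0.dz_iterate 3).mul_right y1.1).integrable
  have i2 := ((y1.dz_iterate 3).mul_right x0.1).integrable
  have i3 := ((x1.dz_iterate 3).mul_right y0.1).integrable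
  have i4 := ((y0.dz_iterate 3).mul_right x1.1).integrable
  have i5 : Integrable (fun z => (dz^[3] (X.coeff₀ φ) * Y.coeff₁ φ) z
      - (dz^[3] (Y.coeff₁ φ) * X.coeff₀ φ) z) := i1.sub i2
  have i6 : Integrable (fun z => (dz^[3] (X.coeff₁ φ) * Y.coeff₀ φ) z
      - (dz^[3] (Y.coeff₀ φ) * X.coeff₁ φ) z) := i3.sub i4
  have i7 : Integrable (fun z => (1 / 2 : ℂ) *
      (((dz^[3] (X.coeff₀ φ) * Y.coeff₁ φ) z - (dz^[3] (Y.coeff₁ φ) * X.coeff₀ φ) z)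
        + ((dz^[3] (X.coeff₁ φ) * Y.coeff₀ φ) z - (dz^[3] (Y.coeff₀ φ) * X.coeff₁ φ) z))) :=
    (i5.add i6).const_mul _
  have hd : D.density X Y φ = fun z => 1 / (2 * Real.pi) * (1 / 12) *
      ((1 / 2) * (((dz^[3] (X.coeff₀ φ) * Y.coeff₁ φ) z - (dz^[3] (Y.coeff₁ φ) * X.coeff₀ φ) z)
        + ((dz^[3] (X.coeff₁ φ) * Y.coeff₀ φ) z - (dz^[3] (Y.coeff₀ φ) * X.coeff₁ φ) z))
      - D.ρ φ z * (X.bracket Y).coeff₁ φ z) := by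
    funext z
    simp only [density, Pi.mul_apply]
    ring
  rw [D.omegaLocal_eq hX hY, omega, integral_eq_setIntegral (D.isTensor_density X Y)
    (D.density_supportedIn hX Y), φ.setIntegral_target_eq ((D.isTensor_density X Y).zero φ), hd,
    integral_const_mul, integral_sub i7
      (D.isTest_mul_coeff₁ (Lc.bracket_mem_on hX Y)).integrable, integral_const_mul,
    integral_add i5 i6, integral_sub i1 i2, integral_sub i3 i4]
  have g1 := gelfandFuks_swap y1 x0
  have g2 := gelfandFuks_swap y0 x1
  simp only [gelfandFuks] at g1 g2 ⊢
  simp only [Pi.mul_apply]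
  rw [g1, g2]
  ring

/-! ### The cocycle identities in one coordinate domain. -/

theorem Lc.coeff₁_dbar_eq {φ : S.Coord} {X : Lc S} (hX : X ∈ Lc.on φ.source) :
    X.dbar.coeff₁ φ = dzbar (X.coeff₀ φ) := by
  obtain ⟨⟨K, hKφ, hK, h⟩, -⟩ := hX
  funext z
  by_cases hz : z ∈ φ.target
  · rw [Lc.coeff₁_dbar, Set.indicator_of_mem hz]
  · rw [Lc.coeff₁_dbar, Set.indicator_of_notMem hz, dzbar_congr (φ.eventuallyEq_zero hK hKφ (h φ)
      (X.isTensor₀.zero φ) fun hk => hz (φ.image_subset_target hKφ hk)), dzbar_zero]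

theorem gelfandFuks_zero_left (b : ℂ → ℂ) : gelfandFuks 0 b = 0 := by
  simp [gelfandFuks, dz_iterate_zero]

theorem gelfandFuks_zero_right (b : ℂ → ℂ) : gelfandFuks b 0 = 0 := by
  simp [gelfandFuks]

theorem gelfandFuks_add_left {a a' b : ℂ → ℂ} (ha : IsTest a) (ha' : IsTest a') (hb : IsTest b) :
    gelfandFuks (a + a') b = gelfandFuks a b + gelfandFuks a' b := by
  have h : dz^[3] (a + a') = dz^[3] a + dz^[3] a' := funext fun z =>
    dz_iterate_add isOpen_univ ha.1.contDiffOn ha'.1.contDiffOn 3 (Set.mem_univ z)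
  simp only [gelfandFuks, h, Pi.add_apply, add_mul]
  exact integral_add ((ha.dz_iterate 3).mul_right hb.1).integrable
    ((ha'.dz_iterate 3).mul_right hb.1).integrable

theorem ProjConn.omega_closed_on (D : ProjConn S) {φ : S.Coord} {X Y : Lc S}
    (hX : X ∈ Lc.on φ.source) (hY : Y ∈ Lc.on φ.source) :
    D.omega X.dbar Y + D.omega X Y.dbar = 0 := by
  rw [D.omega_eq_omegaLocal (Lc.dbar_mem_on hX) hY, D.omega_eq_omegaLocal hX (Lc.dbar_mem_on hY),
    D.omegaLocal_eq (Lc.dbar_mem_on hX) hY, D.omegaLocal_eq hX (Lc.dbar_mem_on hY),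
    Lc.coeff₁_dbar_eq hX, Lc.coeff₁_dbar_eq hY, Lc.coeff₀_dbar, Lc.coeff₀_dbar,
    gelfandFuks_zero_left, gelfandFuks_zero_right]
  have h1 := gelfandFuks_dzbar (Lc.isTest₀ hX) (Lc.isTest₀ hY)
  -- By the Leibniz rule the sum is the pairing of the holomorphic `ρ` with `∂̄[X, Y]`, which is
  -- zero by Stokes.
  have h2 : (∫ z, D.ρ φ z * (X.dbar.bracket Y).coeff₁ φ z)
      + ∫ z, D.ρ φ z * (X.bracket Y.dbar).coeff₁ φ z = 0 := by
    rw [← integral_add (D.isTest_mul_coeff₁ (Lc.bracket_mem_on (Lc.dbar_mem_on hX) Y)).integrable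
      (D.isTest_mul_coeff₁ (Lc.bracket_mem_on hX _)).integrable,
      ← setIntegral_holo_mul_dbar (X.bracket Y).isTensor₀ (Lc.bracket_mem_on hX Y).1 (D.holo φ),
      φ.setIntegral_target_eq (fun z hz => by simp [D.zero φ z hz])]
    refine integral_congr_ae (.of_forall fun z => ?_)
    change _ = D.ρ φ z * (X.bracket Y).dbar.coeff₁ φ z
    rw [Lc.dbar_bracket, Lc.coeff₁_add, Pi.add_apply]
    ring
  linear_combination 1 / (2 * Real.pi) * (1 / 12) * (h1 - h2)

theorem ProjConn.omega_jacobi_on (D : ProjConn S) {φ : S.Coord} {X Y Z : Lc S}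
    (hX : X ∈ Lc.on φ.source) (hY : Y ∈ Lc.on φ.source) (hZ : Z ∈ Lc.on φ.source) :
    D.omega (X.bracket Y) Z + D.omega (Y.bracket Z) X + D.omega (Z.bracket X) Y = 0 := by
  have x0 := Lc.isTest₀ hX
  have x1 := Lc.isTest₁ hX
  have y0 := Lc.isTest₀ hY
  have y1 := Lc.isTest₁ hY
  have z0 := Lc.isTest₀ hZ
  have z1 := Lc.isTest₁ hZ
  have hXY := Lc.bracket_mem_on hX Y
  have hYZ := Lc.bracket_mem_on hY Z
  have hZX := Lc.bracket_mem_on hZ X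
  have i1 := (D.isTest_mul_coeff₁ (Lc.bracket_mem_on hXY Z)).integrable
  have i2 := (D.isTest_mul_coeff₁ (Lc.bracket_mem_on hYZ X)).integrable
  have i3 := (D.isTest_mul_coeff₁ (Lc.bracket_mem_on hZX Y)).integrable
  have h2 : (∫ z, D.ρ φ z * ((X.bracket Y).bracket Z).coeff₁ φ z)
      + (∫ z, D.ρ φ z * ((Y.bracket Z).bracket X).coeff₁ φ z)
      + ∫ z, D.ρ φ z * ((Z.bracket X).bracket Y).coeff₁ φ z = 0 := by
    have i12 : Integrable (fun z => D.ρ φ z * ((X.bracket Y).bracket Z).coeff₁ φ z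
        + D.ρ φ z * ((Y.bracket Z).bracket X).coeff₁ φ z) := i1.add i2
    rw [← integral_add i1 i2, ← integral_add i12 i3, ← integral_zero ℂ ℂ]
    refine integral_congr_ae (.of_forall fun z => ?_)
    have h := congrArg (fun V : Lc S => V.coeff₁ φ z) (Lc.jacobi X Y Z)
    simp only [Lc.coeff₁_add, Pi.add_apply, Lc.coeff₁_zero, Pi.zero_apply] at h
    simp only
    linear_combination D.ρ φ z * h
  rw [D.omega_eq_omegaLocal hXY hZ, D.omega_eq_omegaLocal hYZ hX, D.omega_eq_omegaLocal hZX hY,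
    D.omegaLocal_eq hXY hZ, D.omegaLocal_eq hYZ hX, D.omegaLocal_eq hZX hY]
  simp only [Lc.coeff₁_bracket_eq (X := X) (Y := Y), Lc.coeff₁_bracket_eq (X := Y) (Y := Z),
    Lc.coeff₁_bracket_eq (X := Z) (Y := X), Lc.coeff₀_bracket] at h2 ⊢
  rw [gelfandFuks_add_left (x0.planeBracket y1) (x1.planeBracket y0) z0,
    gelfandFuks_add_left (y0.planeBracket z1) (y1.planeBracket z0) x0,
    gelfandFuks_add_left (z0.planeBracket x1) (z1.planeBracket x0) y0]
  -- The third-derivative part is three instances of the cocycle identity on the plane, according to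
  -- the argument contributing its `dz̄` coefficient; the `ρ` part is the Jacobi identity of the
  -- bracket.
  linear_combination 1 / (2 * Real.pi) * (1 / 12) * (gelfandFuks_jacobi x0 y0 z1
    + gelfandFuks_jacobi x0 y1 z0 + gelfandFuks_jacobi x1 y0 z0 - h2)

/-! ### From one coordinate domain to the whole surface. -/

theorem ProjConn.omega_agreeNear (D : ProjConn S) {K : Set S} (hK : IsCompact K) {X Y Y' : Lc S}
    (h₀ : VanishesOff K X.coeff₀) (h₁ : VanishesOff K X.coeff₁) (h : Lc.AgreeNear K Y Y') :
    D.omega X Y = D.omega X Y' := by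
  rw [omega, omega, D.density_agreeNear hK h₀ h₁ h]

theorem vanishesOff_bracketCoeff {K : Set S} (hK : IsCompact K) {a : S.Coord → ℂ → ℂ}
    (h : VanishesOff K a) (b : S.Coord → ℂ → ℂ) : VanishesOff K (bracketCoeff a b) :=
  fun φ z hz hn => by
    have e := eventuallyEq_of_vanishesOff hK h φ hz hn
    simp [bracketCoeff, dz_congr e, dz_zero, e.eq_of_nhds]

theorem vanishesOff_dbarCoeff {K : Set S} (hK : IsCompact K) {a : S.Coord → ℂ → ℂ}
    (h : VanishesOff K a) : VanishesOff K (dbarCoeff a) := fun φ z hz hn => by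
  rw [dbarCoeff, Set.indicator_of_mem hz, dzbar_congr (eventuallyEq_of_vanishesOff hK h φ hz hn),
    dzbar_zero]

theorem VanishesOff.add {K : Set S} {a b : S.Coord → ℂ → ℂ} (ha : VanishesOff K a)
    (hb : VanishesOff K b) : VanishesOff K (a + b) := fun φ z hz hn => by
  simp [ha φ z hz hn, hb φ z hz hn]

theorem Lc.bracket_agreeNear {K : Set S} (hK : IsCompact K) {X Y Y' : Lc S}
    (h₀ : VanishesOff K X.coeff₀) (h₁ : VanishesOff K X.coeff₁) (h : Lc.AgreeNear K Y Y') :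
    X.bracket Y = X.bracket Y' := by
  have h' := Lc.AgreeNear.bracket (.refl K X) h
  refine Lc.ext_coeff (fun φ z hz => ?_) (fun φ z hz => ?_) <;> by_cases hk : φ.inv z ∈ K
  · exact (h' φ z hz hk).1.eq_of_nhds
  · exact (vanishesOff_bracketCoeff hK h₀ Y.coeff₀ φ z hz hk).trans
      (vanishesOff_bracketCoeff hK h₀ Y'.coeff₀ φ z hz hk).symm
  · exact (h' φ z hz hk).2.eq_of_nhds
  · have e (V : Lc S) : (X.bracket V).coeff₁ φ z = 0 :=
      (vanishesOff_bracketCoeff hK h₀ V.coeff₁).add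
        (vanishesOff_bracketCoeff hK h₁ V.coeff₀) φ z hz hk
    rw [e, e]

/-- Additivity in `X` reduces to `X` with compact support `K` in a coordinate domain. All terms see
`Y` only near `K`, so `Y` may be cut off to the same domain. -/
theorem ProjConn.omega_closed (D : ProjConn S) (X Y : Lc S) :
    D.omega X.dbar Y + D.omega X Y.dbar = 0 := by
  have l1 := D.isLinearMap_omega_left Y
  have l2 := D.isLinearMap_omega_left Y.dbar
  refine Lc.induction (P := fun X => D.omega X.dbar Y + D.omega X Y.dbar = 0) ?_ ?_ ?_ X
  · rw [Lc.isLinearMap_dbar.map_zero, l1.map_zero, l2.map_zero, add_zero]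
  · intro X X' h h'
    rw [Lc.isLinearMap_dbar.map_add, l1.map_add, l2.map_add]
    linear_combination h + h'
  · intro φ X hX
    obtain ⟨K, hKφ, hK, h₀, h₁⟩ := Lc.exists_compact hX
    obtain ⟨Y', hY', hYY'⟩ := Lc.exists_agreeNear hK φ.open_source hKφ Y
    rw [D.omega_agreeNear hK (X := X.dbar) (fun _ _ _ _ => rfl) (vanishesOff_dbarCoeff hK h₀) hYY',
      D.omega_agreeNear hK h₀ h₁ hYY'.dbar]
    exact D.omega_closed_on hX hY'

/-- The same localization works because `X` occurs in every term, either directly or inside a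
bracket whose support it controls. -/
theorem ProjConn.omega_jacobi (D : ProjConn S) (X Y Z : Lc S) :
    D.omega (X.bracket Y) Z + D.omega (Y.bracket Z) X + D.omega (Z.bracket X) Y = 0 := by
  have l1 := D.isLinearMap_omega_left Z
  have l2 := D.isLinearMap_omega_right (Y.bracket Z)
  have l3 := D.isLinearMap_omega_left Y
  have b1 := Lc.isLinearMap_bracket_left Y
  have b2 := Lc.isLinearMap_bracket_right Z
  refine Lc.induction (P := fun X => D.omega (X.bracket Y) Z + D.omega (Y.bracket Z) X
    + D.omega (Z.bracket X) Y = 0) ?_ ?_ ?_ X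
  · rw [b1.map_zero, b2.map_zero, l1.map_zero, l2.map_zero, l3.map_zero, add_zero, add_zero]
  · intro X X' h h'
    rw [b1.map_add, b2.map_add, l1.map_add, l2.map_add, l3.map_add]
    linear_combination h + h'
  · intro φ X hX
    obtain ⟨K, hKφ, hK, h₀, h₁⟩ := Lc.exists_compact hX
    obtain ⟨Y', hY', hYY'⟩ := Lc.exists_agreeNear hK φ.open_source hKφ Y
    obtain ⟨Z', hZ', hZZ'⟩ := Lc.exists_agreeNear hK φ.open_source hKφ Z
    have e : ∀ W V V' : Lc S, Lc.AgreeNear K V V' →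
        D.omega (X.bracket W) V = D.omega (X.bracket W) V' := fun W V V' h =>
      D.omega_agreeNear hK (vanishesOff_bracketCoeff hK h₀ _)
        ((vanishesOff_bracketCoeff hK h₀ _).add (vanishesOff_bracketCoeff hK h₁ _)) h
    have e1 : D.omega (X.bracket Y) Z = D.omega (X.bracket Y') Z' := by
      rw [Lc.bracket_agreeNear hK h₀ h₁ hYY', e _ _ _ hZZ']
    have e2 : D.omega (Y.bracket Z) X = D.omega (Y'.bracket Z') X := by
      -- The exchange puts `X` in the first slot, since `ProjConn.omega_agreeNear` replaces the
      -- second argument.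
      rw [D.omega_swap, D.omega_agreeNear hK h₀ h₁ (hYY'.bracket hZZ'), ← D.omega_swap]
    have e3 : D.omega (Z.bracket X) Y = D.omega (Z'.bracket X) Y' := by
      rw [Lc.bracket_swap Z, Lc.bracket_swap Z', (D.isLinearMap_omega_left Y).map_neg,
        (D.isLinearMap_omega_left Y').map_neg, Lc.bracket_agreeNear hK h₀ h₁ hZZ', e _ _ _ hYY']
    rw [e1, e2, e3]
    exact D.omega_jacobi_on hX hY' hZ'

/-! ## Grading -/

theorem Lc.mem_deg {i : ℤ} {X : Lc S} (h : X ∈ Lc.deg S i) :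
    (i = 0 ∧ X.2 = 0) ∨ (i = 1 ∧ X.1 = 0) ∨ X = 0 := by
  unfold Lc.deg at h
  split_ifs at h with h0 h1
  · exact Or.inl ⟨h0, h.2⟩
  · exact Or.inr (Or.inl ⟨h1, h.1⟩)
  · exact Or.inr (Or.inr h)

theorem Lc.mem_deg_zero {X : Lc S} : X ∈ Lc.deg S 0 ↔ X.2 = 0 := by
  simp [Lc.deg, Submodule.mem_prod]

theorem Lc.mem_deg_one {X : Lc S} : X ∈ Lc.deg S 1 ↔ X.1 = 0 := by
  simp [Lc.deg, Submodule.mem_prod]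

/-- The dichotomy behind all sign arguments: degree `0` makes the sign trivial, and two arguments
without function component have zero bracket and zero pairing. -/
theorem Lc.eq_zero_or_fst {i : ℤ} {X : Lc S} (h : X ∈ Lc.deg S i) : i = 0 ∨ X.1 = 0 := by
  rcases Lc.mem_deg h with h | h | h
  · exact Or.inl h.1
  · exact Or.inr h.2
  · exact Or.inr (by rw [h]; rfl)

theorem Lc.snd_eq_zero {i : ℤ} (hi : i ≠ 1) {X : Lc S} (h : X ∈ Lc.deg S i) : X.2 = 0 := by
  rcases Lc.mem_deg h with h | h | h
  · exact h.2
  · exact absurd h.1 hi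
  · rw [h]; rfl

theorem Lc.coeff₀_of_fst {X : Lc S} (h : X.1 = 0) (φ : S.Coord) : X.coeff₀ φ = 0 := by
  rw [Lc.coeff₀, h]; rfl

theorem Lc.coeff₁_of_snd {X : Lc S} (h : X.2 = 0) (φ : S.Coord) : X.coeff₁ φ = 0 := by
  rw [Lc.coeff₁, h]; rfl

theorem Lc.bracket_fst_of_left {X : Lc S} (h : X.1 = 0) (Y : Lc S) : (X.bracket Y).1 = 0 :=
  Subtype.ext (funext fun φ => (Lc.coeff₀_bracket X Y φ).trans
    (by rw [Lc.coeff₀_of_fst h, planeBracket_zero_left]; rfl))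

theorem Lc.bracket_fst_of_right (X : Lc S) {Y : Lc S} (h : Y.1 = 0) : (X.bracket Y).1 = 0 := by
  rw [Lc.bracket_swap, Prod.fst_neg, Lc.bracket_fst_of_left h, neg_zero]

theorem Lc.bracket_of_fst {X Y : Lc S} (hX : X.1 = 0) (hY : Y.1 = 0) : X.bracket Y = 0 :=
  Prod.ext (Lc.bracket_fst_of_left hX Y) (Subtype.ext (funext fun φ =>
    (Lc.coeff₁_bracket_eq X Y φ).trans (by
      rw [Lc.coeff₀_of_fst hX, Lc.coeff₀_of_fst hY, planeBracket_zero_left,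
        planeBracket_zero_right, add_zero]; rfl)))

theorem Lc.bracket_snd {X Y : Lc S} (hX : X.2 = 0) (hY : Y.2 = 0) : (X.bracket Y).2 = 0 :=
  Subtype.ext (funext fun φ => (Lc.coeff₁_bracket_eq X Y φ).trans (by
      rw [Lc.coeff₁_of_snd hX, Lc.coeff₁_of_snd hY, planeBracket_zero_left,
        planeBracket_zero_right, add_zero]; rfl))

theorem ProjConn.omega_of_density (D : ProjConn S) {X Y : Lc S} (h : D.density X Y = 0) :
    D.omega X Y = 0 := by
  rw [omega_eq, ← map_zero (integralLinear S)]
  exact congrArg _ (Subtype.ext h)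

theorem ProjConn.omega_of_fst (D : ProjConn S) {X Y : Lc S} (hX : X.1 = 0) (hY : Y.1 = 0) :
    D.omega X Y = 0 := by
  refine D.omega_of_density (funext fun φ => funext fun z => ?_)
  simp [density, Lc.bracket_of_fst hX hY, Lc.coeff₀_of_fst hX, Lc.coeff₀_of_fst hY, dz_zero,
    Lc.coeff₁_zero, show dz (0 : ℂ → ℂ) = 0 from funext dz_zero]

theorem ProjConn.omega_of_snd (D : ProjConn S) {X Y : Lc S} (hX : X.2 = 0) (hY : Y.2 = 0) :
    D.omega X Y = 0 := by
  refine D.omega_of_density (funext fun φ => funext fun z => ?_)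
  simp [density, Lc.coeff₁_of_snd (Lc.bracket_snd hX hY), Lc.coeff₁_of_snd hX,
    Lc.coeff₁_of_snd hY, dz_zero, show dz (0 : ℂ → ℂ) = 0 from funext dz_zero]

theorem ProjConn.omega_degree (D : ProjConn S) {i j : ℤ} {X Y : Lc S} (hX : X ∈ Lc.deg S i)
    (hY : Y ∈ Lc.deg S j) (hij : i + j ≠ 1) : D.omega X Y = 0 := by
  by_cases hi : i = 1
  · have h1 : X.1 = 0 := (Lc.eq_zero_or_fst hX).resolve_left (by omega)
    have h2 : Y.1 = 0 := (Lc.eq_zero_or_fst hY).resolve_left (by omega)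
    exact D.omega_of_fst h1 h2
  · by_cases hj : j = 1
    · have h1 : X.1 = 0 := (Lc.eq_zero_or_fst hX).resolve_left (by omega)
      have h2 : Y.1 = 0 := (Lc.eq_zero_or_fst hY).resolve_left (by omega)
      exact D.omega_of_fst h1 h2
    · exact D.omega_of_snd (Lc.snd_eq_zero hi hX) (Lc.snd_eq_zero hj hY)

/-- Each exponent is a product of two of the three degrees, so if two degrees vanish all the signs
are `1`. -/
theorem signed_jacobi {M : Type*} [AddCommGroup M] [Module ℂ M] {i j k : ℤ} {a b c : M}
    (h : a + b + c = 0)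
    (hd : ((i = 0 ∧ j = 0) ∨ (i = 0 ∧ k = 0) ∨ (j = 0 ∧ k = 0)) ∨ (a = 0 ∧ b = 0 ∧ c = 0)) :
    (-1 : ℂ) ^ (i * k) • a + (-1 : ℂ) ^ (j * i) • b + (-1 : ℂ) ^ (k * j) • c = 0 := by
  rcases hd with (⟨rfl, rfl⟩ | ⟨rfl, rfl⟩ | ⟨rfl, rfl⟩) | ⟨rfl, rfl, rfl⟩ <;> simp [h]

theorem Lc.two_of_three {i j k : ℤ} {X Y Z : Lc S} (hX : X ∈ Lc.deg S i) (hY : Y ∈ Lc.deg S j)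
    (hZ : Z ∈ Lc.deg S k) : ((i = 0 ∧ j = 0) ∨ (i = 0 ∧ k = 0) ∨ (j = 0 ∧ k = 0)) ∨
      ((X.1 = 0 ∧ Y.1 = 0) ∨ (X.1 = 0 ∧ Z.1 = 0) ∨ (Y.1 = 0 ∧ Z.1 = 0)) := by
  have := Lc.eq_zero_or_fst hX
  have := Lc.eq_zero_or_fst hY
  have := Lc.eq_zero_or_fst hZ
  tauto

theorem Lc.bracket_bracket_of_two {X Y Z : Lc S}
    (h : (X.1 = 0 ∧ Y.1 = 0) ∨ (X.1 = 0 ∧ Z.1 = 0) ∨ (Y.1 = 0 ∧ Z.1 = 0)) :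
    (X.bracket Y).bracket Z = 0 := by
  rcases h with h | h | h
  · rw [Lc.bracket_of_fst h.1 h.2, (Lc.isLinearMap_bracket_left Z).map_zero]
  · exact Lc.bracket_of_fst (Lc.bracket_fst_of_left h.1 Y) h.2
  · exact Lc.bracket_of_fst (Lc.bracket_fst_of_right X h.1) h.2

theorem ProjConn.omega_bracket_of_two (D : ProjConn S) {X Y Z : Lc S}
    (h : (X.1 = 0 ∧ Y.1 = 0) ∨ (X.1 = 0 ∧ Z.1 = 0) ∨ (Y.1 = 0 ∧ Z.1 = 0)) :
    D.omega (X.bracket Y) Z = 0 := by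
  rcases h with h | h | h
  · rw [Lc.bracket_of_fst h.1 h.2, (D.isLinearMap_omega_left Z).map_zero]
  · exact D.omega_of_fst (Lc.bracket_fst_of_left h.1 Y) h.2
  · exact D.omega_of_fst (Lc.bracket_fst_of_right X h.1) h.2

theorem ProjConn.omega_signed_jacobi (D : ProjConn S) {i j k : ℤ} {X Y Z : Lc S}
    (hX : X ∈ Lc.deg S i) (hY : Y ∈ Lc.deg S j) (hZ : Z ∈ Lc.deg S k) :
    (-1 : ℂ) ^ (i * k) * D.omega (X.bracket Y) Z + (-1 : ℂ) ^ (j * i) * D.omega (Y.bracket Z) X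
      + (-1 : ℂ) ^ (k * j) * D.omega (Z.bracket X) Y = 0 :=
  signed_jacobi (D.omega_jacobi X Y Z) ((Lc.two_of_three hX hY hZ).imp_right fun h =>
    ⟨D.omega_bracket_of_two h, D.omega_bracket_of_two (by tauto),
      D.omega_bracket_of_two (by tauto)⟩)

theorem Lc.signed_jacobi {i j k : ℤ} {X Y Z : Lc S}
    (hX : X ∈ Lc.deg S i) (hY : Y ∈ Lc.deg S j) (hZ : Z ∈ Lc.deg S k) :
    (-1 : ℂ) ^ (i * k) • (X.bracket Y).bracket Z + (-1 : ℂ) ^ (j * i) • (Y.bracket Z).bracket X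
      + (-1 : ℂ) ^ (k * j) • (Z.bracket X).bracket Y = 0 :=
  RiemannSurface.signed_jacobi (Lc.jacobi X Y Z) ((Lc.two_of_three hX hY hZ).imp_right fun h =>
    ⟨Lc.bracket_bracket_of_two h, Lc.bracket_bracket_of_two (by tauto),
      Lc.bracket_bracket_of_two (by tauto)⟩)

theorem ProjConn.omega_signed_swap (D : ProjConn S) {i j : ℤ} {X Y : Lc S} (hX : X ∈ Lc.deg S i)
    (hY : Y ∈ Lc.deg S j) : D.omega X Y = -(-1 : ℂ) ^ (i * j) * D.omega Y X := by
  rcases Lc.eq_zero_or_fst hX with rfl | hX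
  · simpa using D.omega_swap X Y
  · rcases Lc.eq_zero_or_fst hY with rfl | hY
    · simpa using D.omega_swap X Y
    · rw [D.omega_of_fst hX hY, D.omega_of_fst hY hX, mul_zero]

theorem Lc.signed_swap {i j : ℤ} {X Y : Lc S} (hX : X ∈ Lc.deg S i)
    (hY : Y ∈ Lc.deg S j) : X.bracket Y = -(-1 : ℂ) ^ (i * j) • Y.bracket X := by
  rcases Lc.eq_zero_or_fst hX with rfl | hX
  · rw [zero_mul, zpow_zero]
    exact (Lc.bracket_swap X Y).trans (neg_one_smul ℂ (Y.bracket X)).symm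
  · rcases Lc.eq_zero_or_fst hY with rfl | hY
    · rw [mul_zero, zpow_zero]
      exact (Lc.bracket_swap X Y).trans (neg_one_smul ℂ (Y.bracket X)).symm
    · rw [Lc.bracket_of_fst hX hY, Lc.bracket_of_fst hY hX, smul_zero]

theorem ProjConn.omega_signed_closed (D : ProjConn S) {i : ℤ} {X : Lc S} (hX : X ∈ Lc.deg S i)
    (Y : Lc S) : D.omega X.dbar Y + (-1 : ℂ) ^ i * D.omega X Y.dbar = 0 := by
  rcases Lc.eq_zero_or_fst hX with rfl | hX
  · simpa using D.omega_closed X Y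
  · have h := D.omega_closed X Y
    -- Neither `X` nor `∂̄Y` has a function component, so the signed term vanishes and its sign is
    -- irrelevant.
    rw [D.omega_of_fst (Y := Y.dbar) hX rfl, add_zero] at h
    rw [D.omega_of_fst (Y := Y.dbar) hX rfl, h, mul_zero, add_zero]

theorem Lc.signed_leibniz {i : ℤ} {X : Lc S} (hX : X ∈ Lc.deg S i)
    (Y : Lc S) : (X.bracket Y).dbar = X.dbar.bracket Y + (-1 : ℂ) ^ i • X.bracket Y.dbar := by
  rw [Lc.dbar_bracket]
  rcases Lc.eq_zero_or_fst hX with rfl | hX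
  · simp
  · rw [Lc.bracket_of_fst (Y := Y.dbar) hX rfl, smul_zero]

/-! ## The cocycles -/

theorem ProjConn.isCocycle_omega (D : ProjConn S) :
    IsCocycle (Lc.deg S) Lc.dbar Lc.bracket ⊤ D.omega where
  left Y _ := ⟨fun X X' => (D.isLinearMap_omega_left Y).map_add X X',
    fun a X => (D.isLinearMap_omega_left Y).map_smul a X⟩
  right X _ := ⟨fun Y Y' => (D.isLinearMap_omega_right X).map_add Y Y',
    fun a Y => (D.isLinearMap_omega_right X).map_smul a Y⟩
  degree _ _ _ hX _ hY := D.omega_degree hX.1 hY.1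
  skew _ _ _ hX _ hY := D.omega_signed_swap hX.1 hY.1
  closed _ _ hX Y _ := D.omega_signed_closed hX.1 Y
  jacobi _ _ _ _ hX _ hY _ hZ := D.omega_signed_jacobi hX.1 hY.1 hZ.1

/-- On elements supported in the coordinate domain, a class stable under `∂̄` and the bracket, the
local form is the restriction of the global one and inherits its identities. -/
theorem ProjConn.isCocycle_omegaLocal (D : ProjConn S) (φ : S.Coord) :
    IsCocycle (Lc.deg S) Lc.dbar Lc.bracket (Lc.on φ.source) (D.omegaLocal φ) where
  left Y hY := by
    have h : (fun X : Lc.on φ.source => D.omegaLocal φ X Y)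
        = fun X : Lc.on φ.source => D.omega X Y :=
      funext fun X => (D.omega_eq_omegaLocal X.2 hY).symm
    rw [h]
    exact ⟨fun X X' => (D.isLinearMap_omega_left Y).map_add X X',
      fun a X => (D.isLinearMap_omega_left Y).map_smul a X⟩
  right X hX := by
    have h : (fun Y : Lc.on φ.source => D.omegaLocal φ X Y)
        = fun Y : Lc.on φ.source => D.omega X Y :=
      funext fun Y => (D.omega_eq_omegaLocal hX Y.2).symm
    rw [h]
    exact ⟨fun Y Y' => (D.isLinearMap_omega_right X).map_add Y Y',
      fun a Y => (D.isLinearMap_omega_right X).map_smul a Y⟩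
  degree _ _ _ hX _ hY hij := by
    rw [← D.omega_eq_omegaLocal hX.2 hY.2]
    exact D.omega_degree hX.1 hY.1 hij
  skew _ _ _ hX _ hY := by
    rw [← D.omega_eq_omegaLocal hX.2 hY.2, ← D.omega_eq_omegaLocal hY.2 hX.2]
    exact D.omega_signed_swap hX.1 hY.1
  closed _ _ hX Y hY := by
    rw [← D.omega_eq_omegaLocal (Lc.dbar_mem_on hX.2) hY,
      ← D.omega_eq_omegaLocal hX.2 (Lc.dbar_mem_on hY)]
    exact D.omega_signed_closed hX.1 Y
  jacobi _ _ _ X hX Y hY Z hZ := by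
    rw [← D.omega_eq_omegaLocal (Lc.bracket_mem_on hX.2 Y) hZ.2,
      ← D.omega_eq_omegaLocal (Lc.bracket_mem_on hY.2 Z) hX.2,
      ← D.omega_eq_omegaLocal (Lc.bracket_mem_on hZ.2 X) hY.2]
    exact D.omega_signed_jacobi hX.1 hY.1 hZ.1

/-- Both sides are values of the global form; the change of variables was carried out for the
invariant density, not for the one-sided integrands. -/
theorem ProjConn.omegaLocal_eq_omegaLocal (D : ProjConn S) (φ ψ : S.Coord) {X Y : Lc S}
    (hX : X ∈ Lc.on (φ.source ∩ ψ.source)) (hY : Y ∈ Lc.on (φ.source ∩ ψ.source)) :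
    D.omegaLocal φ X Y = D.omegaLocal ψ X Y := by
  rw [← D.omega_eq_omegaLocal (Lc.on_mono Set.inter_subset_left hX)
      (Lc.on_mono Set.inter_subset_left hY),
    D.omega_eq_omegaLocal (Lc.on_mono Set.inter_subset_right hX)
      (Lc.on_mono Set.inter_subset_right hY)]

/-! ## Change of the projective connection -/

theorem ProjConn.diff_eq (D D' : ProjConn S) (X : Lc S) : D.diff D' X
    = -(1 / (2 * Real.pi) * (1 / 12)) * integralLinear S ⟨_, D.diff_mem D' X⟩ := rfl

theorem ProjConn.isLinearMap_diff (D D' : ProjConn S) : IsLinearMap ℂ (D.diff D') := by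
  constructor
  · intro X Y
    simp only [diff_eq]
    rw [← mul_add, ← map_add]
    refine congrArg _ (congrArg _ (Subtype.ext (funext fun φ => funext fun z => ?_)))
    exact mul_add _ _ _
  · intro a X
    simp only [diff_eq]
    rw [smul_eq_mul, mul_left_comm, ← smul_eq_mul a, ← map_smul]
    refine congrArg _ (congrArg _ (Subtype.ext (funext fun φ => funext fun z => ?_)))
    exact mul_left_comm _ _ _

theorem ProjConn.diff_of_snd (D D' : ProjConn S) {X : Lc S} (h : X.2 = 0) : D.diff D' X = 0 := by
  rw [diff_eq]
  have : (⟨_, D.diff_mem D' X⟩ : S.Sections 1 1) = 0 :=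
    Subtype.ext (funext fun φ => funext fun z => by simp [Lc.coeff₁_of_snd h])
  rw [this, map_zero, mul_zero]

theorem ProjConn.diff_eq_setIntegral (D D' : ProjConn S) {φ : S.Coord} {X : Lc S}
    (hX : X ∈ Lc.on φ.source) : D.diff D' X
      = -(1 / (2 * Real.pi) * (1 / 12)) * ∫ z in φ.target, (D.ρ φ z - D'.ρ φ z) * X.coeff₁ φ z := by
  obtain ⟨K, hKφ, hK, h⟩ := hX.2
  rw [diff, integral_eq_setIntegral (D.diff_mem D' X).1
    ⟨K, hKφ, hK, fun φ z hz hn => by simp [h φ z hz hn]⟩]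

/-- After localizing `X` to one coordinate, Stokes applies because `ρ - ρ'` is holomorphic there. -/
theorem ProjConn.diff_dbar (D D' : ProjConn S) (X : Lc S) : D.diff D' X.dbar = 0 := by
  have l := D.isLinearMap_diff D'
  refine Lc.induction (P := fun X => D.diff D' X.dbar = 0) ?_ ?_ ?_ X
  · rw [Lc.isLinearMap_dbar.map_zero, l.map_zero]
  · intro X Y h h'
    rw [Lc.isLinearMap_dbar.map_add, l.map_add, h, h', add_zero]
  · intro φ X hX
    rw [D.diff_eq_setIntegral D' (Lc.dbar_mem_on hX)]
    have h := setIntegral_holo_mul_dbar X.isTensor₀ hX.1 ((D.holo φ).sub (D'.holo φ))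
    simp only [Pi.sub_apply] at h
    exact mul_eq_zero_of_right _ h

/-- The identity holds for the densities: the third-derivative terms do not involve the connection
and cancel pointwise. -/
theorem ProjConn.omega_sub_omega (D D' : ProjConn S) (X Y : Lc S) :
    D.omega X Y - D'.omega X Y = D.diff D' (X.bracket Y) := by
  rw [omega_eq, omega_eq, diff_eq, ← map_sub, ← smul_eq_mul, ← map_smul]
  refine congrArg _ (Subtype.ext (funext fun φ => funext fun z => ?_))
  change D.density X Y φ z - D'.density X Y φ z = -(1 / (2 * Real.pi) * (1 / 12))
    * ((D.ρ φ z - D'.ρ φ z) * (X.bracket Y).coeff₁ φ z)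
  simp only [density]
  ring

theorem ProjConn.isCoboundaryOf_diff (D D' : ProjConn S) :
    IsCoboundaryOf (Lc.deg S) Lc.dbar Lc.bracket ⊤ (D.diff D')
      (fun X Y => D.omega X Y - D'.omega X Y) where
  linear := ⟨fun X Y => (D.isLinearMap_diff D').map_add X Y,
    fun a X => (D.isLinearMap_diff D').map_smul a X⟩
  degree _ hi _ hX := D.diff_of_snd D' (Lc.snd_eq_zero hi hX.1)
  closed X _ := D.diff_dbar D' X
  eq X _ Y _ := D.omega_sub_omega D' X Y

theorem ProjConn.pairLocal_sub_pairLocal (D D' : ProjConn S) {φ : S.Coord} {X : Lc S}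
    (hX : X ∈ Lc.on φ.source) : D.pairLocal φ X - D'.pairLocal φ X = D.diff D' X := by
  rw [D.diff_eq_setIntegral D' hX, pairLocal, pairLocal, ← mul_sub, ← integral_sub
    (D.isTest_mul_coeff₁ hX).integrable.integrableOn
    (D'.isTest_mul_coeff₁ hX).integrable.integrableOn]
  simp only [sub_mul]

theorem ProjConn.isCoboundaryOf_pairLocal (D D' : ProjConn S) (φ : S.Coord) :
    IsCoboundaryOf (Lc.deg S) Lc.dbar Lc.bracket (Lc.on φ.source)
      (fun X => D.pairLocal φ X - D'.pairLocal φ X)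
      (fun X Y => D.omegaLocal φ X Y - D'.omegaLocal φ X Y) where
  linear := by
    have h : (fun X : Lc.on φ.source => D.pairLocal φ X - D'.pairLocal φ X)
        = fun X : Lc.on φ.source => D.diff D' X :=
      funext fun X => D.pairLocal_sub_pairLocal D' X.2
    rw [h]
    exact ⟨fun X Y => (D.isLinearMap_diff D').map_add X Y,
      fun a X => (D.isLinearMap_diff D').map_smul a X⟩
  degree _ hi _ hX := by
    rw [D.pairLocal_sub_pairLocal D' hX.2]
    exact D.diff_of_snd D' (Lc.snd_eq_zero hi hX.1)
  closed X hX := by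
    rw [D.pairLocal_sub_pairLocal D' (Lc.dbar_mem_on hX)]
    exact D.diff_dbar D' X
  eq X hX Y hY := by
    rw [D.pairLocal_sub_pairLocal D' (Lc.bracket_mem_on hX Y), ← D.omega_eq_omegaLocal hX hY,
      ← D'.omega_eq_omegaLocal hX hY]
    exact D.omega_sub_omega D' X Y

/-! ## The central extensions are dg Lie algebras -/

theorem Ext.mem_deg_iff {i : ℤ} {x : Ext S} :
    x ∈ Ext.deg S i ↔ x.1 ∈ Lc.deg S i ∧ (i ≠ 1 → x.2 = 0) := by
  unfold Ext.deg
  rw [Submodule.mem_prod]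
  split_ifs with h <;> simp [h]

theorem Ext.isInternal_deg (S : RiemannSurface.{u}) : DirectSum.IsInternal (Ext.deg S) := by
  rw [DirectSum.isInternal_submodule_iff_iSupIndep_and_iSup_eq_top]
  constructor
  · intro i
    rw [Submodule.disjoint_def]
    intro x hx hx'
    -- An element of the span of the other degrees lies in any submodule containing them all. For `i
    -- = 1` take the elements with neither `dz̄` nor central component, for `i = 0` those without
    -- function component.
    have key : ∀ E : Submodule ℂ (Ext S), (∀ j, j ≠ i → Ext.deg S j ≤ E) → x ∈ E := fun E h =>
      (iSup₂_le h : ⨆ j, ⨆ (_ : j ≠ i), Ext.deg S j ≤ E) hx'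
    have hx2 := (Ext.mem_deg_iff.1 hx).2
    by_cases hi : i = 1
    · have h' := key (((⊤ : Submodule ℂ (S.Sections (-1) 0)).prod ⊥).prod ⊥) fun j hj y hy =>
        ⟨⟨trivial, Lc.snd_eq_zero (hi ▸ hj) hy.1⟩, (Ext.mem_deg_iff.1 hy).2 (hi ▸ hj)⟩
      exact Prod.ext (Prod.ext ((Lc.eq_zero_or_fst hx.1).resolve_left (by omega)) h'.1.2) h'.2
    · refine Prod.ext (Prod.ext ?_ (Lc.snd_eq_zero hi hx.1)) (hx2 hi)
      rcases Lc.eq_zero_or_fst hx.1 with rfl | h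
      · exact (key ((⊥ : Submodule ℂ (S.Sections (-1) 0)).prod ⊤ |>.prod ⊤) fun j hj y hy =>
          ⟨⟨(Lc.eq_zero_or_fst hy.1).resolve_left hj, trivial⟩, trivial⟩).1.1
      · exact h
  · refine eq_top_iff.2 fun x _ => ?_
    have h : x = ((x.1.1, 0), 0) + ((0, x.1.2), x.2) := by simp
    rw [h]
    refine add_mem (Submodule.mem_iSup_of_mem 0 ?_) (Submodule.mem_iSup_of_mem 1 ?_)
    · exact Ext.mem_deg_iff.2 ⟨Lc.mem_deg_zero.2 rfl, fun _ => rfl⟩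
    · exact Ext.mem_deg_iff.2 ⟨Lc.mem_deg_one.2 rfl, fun h => absurd rfl h⟩

/-- In each axiom the first component is the rule for `L_c(S)` and the central component is the
corresponding identity of the cocycle `ω_∇`; the grading matches since `ω_∇` is nonzero only in
total degree `1`. -/
theorem Ext.isDGLie (D : ProjConn S) : IsDGLie (Ext.deg S) Ext.d (Ext.bracket D) where
  internal := Ext.isInternal_deg S
  d_linear := ⟨fun x y => Prod.ext (Lc.isLinearMap_dbar.map_add x.1 y.1) (add_zero _).symm,
    fun a x => Prod.ext (Lc.isLinearMap_dbar.map_smul a x.1) (smul_zero _).symm⟩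
  br_left y := ⟨fun x x' => Prod.ext ((Lc.isLinearMap_bracket_left y.1).map_add x.1 x'.1)
      ((D.isLinearMap_omega_left y.1).map_add x.1 x'.1),
    fun a x => Prod.ext ((Lc.isLinearMap_bracket_left y.1).map_smul a x.1)
      ((D.isLinearMap_omega_left y.1).map_smul a x.1)⟩
  br_right x := ⟨fun y y' => Prod.ext ((Lc.isLinearMap_bracket_right x.1).map_add y.1 y'.1)
      ((D.isLinearMap_omega_right x.1).map_add y.1 y'.1),
    fun a y => Prod.ext ((Lc.isLinearMap_bracket_right x.1).map_smul a y.1)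
      ((D.isLinearMap_omega_right x.1).map_smul a y.1)⟩
  d_deg i x hx := by
    refine Ext.mem_deg_iff.2 ⟨?_, fun _ => rfl⟩
    rcases Lc.eq_zero_or_fst hx.1 with rfl | h
    · exact Lc.mem_deg_one.2 rfl
    · have : x.1.dbar = 0 := Lc.ext_coeff (fun _ _ _ => rfl) fun φ z hz => by
        rw [Lc.coeff₁_dbar, Lc.coeff₀_of_fst h, Set.indicator_of_mem hz, dzbar_zero]; rfl
      change x.1.dbar ∈ _
      rw [this]
      exact zero_mem _
  br_deg i j x hx y hy := by
    refine Ext.mem_deg_iff.2 ⟨?_, fun hij => D.omega_degree hx.1 hy.1 hij⟩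
    change x.1.bracket y.1 ∈ _
    rcases Lc.mem_deg hx.1 with ⟨rfl, h⟩ | ⟨rfl, h⟩ | h
    · rcases Lc.mem_deg hy.1 with ⟨rfl, k⟩ | ⟨rfl, k⟩ | k
      · exact Lc.mem_deg_zero.2 (Lc.bracket_snd h k)
      · exact Lc.mem_deg_one.2 (Lc.bracket_fst_of_right _ k)
      · rw [k, (Lc.isLinearMap_bracket_right _).map_zero]
        exact zero_mem _
    · rcases Lc.eq_zero_or_fst hy.1 with rfl | k
      · exact Lc.mem_deg_one.2 (Lc.bracket_fst_of_left h _)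
      · rw [Lc.bracket_of_fst h k]
        exact zero_mem _
    · rw [h, (Lc.isLinearMap_bracket_left y.1).map_zero]
      exact zero_mem _
  d_d x := Prod.ext (Lc.dbar_dbar x.1) rfl
  skew i j x hx y hy := Prod.ext (Lc.signed_swap hx.1 hy.1) (D.omega_signed_swap hx.1 hy.1)
  leibniz i x hx y := Prod.ext (Lc.signed_leibniz hx.1 y.1) (D.omega_signed_closed hx.1 y.1).symm
  jacobi i j k x hx y hy z hz :=
    Prod.ext (Lc.signed_jacobi hx.1 hy.1 hz.1) (D.omega_signed_jacobi hx.1 hy.1 hz.1)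

/-! ## Restriction of coordinates -/

/-- The coordinate `φ` is a restriction of the coordinate `ψ`. -/
def Coord.IsRestr (φ ψ : S.Coord) : Prop := ∀ z ∈ φ.target, z ∈ ψ.target ∧ φ.inv z = ψ.inv z

theorem Coord.IsRestr.mem_overlap {φ ψ : S.Coord} (h : φ.IsRestr ψ) {z : ℂ} (hz : z ∈ φ.target) :
    z ∈ overlap φ ψ :=
  ⟨hz, by
    rw [Set.mem_preimage, (h z hz).2]
    exact ψ.map_target (h z hz).1⟩

theorem Coord.IsRestr.trans_eventuallyEq {φ ψ : S.Coord} (h : φ.IsRestr ψ) {z : ℂ}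
    (hz : z ∈ φ.target) : trans φ ψ =ᶠ[𝓝 z] id := by
  filter_upwards [φ.open_target.mem_nhds hz] with w hw
  rw [trans, (h w hw).2]
  exact ψ.right_inv (h w hw).1

/-- Pushing a pulled-back coordinate forward returns it only on a smaller domain. The transition map
to the original coordinate is then locally the identity, and the transformation law becomes equality
of coefficients. -/
theorem IsTensor.eq_of_isRestr {p q : ℤ} {c : S.Coord → ℂ → ℂ} (hc : IsTensor S p q c)
    {φ ψ : S.Coord} (h : φ.IsRestr ψ) {z : ℂ} (hz : z ∈ φ.target) : c φ z = c ψ z := by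
  have e := h.trans_eventuallyEq hz
  rw [hc.law φ ψ z (h.mem_overlap hz), e.deriv_eq, e.eq_of_nhds]
  simp

theorem schwarzian_of_eventuallyEq_id {τ : ℂ → ℂ} {z : ℂ} (h : τ =ᶠ[𝓝 z] id) :
    schwarzian τ z = 0 := by
  have h1 : deriv τ =ᶠ[𝓝 z] fun _ => 1 := by
    filter_upwards [h.eventually_nhds] with w hw
    have hw : τ =ᶠ[𝓝 w] id := hw
    rw [hw.deriv_eq, deriv_id]
  have h2 : deriv (deriv τ) =ᶠ[𝓝 z] fun _ => 0 := by
    filter_upwards [h1.eventually_nhds] with w hw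
    have hw : deriv τ =ᶠ[𝓝 w] fun _ => 1 := hw
    rw [hw.deriv_eq, deriv_const]
  have h3 : (fun w => deriv (deriv τ) w / deriv τ w) =ᶠ[𝓝 z] fun _ => 0 := by
    filter_upwards [h2] with w hw
    rw [hw, zero_div]
  rw [schwarzian, h3.deriv_eq, h3.eq_of_nhds, deriv_const]
  simp

theorem ProjConn.eq_of_isRestr (D : ProjConn S) {φ ψ : S.Coord} (h : φ.IsRestr ψ) {z : ℂ}
    (hz : z ∈ φ.target) : D.ρ φ z = D.ρ ψ z := by
  have e := h.trans_eventuallyEq hz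
  rw [D.law φ ψ z (h.mem_overlap hz), e.deriv_eq, e.eq_of_nhds, schwarzian_of_eventuallyEq_id e]
  simp

/-! ## Extension by zero along a holomorphic embedding -/

/-- The inverse of a coordinate is a total function on `ℂ`, so it provides a point of `S`. On the
empty surface all sections are therefore equal, which settles the default branch of extension by
zero. -/
theorem isEmpty_coord [IsEmpty S] : IsEmpty S.Coord := ⟨fun φ => isEmptyElim (φ.inv 0)⟩

theorem subsingleton_sections [IsEmpty S] (p q : ℤ) : Subsingleton (S.Sections p q) :=
  ⟨fun _ _ => Subtype.ext (funext fun φ => (isEmpty_coord (S := S)).elim φ)⟩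

namespace IsHolEmbedding

variable {R : RiemannSurface.{u}} {f : S → T} {g : T → R}

theorem isRestr_pushCoord_pullCoord [Nonempty S] (hf : IsHolEmbedding f) (ψ : T.Coord) :
    (hf.pushCoord (hf.pullCoord ψ)).IsRestr ψ := fun z hz => by
  rw [hf.pushCoord_target, hf.mem_pullCoord_target] at hz
  exact ⟨hz.1, hf.apply_pullCoord_inv ψ hz.2⟩

theorem isRestr_pullCoord_pushCoord [Nonempty S] (hf : IsHolEmbedding f) (φ : S.Coord) :
    φ.IsRestr (hf.pullCoord (hf.pushCoord φ)) := fun z hz => by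
  have hr : (hf.pushCoord φ).inv z ∈ Set.range f := ⟨_, rfl⟩
  refine ⟨(hf.mem_pullCoord_target _ z).2 ⟨(hf.pushCoord_target φ).symm ▸ hz, hr⟩, ?_⟩
  exact hf.isOpenEmbedding.injective (hf.apply_pullCoord_inv _ hr).symm

theorem isRestr_pullCoord_id [Nonempty S] (ψ : S.Coord) :
    ((IsHolEmbedding.id S).pullCoord ψ).IsRestr ψ := fun z hz => by
  rw [mem_pullCoord_target] at hz
  exact ⟨hz.1, (IsHolEmbedding.id S).apply_pullCoord_inv ψ hz.2⟩

theorem pushSection_apply [Nonempty S] (hf : IsHolEmbedding f) {p q : ℤ} (c : S.Sections p q)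
    (ψ : T.Coord) : (hf.pushSection c).1 ψ = c.1 (hf.pullCoord ψ) := by
  rw [pushSection, dif_pos ‹Nonempty S›]

theorem pushSection_of_isEmpty [IsEmpty S] (hf : IsHolEmbedding f) {p q : ℤ} (c : S.Sections p q) :
    hf.pushSection c = 0 := by
  rw [pushSection, dif_neg (not_nonempty_iff.2 ‹_›)]

theorem isLinearMap_pushSection (hf : IsHolEmbedding f) (p q : ℤ) :
    IsLinearMap ℂ (hf.pushSection : S.Sections p q → T.Sections p q) := by
  rcases isEmpty_or_nonempty S with h | h
  · constructor <;> intros <;> simp [pushSection_of_isEmpty]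
  · constructor <;> intros <;> refine Subtype.ext (funext fun ψ => ?_) <;>
      simp [pushSection_apply]

theorem pushSection_of_notMem_range (hf : IsHolEmbedding f) {p q : ℤ} (c : S.Sections p q)
    {ψ : T.Coord} {z : ℂ} (hz : ψ.inv z ∉ Set.range f) : (hf.pushSection c).1 ψ z = 0 := by
  rcases isEmpty_or_nonempty S with h | h
  · rw [pushSection_of_isEmpty]; rfl
  · rw [pushSection_apply]
    exact c.2.1.zero _ z fun h' => hz ((hf.mem_pullCoord_target ψ z).1 h').2

theorem vanishesOff_pushSection (hf : IsHolEmbedding f) {p q : ℤ} (c : S.Sections p q) {K : Set S}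
    (hK : VanishesOff K c.1) : VanishesOff (f '' K) (hf.pushSection c).1 := fun ψ z hz hn => by
  rcases isEmpty_or_nonempty S with h | h
  · rw [pushSection_of_isEmpty]; rfl
  · rw [pushSection_apply]
    by_cases h : z ∈ (hf.pullCoord ψ).target
    · exact hK _ z h fun hk => hn ⟨_, hk,
        hf.apply_pullCoord_inv ψ ((hf.mem_pullCoord_target ψ z).1 h).2⟩
    · exact c.2.1.zero _ z h

/-- A point outside the range may lie in its closure; vanishing near it comes from the image of the
compact support being closed. -/
theorem pushSection_eventuallyEq_zero (hf : IsHolEmbedding f) {p q : ℤ} (c : S.Sections p q)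
    {ψ : T.Coord} {z : ℂ} (hz : z ∈ ψ.target) (hr : ψ.inv z ∉ Set.range f) :
    (hf.pushSection c).1 ψ =ᶠ[𝓝 z] 0 := by
  obtain ⟨-, K, -, hK, h⟩ := c.2
  exact eventuallyEq_of_vanishesOff (hK.image hf.isOpenEmbedding.continuous)
    (hf.vanishesOff_pushSection c h) ψ hz fun ⟨x, _, hx⟩ => hr ⟨x, hx⟩

theorem pushSection_pushCoord (hf : IsHolEmbedding f) {p q : ℤ} (c : S.Sections p q)
    (φ : S.Coord) {z : ℂ} (hz : z ∈ φ.target) : (hf.pushSection c).1 (hf.pushCoord φ) z = c.1 φ z := by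
  have : Nonempty S := ⟨φ.inv 0⟩
  rw [pushSection_apply, c.2.1.eq_of_isRestr (hf.isRestr_pullCoord_pushCoord φ) hz]

theorem pushSection_id {p q : ℤ} (c : S.Sections p q) :
    (IsHolEmbedding.id S).pushSection c = c := by
  refine Subtype.ext (funext fun ψ => funext fun z => ?_)
  have : Nonempty S := ⟨ψ.inv 0⟩
  rw [pushSection_apply]
  by_cases hz : z ∈ ψ.target
  · exact c.2.1.eq_of_isRestr (isRestr_pullCoord_id ψ)
      ((mem_pullCoord_target _ ψ z).2 ⟨hz, _, rfl⟩)
  · rw [c.2.1.zero ψ z hz, c.2.1.zero _ z fun h => hz ((mem_pullCoord_target _ ψ z).1 h).1]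

theorem isRestr_pullCoord_comp [Nonempty S] [Nonempty T] (hg : IsHolEmbedding g)
    (hf : IsHolEmbedding f) (ψ : R.Coord) :
    ((hg.comp hf).pullCoord ψ).IsRestr (hf.pullCoord (hg.pullCoord ψ)) := fun z hz => by
  obtain ⟨hψ, hr⟩ := ((hg.comp hf).mem_pullCoord_target ψ z).1 hz
  have hr' := hr
  obtain ⟨x, hx⟩ := hr
  have hrg : ψ.inv z ∈ Set.range g := ⟨f x, hx⟩
  have h1 := hg.apply_pullCoord_inv ψ hrg
  have h2 : f x = (hg.pullCoord ψ).inv z := hg.isOpenEmbedding.injective (hx.trans h1.symm)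
  refine ⟨(hf.mem_pullCoord_target _ z).2
    ⟨(hg.mem_pullCoord_target ψ z).2 ⟨hψ, hrg⟩, x, h2⟩, ?_⟩
  refine (hg.comp hf).isOpenEmbedding.injective (((hg.comp hf).apply_pullCoord_inv ψ hr').trans ?_)
  rw [Function.comp_apply, hf.apply_pullCoord_inv (hg.pullCoord ψ) ⟨x, h2⟩, h1]

theorem pushSection_comp (hg : IsHolEmbedding g) (hf : IsHolEmbedding f) {p q : ℤ}
    (c : S.Sections p q) :
    (hg.comp hf).pushSection c = hg.pushSection (hf.pushSection c) := by
  rcases isEmpty_or_nonempty S with h | h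
  · rw [pushSection_of_isEmpty, hf.pushSection_of_isEmpty,
      (hg.isLinearMap_pushSection p q).map_zero]
  · have : Nonempty T := ⟨f h.some⟩
    refine Subtype.ext (funext fun ψ => funext fun z => ?_)
    rw [pushSection_apply, pushSection_apply, pushSection_apply]
    by_cases hz : z ∈ ((hg.comp hf).pullCoord ψ).target
    · exact c.2.1.eq_of_isRestr (hg.isRestr_pullCoord_comp hf ψ) hz
    · rw [c.2.1.zero _ z hz, c.2.1.zero _ z fun h' => hz ?_]
      obtain ⟨h1, x, hx⟩ := (hf.mem_pullCoord_target _ z).1 h'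
      obtain ⟨h3, h4⟩ := (hg.mem_pullCoord_target _ z).1 h1
      exact ((hg.comp hf).mem_pullCoord_target ψ z).2 ⟨h3, x, by
        rw [Function.comp_apply, hx, hg.apply_pullCoord_inv ψ h4]⟩

/-- The partitions of unity chosen on `S` and `T` are unrelated, so the sums cannot be compared
termwise. By linearity the section may be supported in one coordinate `φ`, and then both sides are
the same plane integral, taken in `φ` and in its push-forward. -/
theorem integral_pushSection (hf : IsHolEmbedding f) (c : S.Sections 1 1) :
    integral (hf.pushSection c).1 = integral c.1 := by
  have l := hf.isLinearMap_pushSection 1 1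
  simp only [← integralLinear_apply]
  refine Sections.induction (P := fun c => integralLinear T (hf.pushSection c)
    = integralLinear S c) ?_ ?_ ?_ c
  · rw [l.map_zero, map_zero, map_zero]
  · intro c d hc hd
    rw [l.map_add, map_add, map_add, hc, hd]
  · intro φ c hc
    have hs : SupportedIn (hf.pushCoord φ).source (hf.pushSection c).1 := by
      obtain ⟨K, hKφ, hK, h⟩ := hc
      refine ⟨f '' K, ?_, hK.image hf.isOpenEmbedding.continuous, hf.vanishesOff_pushSection c h⟩
      rintro _ ⟨x, hx, rfl⟩
      have h1 : (hf.pushCoord φ).inv (φ.toOpenPartialHomeomorph x) = f x :=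
        congrArg f (φ.left_inv (hKφ hx))
      rw [← h1]
      exact (hf.pushCoord φ).map_target
        ((hf.pushCoord_target φ).symm ▸ φ.map_source (hKφ hx))
    rw [integralLinear_apply, integralLinear_apply, integral_eq_setIntegral (hf.pushSection c).2.1 hs,
      integral_eq_setIntegral c.2.1 hc, hf.pushCoord_target]
    exact MeasureTheory.setIntegral_congr_fun φ.open_target.measurableSet fun z hz =>
      hf.pushSection_pushCoord c φ hz

/-! ## Compatibility with the dg Lie structure and the cocycles -/

theorem isLinearMap_push (hf : IsHolEmbedding f) : IsLinearMap ℂ (hf.push : Lc S → Lc T) :=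
  ⟨fun X Y => Prod.ext ((hf.isLinearMap_pushSection _ _).map_add X.1 Y.1)
      ((hf.isLinearMap_pushSection _ _).map_add X.2 Y.2),
    fun a X => Prod.ext ((hf.isLinearMap_pushSection _ _).map_smul a X.1)
      ((hf.isLinearMap_pushSection _ _).map_smul a X.2)⟩

theorem push_id (X : Lc S) : (IsHolEmbedding.id S).push X = X :=
  Prod.ext (pushSection_id X.1) (pushSection_id X.2)

theorem push_comp (hg : IsHolEmbedding g) (hf : IsHolEmbedding f) (X : Lc S) :
    (hg.comp hf).push X = hg.push (hf.push X) :=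
  Prod.ext (hg.pushSection_comp hf X.1) (hg.pushSection_comp hf X.2)

theorem push_mem_deg (hf : IsHolEmbedding f) {i : ℤ} {X : Lc S} (hX : X ∈ Lc.deg S i) :
    hf.push X ∈ Lc.deg T i := by
  rcases Lc.mem_deg hX with ⟨rfl, h⟩ | ⟨rfl, h⟩ | h
  · refine Lc.mem_deg_zero.2 ?_
    change hf.pushSection X.2 = 0
    rw [h, (hf.isLinearMap_pushSection _ _).map_zero]
  · refine Lc.mem_deg_one.2 ?_
    change hf.pushSection X.1 = 0
    rw [h, (hf.isLinearMap_pushSection _ _).map_zero]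
  · rw [h, hf.isLinearMap_push.map_zero]
    exact zero_mem _

theorem push_of_isEmpty [IsEmpty S] (hf : IsHolEmbedding f) (X : Lc S) : hf.push X = 0 :=
  Prod.ext (hf.pushSection_of_isEmpty X.1) (hf.pushSection_of_isEmpty X.2)

theorem coeff₀_push [Nonempty S] (hf : IsHolEmbedding f) (X : Lc S) (ψ : T.Coord) :
    (hf.push X).coeff₀ ψ = X.coeff₀ (hf.pullCoord ψ) := hf.pushSection_apply X.1 ψ

theorem coeff₁_push [Nonempty S] (hf : IsHolEmbedding f) (X : Lc S) (ψ : T.Coord) :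
    (hf.push X).coeff₁ ψ = X.coeff₁ (hf.pullCoord ψ) := hf.pushSection_apply X.2 ψ

theorem push_dbar (hf : IsHolEmbedding f) (X : Lc S) : hf.push X.dbar = (hf.push X).dbar := by
  rcases isEmpty_or_nonempty S with h | h
  · rw [push_of_isEmpty, push_of_isEmpty, Lc.isLinearMap_dbar.map_zero]
  · refine Lc.ext_coeff (fun ψ z hz => ?_) (fun ψ z hz => ?_)
    · rw [coeff₀_push, Lc.coeff₀_dbar, Lc.coeff₀_dbar]
    · by_cases hr : ψ.inv z ∈ Set.range f
      · rw [coeff₁_push, Lc.coeff₁_dbar, Lc.coeff₁_dbar, Set.indicator_of_mem hz,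
          Set.indicator_of_mem ((hf.mem_pullCoord_target ψ z).2 ⟨hz, hr⟩), coeff₀_push]
      · refine (hf.pushSection_of_notMem_range X.dbar.2 hr).trans ?_
        have e : (hf.push X).coeff₀ ψ =ᶠ[𝓝 z] 0 := hf.pushSection_eventuallyEq_zero X.1 hz hr
        rw [Lc.coeff₁_dbar, Set.indicator_of_mem hz, dzbar_congr e, dzbar_zero]

theorem push_bracket (hf : IsHolEmbedding f) (X Y : Lc S) :
    hf.push (X.bracket Y) = (hf.push X).bracket (hf.push Y) := by
  rcases isEmpty_or_nonempty S with h | h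
  · rw [push_of_isEmpty, push_of_isEmpty, (Lc.isLinearMap_bracket_left _).map_zero]
  · refine Lc.ext_coeff (fun ψ z hz => ?_) (fun ψ z hz => ?_)
    · rw [coeff₀_push, Lc.coeff₀_bracket, Lc.coeff₀_bracket, coeff₀_push, coeff₀_push]
    · rw [coeff₁_push, Lc.coeff₁_bracket_eq, Lc.coeff₁_bracket_eq, coeff₀_push, coeff₀_push,
        coeff₁_push, coeff₁_push]

theorem pull_ρ_pullCoord [Nonempty S] (hf : IsHolEmbedding f) (D : ProjConn T) (ψ : T.Coord) {z : ℂ}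
    (hz : z ∈ (hf.pullCoord ψ).target) : (D.pull hf).ρ (hf.pullCoord ψ) z = D.ρ ψ z :=
  D.eq_of_isRestr (hf.isRestr_pushCoord_pullCoord ψ) (by rwa [hf.pushCoord_target])

theorem density_push (hf : IsHolEmbedding f) (D : ProjConn T) (X Y : Lc S) :
    D.density (hf.push X) (hf.push Y)
      = (hf.pushSection ⟨_, (D.pull hf).density_mem X Y⟩).1 := by
  rcases isEmpty_or_nonempty S with h | h
  · rw [pushSection_of_isEmpty, push_of_isEmpty]
    exact funext fun ψ => funext fun z => D.density_of_left _ .rfl .rfl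
  · funext ψ z
    rw [pushSection_apply]
    simp only [ProjConn.density]
    rw [← push_bracket]
    simp only [coeff₀_push, coeff₁_push]
    -- Off this set the two connection coefficients may differ, but the coefficient of the bracket
    -- that multiplies them is zero.
    by_cases hz : z ∈ (hf.pullCoord ψ).target
    · rw [hf.pull_ρ_pullCoord D ψ hz]
    · rw [(X.bracket Y).isTensor₁.zero _ z hz, mul_zero, mul_zero]

theorem omega_push (hf : IsHolEmbedding f) (D : ProjConn T) (X Y : Lc S) :
    D.omega (hf.push X) (hf.push Y) = (D.pull hf).omega X Y := by
  rw [ProjConn.omega, density_push, integral_pushSection, ProjConn.omega]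

theorem diff_push (hf : IsHolEmbedding f) (D D' : ProjConn T) (X : Lc S) :
    D.diff D' (hf.push X) = (D.pull hf).diff (D'.pull hf) X := by
  rcases isEmpty_or_nonempty S with h | h
  · have : X = 0 := Prod.ext ((subsingleton_sections _ _).elim _ _)
      ((subsingleton_sections _ _).elim _ _)
    rw [this, hf.isLinearMap_push.map_zero, (D.isLinearMap_diff D').map_zero,
      ((D.pull hf).isLinearMap_diff _).map_zero]
  · rw [ProjConn.diff, ProjConn.diff,
      ← hf.integral_pushSection ⟨_, (D.pull hf).diff_mem (D'.pull hf) X⟩]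
    congr 2
    funext ψ z
    rw [pushSection_apply, coeff₁_push]
    by_cases hz : z ∈ (hf.pullCoord ψ).target
    · simp only
      rw [hf.pull_ρ_pullCoord D ψ hz, hf.pull_ρ_pullCoord D' ψ hz]
    · simp only [X.isTensor₁.zero _ z hz, mul_zero]

theorem pull_pull (hg : IsHolEmbedding g) (hf : IsHolEmbedding f) (D : ProjConn R) :
    (D.pull hg).pull hf = D.pull (hg.comp hf) := by
  refine ProjConn.ext (funext fun φ => funext fun z => ?_)
  by_cases hz : z ∈ φ.target
  · refine D.eq_of_isRestr (φ := hg.pushCoord (hf.pushCoord φ)) (ψ := (hg.comp hf).pushCoord φ)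
      (fun w hw => ⟨?_, rfl⟩) ?_
    · simpa only [pushCoord_target] using hw
    · simpa only [pushCoord_target] using hz
  · rw [((D.pull hg).pull hf).zero φ z hz, (D.pull (hg.comp hf)).zero φ z hz]

end IsHolEmbedding

theorem ProjConn.diff_self (D : ProjConn S) (X : Lc S) : D.diff D X = 0 := by
  rw [diff_eq]
  have : (⟨_, D.diff_mem D X⟩ : S.Sections 1 1) = 0 :=
    Subtype.ext (funext fun φ => funext fun z => by simp)
  rw [this, map_zero, mul_zero]

theorem ProjConn.diff_add_diff (D D' D'' : ProjConn S) (X : Lc S) :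
    D.diff D' X + D'.diff D'' X = D.diff D'' X := by
  simp only [diff_eq]
  rw [← mul_add, ← map_add]
  refine congrArg _ (congrArg _ (Subtype.ext (funext fun φ => funext fun z => ?_)))
  change (D.ρ φ z - D'.ρ φ z) * X.coeff₁ φ z + (D'.ρ φ z - D''.ρ φ z) * X.coeff₁ φ z
    = (D.ρ φ z - D''.ρ φ z) * X.coeff₁ φ z
  ring

theorem ProjConn.pull_id (D : ProjConn S) : D.pull (IsHolEmbedding.id S) = D := by
  refine ProjConn.ext (funext fun φ => funext fun z => ?_)
  by_cases hz : z ∈ φ.target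
  · have ht := (IsHolEmbedding.id S).pushCoord_target φ
    exact D.eq_of_isRestr (φ := (IsHolEmbedding.id S).pushCoord φ) (ψ := φ)
      (fun w hw => ⟨ht ▸ hw, rfl⟩) (ht.symm ▸ hz)
  · rw [(D.pull _).zero φ z hz, D.zero φ z hz]

/-! ## Functoriality of the central extensions -/

namespace Ext

variable {R : RiemannSurface.{u}} {f : S → T} {g : T → R}

theorem map_id (D : ProjConn S) : Ext.map (IsHolEmbedding.id S) D D = id := by
  funext x
  refine Prod.ext (IsHolEmbedding.push_id x.1) ?_
  change x.2 + (D.pull (IsHolEmbedding.id S)).diff D x.1 = x.2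
  rw [D.pull_id, D.diff_self, add_zero]

/-- The intermediate connection drops out: `Φ` commutes with pull-back (`diff_push`) and is additive
along a chain of connections (`diff_add_diff`). -/
theorem map_comp (hg : IsHolEmbedding g) (hf : IsHolEmbedding f) (D : ProjConn S) (D' : ProjConn T)
    (D'' : ProjConn R) :
    Ext.map (hg.comp hf) D D'' = Ext.map hg D' D'' ∘ Ext.map hf D D' := by
  funext x
  refine Prod.ext (hg.push_comp hf x.1) ?_
  change x.2 + (D''.pull (hg.comp hf)).diff D x.1
    = x.2 + (D'.pull hf).diff D x.1 + (D''.pull hg).diff D' (hf.push x.1)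
  rw [hf.diff_push, hg.pull_pull hf, ← ProjConn.diff_add_diff _ (D'.pull hf)]
  ring

theorem isDGLieHom_map (hf : IsHolEmbedding f) (D : ProjConn S) (D' : ProjConn T) :
    IsDGLieHom (Ext.deg S) Ext.d (Ext.bracket D) (Ext.deg T) Ext.d (Ext.bracket D')
      (Ext.map hf D D') where
  linear := by
    have l := (D'.pull hf).isLinearMap_diff D
    refine ⟨fun x y => Prod.ext (hf.isLinearMap_push.map_add x.1 y.1) ?_,
      fun a x => Prod.ext (hf.isLinearMap_push.map_smul a x.1) ?_⟩
    · change x.2 + y.2 + (D'.pull hf).diff D (x.1 + y.1)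
        = x.2 + (D'.pull hf).diff D x.1 + (y.2 + (D'.pull hf).diff D y.1)
      rw [l.map_add]
      ring
    · change a * x.2 + (D'.pull hf).diff D (a • x.1) = a * (x.2 + (D'.pull hf).diff D x.1)
      rw [l.map_smul, smul_eq_mul]
      ring
  map_deg i x hx := by
    obtain ⟨h1, h2⟩ := Ext.mem_deg_iff.1 hx
    refine Ext.mem_deg_iff.2 ⟨hf.push_mem_deg h1, fun hi => ?_⟩
    change x.2 + (D'.pull hf).diff D x.1 = 0
    rw [h2 hi, ProjConn.diff_of_snd _ _ (Lc.snd_eq_zero hi h1), add_zero]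
  map_d x := by
    refine Prod.ext (hf.push_dbar x.1) ?_
    change 0 + (D'.pull hf).diff D x.1.dbar = 0
    rw [ProjConn.diff_dbar, add_zero]
  map_br x y := by
    refine Prod.ext (hf.push_bracket x.1 y.1) ?_
    change D.omega x.1 y.1 + (D'.pull hf).diff D (x.1.bracket y.1)
      = D'.omega (hf.push x.1) (hf.push y.1)
    -- By naturality the right side is `ω` for the pulled-back connection, and the correction term
    -- in the map is precisely its difference from `ω_∇`.
    rw [hf.omega_push, ← ProjConn.omega_sub_omega]
    ring

end Ext

/-! ## Disjoint embeddings -/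

namespace IsHolEmbedding

variable {R : RiemannSurface.{u}} {f : S → R} {g : T → R}

/-- Vanishing of one element on a whole neighbourhood is needed because brackets and densities
involve derivatives. -/
theorem eventuallyEq_zero_or (hf : IsHolEmbedding f) (hg : IsHolEmbedding g)
    (hd : Disjoint (Set.range f) (Set.range g)) (X : Lc S) (Y : Lc T) {ψ : R.Coord} {z : ℂ}
    (hz : z ∈ ψ.target) :
    ((hf.push X).coeff₀ ψ =ᶠ[𝓝 z] 0 ∧ (hf.push X).coeff₁ ψ =ᶠ[𝓝 z] 0) ∨
      ((hg.push Y).coeff₀ ψ =ᶠ[𝓝 z] 0 ∧ (hg.push Y).coeff₁ ψ =ᶠ[𝓝 z] 0) := by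
  by_cases h : ψ.inv z ∈ Set.range f
  · have h' := Set.disjoint_left.1 hd h
    exact Or.inr ⟨hg.pushSection_eventuallyEq_zero Y.1 hz h',
      hg.pushSection_eventuallyEq_zero Y.2 hz h'⟩
  · exact Or.inl ⟨hf.pushSection_eventuallyEq_zero X.1 hz h,
      hf.pushSection_eventuallyEq_zero X.2 hz h⟩

theorem bracket_push_of_disjoint (hf : IsHolEmbedding f) (hg : IsHolEmbedding g)
    (hd : Disjoint (Set.range f) (Set.range g)) (X : Lc S) (Y : Lc T) :
    (hf.push X).bracket (hg.push Y) = 0 := by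
  refine Lc.ext_coeff (fun ψ z hz => ?_) (fun ψ z hz => ?_)
  · rw [Lc.coeff₀_bracket, Lc.coeff₀_zero]
    rcases hf.eventuallyEq_zero_or hg hd X Y hz with h | h
    · rw [planeBracket_congr h.1 .rfl, planeBracket_zero_left]
    · rw [planeBracket_congr .rfl h.1, planeBracket_zero_right]
  · rw [Lc.coeff₁_bracket_eq, Lc.coeff₁_zero, Pi.add_apply]
    rcases hf.eventuallyEq_zero_or hg hd X Y hz with h | h
    · rw [planeBracket_congr h.1 .rfl, planeBracket_congr h.2 .rfl, planeBracket_zero_left,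
        planeBracket_zero_left]
      simp
    · rw [planeBracket_congr .rfl h.1, planeBracket_congr .rfl h.2, planeBracket_zero_right,
        planeBracket_zero_right]
      simp

theorem omega_push_of_disjoint (hf : IsHolEmbedding f) (hg : IsHolEmbedding g)
    (hd : Disjoint (Set.range f) (Set.range g)) (D : ProjConn R) (X : Lc S) (Y : Lc T) :
    D.omega (hf.push X) (hg.push Y) = 0 := by
  refine D.omega_of_density (funext fun ψ => funext fun z => ?_)
  by_cases hz : z ∈ ψ.target
  · rcases hf.eventuallyEq_zero_or hg hd X Y hz with h | h
    · exact D.density_of_left _ h.1 h.2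
    · exact D.density_of_right _ h.1 h.2
  · exact (D.isTensor_density _ _).zero ψ z hz

/-- The restriction of a section to an open and closed subset. -/
def pullSection (hf : IsHolEmbedding f) (hc : IsClosed (Set.range f)) {p q : ℤ}
    (c : R.Sections p q) : S.Sections p q :=
  ⟨fun φ => c.1 (hf.pushCoord φ), ⟨fun φ => hf.pushCoord_target φ ▸ c.2.1.smooth (hf.pushCoord φ),
    fun φ z hz => c.2.1.zero _ z (by rwa [hf.pushCoord_target]), fun φ ψ z hz => by
      have h := c.2.1.law _ _ z (hf.pushCoord_overlap hz)
      rwa [hf.trans_pushCoord] at h⟩, by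
    obtain ⟨K, -, hK, h⟩ := c.2.2
    -- Closedness of the range makes `f` a closed embedding, so the preimage of a compact set is
    -- compact; for a general open range the restricted section need not have compact support.
    refine ⟨f ⁻¹' K, Set.subset_univ _,
      (Topology.IsClosedEmbedding.mk hf.isOpenEmbedding.isEmbedding hc).isCompact_preimage hK,
      fun φ z hz hn => h (hf.pushCoord φ) z (by rwa [hf.pushCoord_target]) hn⟩⟩

theorem pushSection_pullSection (hf : IsHolEmbedding f) (hc : IsClosed (Set.range f)) {p q : ℤ}
    (c : R.Sections p q) {ψ : R.Coord} {z : ℂ} (hz : z ∈ ψ.target) (hr : ψ.inv z ∈ Set.range f) :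
    (hf.pushSection (hf.pullSection hc c)).1 ψ z = c.1 ψ z := by
  have : Nonempty S := ⟨hr.choose⟩
  rw [pushSection_apply]
  exact c.2.1.eq_of_isRestr (hf.isRestr_pushCoord_pullCoord ψ)
    (by rw [hf.pushCoord_target]; exact (hf.mem_pullCoord_target ψ z).2 ⟨hz, hr⟩)

/-- Evaluated in a coordinate pushed forward along `f`, the summand from `g` vanishes and the other
one returns the coefficient of `c`. -/
theorem eq_zero_of_pushSection_add (hf : IsHolEmbedding f) (hg : IsHolEmbedding g)
    (hd : Disjoint (Set.range f) (Set.range g)) {p q : ℤ} {c : S.Sections p q}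
    {d : T.Sections p q} (h : hf.pushSection c + hg.pushSection d = 0) : c = 0 := by
  refine Subtype.ext (funext fun φ => funext fun z => ?_)
  by_cases hz : z ∈ φ.target
  · have h1 := congrArg (fun s : R.Sections p q => s.1 (hf.pushCoord φ) z) h
    have h2 : (hf.pushSection c).1 (hf.pushCoord φ) z + (hg.pushSection d).1 (hf.pushCoord φ) z = 0 :=
      h1
    have h3 : (hf.pushCoord φ).inv z ∉ Set.range g :=
      Set.disjoint_left.1 hd ⟨φ.inv z, rfl⟩
    rwa [hf.pushSection_pushCoord c φ hz, hg.pushSection_of_notMem_range d h3, add_zero] at h2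
  · exact c.2.1.zero φ z hz

theorem pushSection_add_pullSection (hf : IsHolEmbedding f) (hg : IsHolEmbedding g)
    (hd : Disjoint (Set.range f) (Set.range g)) (hu : Set.range f ∪ Set.range g = Set.univ)
    (hfc : IsClosed (Set.range f)) (hgc : IsClosed (Set.range g)) {p q : ℤ} (c : R.Sections p q) :
    hf.pushSection (hf.pullSection hfc c) + hg.pushSection (hg.pullSection hgc c) = c := by
  refine Subtype.ext (funext fun ψ => funext fun z => ?_)
  change (hf.pushSection (hf.pullSection hfc c)).1 ψ z
    + (hg.pushSection (hg.pullSection hgc c)).1 ψ z = c.1 ψ z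
  by_cases hz : z ∈ ψ.target
  · rcases hu.symm ▸ Set.mem_univ (ψ.inv z) with h | h
    · rw [hf.pushSection_pullSection hfc c hz h,
        hg.pushSection_of_notMem_range _ (Set.disjoint_left.1 hd h), add_zero]
    · rw [hg.pushSection_pullSection hgc c hz h,
        hf.pushSection_of_notMem_range _ (Set.disjoint_right.1 hd h), zero_add]
  · rw [(hf.pushSection _).2.1.zero ψ z hz, (hg.pushSection _).2.1.zero ψ z hz, add_zero,
      c.2.1.zero ψ z hz]

theorem bijective_push_add_push (hf : IsHolEmbedding f) (hg : IsHolEmbedding g)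
    (hd : Disjoint (Set.range f) (Set.range g)) (hu : Set.range f ∪ Set.range g = Set.univ) :
    Function.Bijective (fun p : Lc S × Lc T => hf.push p.1 + hg.push p.2) := by
  -- Two complementary open sets are both closed, as restriction of sections requires.
  have hcompl : (Set.range f)ᶜ = Set.range g := (IsCompl.of_eq hd.inter_eq hu).compl_eq
  have hgc : IsClosed (Set.range g) := hcompl ▸ hf.isOpenEmbedding.isOpen_range.isClosed_compl
  have hfc : IsClosed (Set.range f) := by
    rw [← isOpen_compl_iff, hcompl]
    exact hg.isOpenEmbedding.isOpen_range
  constructor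
  · let L : Lc S × Lc T →+ Lc R :=
      AddMonoidHom.mk' (fun p => hf.push p.1 + hg.push p.2) fun p q => by
        rw [Prod.fst_add, Prod.snd_add, hf.isLinearMap_push.map_add, hg.isLinearMap_push.map_add]
        abel
    refine (injective_iff_map_eq_zero L).2 fun p hp => ?_
    have h1 : hf.pushSection p.1.1 + hg.pushSection p.2.1 = 0 := congrArg Prod.fst hp
    have h2 : hf.pushSection p.1.2 + hg.pushSection p.2.2 = 0 := congrArg Prod.snd hp
    exact Prod.ext
      (Prod.ext (hf.eq_zero_of_pushSection_add hg hd h1) (hf.eq_zero_of_pushSection_add hg hd h2))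
      (Prod.ext (hg.eq_zero_of_pushSection_add hf hd.symm ((add_comm _ _).trans h1))
        (hg.eq_zero_of_pushSection_add hf hd.symm ((add_comm _ _).trans h2)))
  · intro Z
    exact ⟨((hf.pullSection hfc Z.1, hf.pullSection hfc Z.2),
      (hg.pullSection hgc Z.1, hg.pullSection hgc Z.2)),
      Prod.ext (hf.pushSection_add_pullSection hg hd hu hfc hgc Z.1)
        (hf.pushSection_add_pullSection hg hd hu hfc hgc Z.2)⟩

end IsHolEmbedding

end RiemannSurface

end

theorem mainTheorem6 :
    -- in each coordinate, `ω_∇` is a cocycle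
    (∀ (S : RiemannSurface.{u}) (D : ProjConn S) (φ : S.Coord),
      IsCocycle (Lc.deg S) Lc.dbar Lc.bracket (Lc.on φ.source) (D.omegaLocal φ)) ∧
    -- it does not depend on the coordinate
    (∀ (S : RiemannSurface.{u}) (D : ProjConn S) (φ ψ : S.Coord),
      ∀ X ∈ Lc.on (φ.source ∩ ψ.source), ∀ Y ∈ Lc.on (φ.source ∩ ψ.source),
        D.omegaLocal φ X Y = D.omegaLocal ψ X Y) ∧
    -- hence it is globally defined on `S`, as the integral of a `(1,1)`-form
    (∀ (S : RiemannSurface.{u}) (D : ProjConn S),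
      (∀ X Y, D.density X Y ∈ S.Sections 1 1) ∧
      (∀ φ : S.Coord, ∀ X ∈ Lc.on φ.source, ∀ Y ∈ Lc.on φ.source,
        D.omega X Y = D.omegaLocal φ X Y) ∧
      IsCocycle (Lc.deg S) Lc.dbar Lc.bracket ⊤ D.omega) ∧
    -- and it is natural for holomorphic embeddings
    (∀ (S T : RiemannSurface.{u}) (f : S → T) (hf : IsHolEmbedding f) (D : ProjConn T) (X Y : Lc S),
      D.omega (hf.push X) (hf.push Y) = (D.pull hf).omega X Y) ∧
    -- changing the projective connection changes `ω_∇` by a coboundary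
    (∀ (S : RiemannSurface.{u}) (D D' : ProjConn S),
      IsCoboundaryOf (Lc.deg S) Lc.dbar Lc.bracket ⊤ (D.diff D')
        (fun X Y => D.omega X Y - D'.omega X Y) ∧
      ∀ φ : S.Coord, IsCoboundaryOf (Lc.deg S) Lc.dbar Lc.bracket (Lc.on φ.source)
        (fun X => D.pairLocal φ X - D'.pairLocal φ X)
        (fun X Y => D.omegaLocal φ X Y - D'.omegaLocal φ X Y)) ∧
    -- universality: the central extensions are dg Lie algebras, and they are functorial for all
    -- holomorphic embeddings, whatever projective connections are chosen on the two surfaces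
    (∀ (S : RiemannSurface.{u}) (D : ProjConn S),
      IsDGLie (Ext.deg S) Ext.d (Ext.bracket D) ∧
      Ext.map (IsHolEmbedding.id S) D D = id) ∧
    (∀ (S T : RiemannSurface.{u}) (f : S → T) (hf : IsHolEmbedding f) (D : ProjConn S)
        (D' : ProjConn T),
      IsDGLieHom (Ext.deg S) Ext.d (Ext.bracket D) (Ext.deg T) Ext.d (Ext.bracket D')
        (Ext.map hf D D')) ∧
    (∀ (S T R : RiemannSurface.{u}) (f : S → T) (g : T → R) (hf : IsHolEmbedding f)
        (hg : IsHolEmbedding g) (D : ProjConn S) (D' : ProjConn T) (D'' : ProjConn R),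
      Ext.map (hg.comp hf) D D'' = Ext.map hg D' D'' ∘ Ext.map hf D D') ∧
    -- surfaces embedded disjointly give commuting subalgebras, and a disjoint union gives a direct sum
    (∀ (S T R : RiemannSurface.{u}) (f : S → R) (g : T → R) (hf : IsHolEmbedding f)
        (hg : IsHolEmbedding g), Disjoint (Set.range f) (Set.range g) →
      (∀ (D : ProjConn S) (D' : ProjConn T) (D'' : ProjConn R) (x : Ext S) (y : Ext T),
        Ext.bracket D'' (Ext.map hf D D'' x) (Ext.map hg D' D'' y) = 0) ∧
      (Set.range f ∪ Set.range g = Set.univ →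
        Function.Bijective (fun p : Lc S × Lc T => hf.push p.1 + hg.push p.2))) := by
  refine ⟨fun S D φ => D.isCocycle_omegaLocal φ,
    fun S D φ ψ X hX Y hY => D.omegaLocal_eq_omegaLocal φ ψ hX hY,
    fun S D => ⟨D.density_mem, fun φ X hX Y hY => D.omega_eq_omegaLocal hX hY, D.isCocycle_omega⟩,
    fun S T f hf D X Y => hf.omega_push D X Y,
    fun S D D' => ⟨D.isCoboundaryOf_diff D', D.isCoboundaryOf_pairLocal D'⟩,
    fun S D => ⟨Ext.isDGLie D, Ext.map_id D⟩,
    fun S T f hf D D' => Ext.isDGLieHom_map hf D D',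
    fun S T R f g hf hg D D' D'' => Ext.map_comp hg hf D D' D'',
    fun S T R f g hf hg hd => ⟨fun D D' D'' x y => ?_, hf.bijective_push_add_push hg hd⟩⟩
  -- The central components of the two arguments, including the corrections by `Φ`, do not enter the
  -- bracket.
  exact Prod.ext (hf.bracket_push_of_disjoint hg hd x.1 y.1)
    (hf.omega_push_of_disjoint hg hd D'' x.1 y.1)
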